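/- A \emph{tubular graph of graphs} $X$ is a finite graph of spaces with connected underlying graph (loops and multiple edges allowed) in which every vertex space $X_s$ is a finite connected simplicial graph, every edge space $X_a$ is a simplicial circle, and the two attaching maps of every edge space are simplicial immersions. Its geometric realisation, also denoted $X$, is a square complex: each tube $X_a\times[0,1]$ contributes one square for every edge of $X_a$ and one horizontal edge for every vertex of $X_a$. The \emph{link} of a vertex is the graph whose vertices are the half-edges incident to it, two of them being joined for each square in which they are adjacent. $X$ is \emph{Brady--Meier} if every vertex link is connected and remains connected after removing any simplex (vertex or closed edge) of the link; here the empty graph is not considered connected. The \emph{incident edge cycles} of a vertex graph $X_s$ are the immersed cycles $X_a\to X_s$, one for each end at $s$ of an edge $a$ of the underlying graph (so a loop at $s$ contributes two). The \emph{double} of $X_s$ consists of two copies of the graph $X_s$ joined by one tube for each incident edge cycle $C$, the tube being attached along $C$ on both sides. The vertex graph $X_s$ is a \emph{surface graph} if $\pi_1(X_s)$ is a surface group whose peripheral subgroups are precisely the incident edge subgroups, that is: there are a compact connected surface $S$ (possibly with boundary), an isomorphism $\varphi:\pi_1(X_s)\to\pi_1(S)$, and a bijection from the family of incident edge cycles to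 the set of boundary circles of $S$, such that for each incident edge cycle $\varphi$ carries the conjugacy class of cyclic subgroups of $\pi_1(X_s)$ that it determines to the conjugacy class of subgroups of $\pi_1(S)$ determined by the corresponding boundary circle. (A circle may thus be a surface graph, $S$ being then an annulus or a M\"obius band.) \textbf{Lemma.} Let $X$ be a Brady--Meier tubular graph of graphs and let $X_s$ be a vertex graph of $X$. Then $X_s$ is a surface graph if and only if every edge of the double of $X_s$ is contained in exactly two squares. -/

import Mathlib

universe u v w

/-! ## Edge-path groups

For a simplicial complex of dimension at most two, given by its 1-skeleton `G` and the set `T` of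
vertex sets of its 2-simplices, the fundamental group is the group of closed edge paths modulo
backtracking and pushing across 2-simplices. A graph is the case `T = ∅`. -/

namespace EdgePath

variable {V : Type*} (G : SimpleGraph V) (T : Set (Set V))

/-- Homotopy of edge paths relative to their endpoints. -/
inductive Homotopic : ∀ {a b : V}, G.Walk a b → G.Walk a b → Prop
  | refl {a b : V} (p : G.Walk a b) : Homotopic p p
  | symm {a b : V} {p q : G.Walk a b} : Homotopic p q → Homotopic q p
  | trans {a b : V} {p q r : G.Walk a b} : Homotopic p q → Homotopic q r → Homotopic p r
  | cons {a b c : V} (h : G.Adj a b) {p q : G.Walk b c} :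
      Homotopic p q → Homotopic (.cons h p) (.cons h q)
  | backtrack {a b c : V} (h : G.Adj a b) (p : G.Walk a c) :
      Homotopic (.cons h (.cons h.symm p)) p
  | triangle {a b c d : V} (hab : G.Adj a b) (hbc : G.Adj b c) (hac : G.Adj a c)
      (ht : ({a, b, c} : Set V) ∈ T) (p : G.Walk c d) :
      Homotopic (.cons hab (.cons hbc p)) (.cons hac p)

variable {G T}

theorem Homotopic.append_right {a b c : V} {p q : G.Walk a b} (h : Homotopic G T p q)
    (r : G.Walk b c) : Homotopic G T (p.append r) (q.append r) := by
  induction h with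
  | refl p => exact .refl _
  | symm _ ih => exact (ih r).symm
  | trans _ _ ih₁ ih₂ => exact (ih₁ r).trans (ih₂ r)
  | cons h _ ih => exact .cons h (ih r)
  | backtrack h p => exact .backtrack h _
  | triangle hab hbc hac ht p => exact .triangle hab hbc hac ht _

theorem Homotopic.append_left {a b c : V} (r : G.Walk a b) {p q : G.Walk b c}
    (h : Homotopic G T p q) : Homotopic G T (r.append p) (r.append q) := by
  induction r with
  | nil => exact h
  | cons h' r ih => exact .cons h' (ih h)

theorem Homotopic.append {a b c : V} {p p' : G.Walk a b} {q q' : G.Walk b c}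
    (hp : Homotopic G T p p') (hq : Homotopic G T q q') :
    Homotopic G T (p.append q) (p'.append q') :=
  (hp.append_right q).trans (Homotopic.append_left p' hq)

theorem Homotopic.reverse_append_self {a b : V} (p : G.Walk a b) :
    Homotopic G T (p.reverse.append p) .nil := by
  induction p with
  | nil => exact .refl _
  | cons h p ih =>
    rw [SimpleGraph.Walk.reverse_cons, ← SimpleGraph.Walk.append_assoc]
    exact (Homotopic.append_left _ (.backtrack h.symm p)).trans ih

theorem Homotopic.append_reverse_self {a b : V} (p : G.Walk a b) :
    Homotopic G T (p.append p.reverse) .nil := by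
  simpa using Homotopic.reverse_append_self (T := T) p.reverse

theorem Homotopic.reverse {a b : V} {p q : G.Walk a b} (h : Homotopic G T p q) :
    Homotopic G T p.reverse q.reverse := by
  have h₁ : Homotopic G T (p.reverse.append (q.append q.reverse)) p.reverse := by
    simpa using Homotopic.append_left p.reverse (Homotopic.append_reverse_self (T := T) q)
  have h₂ : Homotopic G T (p.reverse.append (q.append q.reverse)) q.reverse := by
    rw [SimpleGraph.Walk.append_assoc]
    exact ((Homotopic.append_left p.reverse h.symm).trans
      (Homotopic.reverse_append_self p)).append_right q.reverse
  exact h₁.symm.trans h₂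

variable (G T)

/-- Homotopy of closed edge paths at `x`, as a setoid. -/
def loopSetoid (x : V) : Setoid (G.Walk x x) where
  r := Homotopic G T
  iseqv := ⟨.refl, .symm, .trans⟩

/-- The fundamental group (edge-path group) at the vertex `x`. -/
def Pi1 (x : V) : Type _ := Quotient (loopSetoid G T x)

variable {G T}

/-- The class of a closed edge path. -/
def Pi1.mk {x : V} (p : G.Walk x x) : Pi1 G T x := Quotient.mk (loopSetoid G T x) p

/-- Concatenation of paths makes the edge-path group a group. -/
instance {x : V} : Group (Pi1 G T x) where
  mul := Quotient.map₂ (fun p q => p.append q) fun _ _ hp _ _ hq => Homotopic.append hp hq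
  one := Pi1.mk .nil
  inv := Quotient.map (fun p => p.reverse) fun _ _ h => Homotopic.reverse h
  mul_assoc := by
    rintro ⟨p⟩ ⟨q⟩ ⟨r⟩
    exact congrArg Pi1.mk (p.append_assoc q r).symm
  one_mul := by
    rintro ⟨p⟩
    rfl
  mul_one := by
    rintro ⟨p⟩
    exact congrArg Pi1.mk p.append_nil
  inv_mul_cancel := by
    rintro ⟨p⟩
    exact Quotient.sound (Homotopic.reverse_append_self p)

variable (T)

/-- For a graph map `f : C → G`, a vertex `i` of `C` and a path `p` in `G` from the base point `x`
to `f i`, the subgroup of `π₁(G, x)` of all loops `p · f(γ) · p⁻¹`, where `γ` is a closed path in `C`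
based at `i`; that is, the image of `π₁(C, i)` transported along `p`. -/
def loopSubgroup {W : Type*} {C : SimpleGraph W} (f : C →g G) {x : V} (i : W)
    (p : G.Walk x (f i)) : Subgroup (Pi1 G T x) :=
  Subgroup.closure
    {g | ∃ γ : C.Walk i i, g = Pi1.mk (p.append ((γ.map f).append p.reverse))}

end EdgePath

/-! ## Compact surfaces -/

/-- A compact connected surface, possibly with boundary, presented by a finite triangulation: a
finite two-dimensional simplicial complex (given by the vertex sets of its triangles) that is
connected, in which every edge lies in one or two triangles and every vertex link is connected.
Every vertex link is then an arc or a circle. -/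
structure TriangulatedSurface where
  /-- The vertices. -/
  V : Type
  finite : Finite V
  /-- The vertex sets of the triangles. -/
  triangles : Set (Set V)
  card_triangle : ∀ t ∈ triangles, t.ncard = 3
  /-- An edge joins two vertices of a common triangle; the 1-skeleton is connected. -/
  connected : (SimpleGraph.fromRel fun a b => ∃ t ∈ triangles, a ∈ t ∧ b ∈ t).Connected
  edge_le_two : ∀ a b, a ≠ b → {t ∈ triangles | a ∈ t ∧ b ∈ t}.ncard ≤ 2
  /-- The link of `a` has as vertices the neighbours of `a`, joined when they span a triangle with
  `a`. -/
  link_connected : ∀ a,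
    (SimpleGraph.fromRel fun b c : {b // b ≠ a ∧ ∃ t ∈ triangles, a ∈ t ∧ b ∈ t} =>
      ({a, b.1, c.1} : Set V) ∈ triangles).Connected

namespace TriangulatedSurface

variable (S : TriangulatedSurface)

/-- The 1-skeleton. -/
def skeleton : SimpleGraph S.V :=
  SimpleGraph.fromRel fun a b => ∃ t ∈ S.triangles, a ∈ t ∧ b ∈ t

/-- The boundary, as a graph: the edges that lie in exactly one triangle. -/
def boundary : SimpleGraph S.V :=
  SimpleGraph.fromRel fun a b => {t ∈ S.triangles | a ∈ t ∧ b ∈ t}.ncard = 1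

theorem boundary_le : S.boundary ≤ S.skeleton := by
  have key : ∀ a b, {t ∈ S.triangles | a ∈ t ∧ b ∈ t}.ncard = 1 →
      ∃ t ∈ S.triangles, a ∈ t ∧ b ∈ t := by
    intro a b h
    obtain ⟨t, ht⟩ := Set.ncard_eq_one.1 h
    have : t ∈ {t ∈ S.triangles | a ∈ t ∧ b ∈ t} := ht ▸ rfl
    exact ⟨t, this.1, this.2⟩
  intro a b h
  rw [boundary, SimpleGraph.fromRel_adj] at h
  rw [skeleton, SimpleGraph.fromRel_adj]
  exact ⟨h.1, h.2.imp (key a b) (key b a)⟩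

/-- The boundary circles: components of the boundary graph that contain an edge. -/
def BoundaryComponent : Type :=
  {c : S.boundary.ConnectedComponent // ∃ i ∈ S.boundary.support, S.boundary.connectedComponentMk i = c}

/-- The fundamental group of the surface. -/
abbrev Pi1 (x : S.V) : Type := EdgePath.Pi1 S.skeleton S.triangles x

/-- The peripheral subgroups of a boundary circle: the conjugacy class of subgroups of the
fundamental group carried by that circle. -/
def peripheralSubgroups (c : S.BoundaryComponent) (x : S.V) : Set (Subgroup (S.Pi1 x)) :=
  {H | ∃ (i : S.V) (_ : S.boundary.connectedComponentMk i = c.1) (p : S.skeleton.Walk x i),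
    H = EdgePath.loopSubgroup S.triangles (SimpleGraph.Hom.ofLE S.boundary_le) i p}

end TriangulatedSurface

/-! ## Graphs with immersed cycles, and surface graphs -/

/-- A simplicial immersion of a simplicial circle (a cycle graph with at least three vertices) in a
graph: a graph map that is injective on the neighbours of each vertex. -/
structure ImmersedCycle {W : Type w} (Γ : SimpleGraph W) where
  /-- The number of edges of the circle. -/
  len : ℕ
  three_le_len : 3 ≤ len
  /-- The graph map. -/
  toHom : SimpleGraph.cycleGraph len →g Γ
  immersion : ∀ i j k, (SimpleGraph.cycleGraph len).Adj i j → (SimpleGraph.cycleGraph len).Adj i k →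
    toHom j = toHom k → j = k

namespace SimpleGraph

variable {W : Type w} (Γ : SimpleGraph W)

/-- The fundamental group of a graph. -/
abbrev Pi1 (x : W) : Type _ := EdgePath.Pi1 Γ ∅ x

/-- The conjugacy class of subgroups of `π₁(Γ, x)` carried by an immersed cycle. -/
def cycleSubgroups {Γ : SimpleGraph W} (C : ImmersedCycle Γ) (x : W) : Set (Subgroup (Γ.Pi1 x)) :=
  {H | ∃ (i : Fin C.len) (p : Γ.Walk x (C.toHom i)), H = EdgePath.loopSubgroup ∅ C.toHom i p}

/-- The graph `Γ` with the family `C` of immersed cycles is of surface type: there are a compact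
connected surface, an isomorphism from `π₁(Γ)` to the fundamental group of the surface, and a
bijection from the family of cycles to the boundary circles, under which the subgroups carried by
each cycle go to the peripheral subgroups of the corresponding boundary circle. -/
def IsSurfaceWithPeripheral {ι : Type*} (C : ι → ImmersedCycle Γ) : Prop :=
  ∃ (S : TriangulatedSurface) (x : W) (y : S.V) (φ : Γ.Pi1 x ≃* S.Pi1 y)
    (β : ι ≃ S.BoundaryComponent), ∀ i,
      (fun H => Subgroup.map φ.toMonoidHom H) '' cycleSubgroups (C i) x =
        S.peripheralSubgroups (β i) y

end SimpleGraph

/-! ## Tubular graphs of graphs -/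

/-- A finite graph of spaces whose vertex spaces are finite connected simplicial graphs, whose edge
spaces are simplicial circles, and whose attaching maps are simplicial immersions. Connectedness of
the underlying graph is the separate predicate `UnderlyingConnected`. -/
structure TubularGraphOfGraphs : Type (max (u + 1) (v + 1) (w + 1)) where
  /-- Vertices of the underlying graph. -/
  V : Type u
  /-- Edges of the underlying graph (loops and multiple edges are allowed). -/
  E : Type v
  finite_V : Finite V
  finite_E : Finite E
  /-- The two endpoints of an edge. -/
  endpt : E → Bool → V
  /-- The vertex set of a vertex graph. -/
  Vert : V → Type w
  finite_Vert : ∀ s, Finite (Vert s)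
  /-- The vertex graphs. -/
  graph : ∀ s, SimpleGraph (Vert s)
  graph_connected : ∀ s, (graph s).Connected
  /-- The edge graph of `a` is the cycle graph with `len a` vertices. -/
  len : E → ℕ
  three_le_len : ∀ a, 3 ≤ len a
  /-- The two attaching maps of an edge graph. -/
  attach : ∀ a b, SimpleGraph.cycleGraph (len a) →g graph (endpt a b)
  immersion : ∀ a b i j k, (SimpleGraph.cycleGraph (len a)).Adj i j →
    (SimpleGraph.cycleGraph (len a)).Adj i k → attach a b j = attach a b k → j = k

namespace TubularGraphOfGraphs

section

variable (X : TubularGraphOfGraphs.{u, v, w})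

/-- The underlying graph is connected (and non-empty). -/
def UnderlyingConnected : Prop :=
  (SimpleGraph.fromRel fun s t => ∃ a, X.endpt a false = s ∧ X.endpt a true = t).Connected

/-! ### The geometric realisation as a square complex

Its vertices and vertical edges are those of the vertex graphs; the tube of `a` (the edge graph of
`a` times an interval) contributes a horizontal edge for each vertex and a square for each edge of
the edge graph. -/

/-- Vertices of the square complex. -/
def Vertex : Type _ := Σ s, X.Vert s

/-- Edges of the square complex: vertical ones and horizontal ones. -/
def Edge : Type _ := (Σ s, (X.graph s).edgeSet) ⊕ (Σ a, Fin (X.len a))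

/-- Squares of the square complex. -/
def Square : Type _ := Σ a, (SimpleGraph.cycleGraph (X.len a)).edgeSet

/-- `X.Contains q e`: the edge `e` is a side of the square `q`. The vertical sides of the square over
an edge of an edge graph are its images under the two attaching maps; its horizontal sides are the
horizontal edges over the two endpoints. -/
def Contains (q : X.Square) : X.Edge → Prop
  | .inl f => ∃ b, (⟨X.endpt q.1 b, (X.attach q.1 b).mapEdgeSet q.2⟩ :
      Σ s, (X.graph s).edgeSet) = f
  | .inr h => ∃ i ∈ q.2.1, (⟨q.1, i⟩ : Σ a, Fin (X.len a)) = h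

/-- The thickness of an edge: the number of squares that contain it. -/
noncomputable def thickness (e : X.Edge) : ℕ := Nat.card {q : X.Square // X.Contains q e}

/-- Half-edges of the square complex: the oriented vertical edges (standing for their initial
halves), and for each horizontal edge its halves at the two ends `b` of the tube. -/
def HalfEdge : Type _ := (Σ s, (X.graph s).Dart) ⊕ (Σ a, Bool × Fin (X.len a))

/-- The vertex at which a half-edge is incident. -/
def base : X.HalfEdge → X.Vertex
  | .inl d => ⟨d.1, d.2.fst⟩
  | .inr h => ⟨X.endpt h.1 h.2.1, X.attach h.1 h.2.1 h.2.2⟩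

/-- A vertical and a horizontal half-edge that are adjacent in some square: the square over the edge
`{i, j}` of an edge graph has at its corner `(i, b)` the horizontal half-edge over `i` at the end `b`
and the half-edge starting the image of the oriented edge `(i, j)`. -/
def IsCorner : X.HalfEdge → X.HalfEdge → Prop
  | .inl d, .inr h => ∃ (j : Fin (X.len h.1))
      (hij : (SimpleGraph.cycleGraph (X.len h.1)).Adj h.2.2 j),
      (⟨X.endpt h.1 h.2.1, (X.attach h.1 h.2.1).mapDart ⟨(h.2.2, j), hij⟩⟩ :
        Σ s, (X.graph s).Dart) = d
  | _, _ => False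

/-- The disjoint union of all vertex links (two half-edges lie in at most one common corner, because
the attaching maps are immersions, so links have no multiple edges). -/
def links : SimpleGraph X.HalfEdge := SimpleGraph.fromRel X.IsCorner

/-- The link of the vertex `x` with the half-edges in `σ` removed. -/
def linkMinus (x : X.Vertex) (σ : Set X.HalfEdge) : SimpleGraph {η | X.base η = x ∧ η ∉ σ} :=
  X.links.induce _

/-- Brady-Meier: every vertex link is connected, and remains connected after the removal of any
simplex (vertex or closed edge). The empty graph is not connected. -/
def IsBradyMeier : Prop :=
  ∀ x : X.Vertex, (X.linkMinus x ∅).Connected ∧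
    (∀ η, X.base η = x → (X.linkMinus x {η}).Connected) ∧
    (∀ η ζ, X.base η = x → X.base ζ = x → X.links.Adj η ζ → (X.linkMinus x {η, ζ}).Connected)

/-- The incidences of edges of the underlying graph with the vertex `s` (a loop at `s` has two). -/
def Incidence (s : X.V) : Type _ := {h : X.E × Bool // X.endpt h.1 h.2 = s}

/-- The attaching map at the end `b` of the tube of `a`, as an immersed cycle. -/
def tubeCycle (a : X.E) (b : Bool) : ImmersedCycle (X.graph (X.endpt a b)) :=
  ⟨X.len a, X.three_le_len a, X.attach a b, X.immersion a b⟩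

/-- The incident edge cycles of a vertex graph, one for each incidence. -/
def incidentCycle (s : X.V) (h : X.Incidence s) : ImmersedCycle (X.graph s) :=
  h.2 ▸ X.tubeCycle h.1.1 h.1.2

/-- The vertex graph at `s` is a surface graph: its fundamental group is a surface group whose
peripheral subgroups are precisely the incident edge subgroups. -/
def IsSurfaceGraph (s : X.V) : Prop := (X.graph s).IsSurfaceWithPeripheral (X.incidentCycle s)

end

/-- The double of a finite connected graph with a finite family of immersed cycles: two copies of
the graph, joined by one tube for each cycle, attached along that cycle on both sides. -/
def double {W : Type w} (hW : Finite W) (Γ : SimpleGraph W) (hΓ : Γ.Connected) {ι : Type v}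
    (hι : Finite ι) (C : ι → ImmersedCycle Γ) : TubularGraphOfGraphs.{0, v, w} where
  V := Bool
  E := ι
  finite_V := inferInstance
  finite_E := hι
  endpt _ b := b
  Vert _ := W
  finite_Vert _ := hW
  graph _ := Γ
  graph_connected _ := hΓ
  len i := (C i).len
  three_le_len i := (C i).three_le_len
  attach i _ := (C i).toHom
  immersion i _ := (C i).immersion

variable (X : TubularGraphOfGraphs.{u, v, w})

theorem finite_incidence (s : X.V) : Finite (X.Incidence s) :=
  have := X.finite_E
  Subtype.finite

/-- The double of the vertex graph at `s` with its incident edge cycles. -/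
def vertexDouble (s : X.V) : TubularGraphOfGraphs.{0, v, w} :=
  double (X.finite_Vert s) (X.graph s) (X.graph_connected s) (X.finite_incidence s)
    (X.incidentCycle s)

end TubularGraphOfGraphs

/-!
Horizontal half-edges have degree two in the link of a vertex `v` of `X_s`, so that the link is the
subdivision of a Whitehead graph: the vertices of the latter are the neighbours of `v` in `X_s`, its edges
the passages of incident cycles through `v`. The Brady–Meier condition makes every Whitehead graph
connected without cut vertices, and makes the incident cycles pass every oriented edge of `X_s` at least
twice (`IsBradyMeier.isBiconnected`). In the double, a horizontal edge always lies in two squares, and a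
vertical edge in as many squares as there are passages through it (`double_thickness_eq_two_iff`). The
claim is therefore that `X_s` is a surface graph if and only if every edge is passed exactly twice.

If every edge is passed exactly twice, the surface is the mapping cylinder of the cycles, triangulated by
cutting each square along a diagonal. Its vertex links are connected because the Whitehead graphs are, its
boundary edges are the edges of the cycles, and the retraction onto `X_s` identifies the fundamental
groups (`MappingCylinder.surface`, `exists_comp_eq`, `homotopic_of_map`,
`isSurfaceWithPeripheral_of_bijection`).

Conversely, let the fundamental group of `X_s` be that of a surface `S` with the cycles as boundary, and
suppose that three passages run through the edge `v w`. They lie on three different lifts of cycles to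
the universal cover of `X_s`, a tree, and lifts of cycles correspond to boundary lines of the universal
cover of `S` (`SurfaceMarking.reachable_iff`). The proof uses cochains modulo two.

* An arc that joins the boundary lines of the first two passages crosses finitely many edges. The
  indicator of these edges is a finite cocycle that meets the boundary in two edges only, one on either
  line (`exists_cocycle`). It is built without geometry: triangles that share an edge are cohomologous,
  so all triangles are, since links and the 1-skeleton are connected.
* Since the universal cover is simply connected, the cocycle is the coboundary of a function `F`
  (`IsCocycle.exists_potential`). Transported to the tree, `F` is locally constant off a finite set, and
  it takes the same value at both ends of every lift of a cycle except possibly for the two chosen ones.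
* Consequently `F` is constant at infinity (`exists_eventually_const`). By induction towards the root,
  all branches at a vertex of the tree have the same limit, because the Whitehead graph stays connected
  after removal of the neighbour towards the root; the third passage connects the two sides of the edge
  `v w` at the root.
* Thus `F` is constant off a finite set of the universal cover of `S`, while on the first boundary line it
  jumps along exactly one edge. The finitely many vertices of that line with the exceptional value would
  have an odd number of boundary edges leaving them, but every vertex has evenly many boundary edges
  (`even_boundary_neighborSet`, `not_finite_of_single_edge`).
-/

/-! ### Homotopy classes of edge paths -/

namespace EdgePath

variable {V : Type*} {G : SimpleGraph V} {T : Set (Set V)}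

variable (G T) in
/-- Homotopy of edge paths from `a` to `b`, as a setoid. -/
def pathSetoid (a b : V) : Setoid (G.Walk a b) where
  r := Homotopic G T
  iseqv := ⟨.refl, .symm, .trans⟩

variable (G T) in
/-- The homotopy classes of edge paths from `a` to `b`. For `a = b` this unfolds to `Pi1 G T a`. The
pairs `⟨a, u⟩` with `u : Cls G T a y` are the vertices of the universal cover with base point `y`. -/
def Cls (a b : V) : Type _ := Quotient (pathSetoid G T a b)

namespace Cls

/-- The class of an edge path. -/
def mk {a b : V} (p : G.Walk a b) : Cls G T a b := Quotient.mk (pathSetoid G T a b) p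

/-- Concatenation of classes of edge paths. -/
def comp {a b c : V} : Cls G T a b → Cls G T b c → Cls G T a c :=
  Quotient.map₂ (fun p q => p.append q) fun _ _ hp _ _ hq => Homotopic.append hp hq

/-- The class of the reversed paths. -/
def inv {a b : V} : Cls G T a b → Cls G T b a :=
  Quotient.map (fun p => p.reverse) fun _ _ h => Homotopic.reverse h

end Cls

infixr:75 " ⬝ " => Cls.comp

namespace Cls

variable {a b c d : V}

theorem ind {P : Cls G T a b → Prop} (h : ∀ p, P (mk p)) (u) : P u := Quotient.ind h u

theorem exists_rep (u : Cls G T a b) : ∃ p, mk p = u := Quotient.exists_rep u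

theorem mk_eq_mk {p q : G.Walk a b} : (mk p : Cls G T a b) = mk q ↔ Homotopic G T p q :=
  ⟨fun h => Quotient.exact h, fun h => Quotient.sound h⟩

theorem mk_append (p : G.Walk a b) (q : G.Walk b c) :
    (mk (p.append q) : Cls G T a c) = mk p ⬝ mk q := rfl

theorem mk_reverse (p : G.Walk a b) : (mk p.reverse : Cls G T b a) = (mk p).inv := rfl

theorem mk_cons (h : G.Adj a b) (q : G.Walk b c) :
    (mk (.cons h q) : Cls G T a c) = mk h.toWalk ⬝ mk q := rfl

theorem comp_assoc (u : Cls G T a b) (v : Cls G T b c) (w : Cls G T c d) :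
    (u ⬝ v) ⬝ w = u ⬝ (v ⬝ w) := by
  induction u using ind; induction v using ind; induction w using ind
  simp only [← mk_append, SimpleGraph.Walk.append_assoc]

theorem nil_comp (u : Cls G T a b) : mk .nil ⬝ u = u := by
  induction u using ind; rfl

theorem comp_nil (u : Cls G T a b) : u ⬝ mk .nil = u := by
  induction u using ind
  simp only [← mk_append, SimpleGraph.Walk.append_nil]

theorem inv_comp (u : Cls G T a b) : u.inv ⬝ u = mk .nil := by
  induction u using ind with | h p =>
  exact mk_eq_mk.2 (Homotopic.reverse_append_self p)

theorem comp_inv (u : Cls G T a b) : u ⬝ u.inv = mk .nil := by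
  induction u using ind with | h p =>
  exact mk_eq_mk.2 (Homotopic.append_reverse_self p)

theorem inv_comp_assoc (u : Cls G T a b) (v : Cls G T b c) : u.inv ⬝ (u ⬝ v) = v := by
  rw [← comp_assoc, inv_comp, nil_comp]

theorem comp_inv_assoc (u : Cls G T a b) (v : Cls G T a c) : u ⬝ (u.inv ⬝ v) = v := by
  rw [← comp_assoc, comp_inv, nil_comp]

theorem inv_inv (u : Cls G T a b) : u.inv.inv = u := by
  induction u using ind with | h p =>
  simp only [← mk_reverse, SimpleGraph.Walk.reverse_reverse]

theorem inv_comp_rev (u : Cls G T a b) (v : Cls G T b c) : (u ⬝ v).inv = v.inv ⬝ u.inv := by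
  induction u using ind; induction v using ind
  simp only [← mk_reverse, ← mk_append, SimpleGraph.Walk.reverse_append]

theorem comp_left_cancel (u : Cls G T a b) {v w : Cls G T b c} (h : u ⬝ v = u ⬝ w) : v = w := by
  rw [← inv_comp_assoc u v, h, inv_comp_assoc]

theorem comp_right_cancel (u : Cls G T b c) {v w : Cls G T a b} (h : v ⬝ u = w ⬝ u) : v = w := by
  rw [← comp_nil v, ← comp_inv u, ← comp_assoc, h, comp_assoc, comp_inv, comp_nil]

end Cls

theorem Homotopic.map {V' : Type*} {G' : SimpleGraph V'} {T' : Set (Set V')} (f : G →g G')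
    (hT : ∀ t ∈ T, f '' t ∈ T') {a b : V} {p q : G.Walk a b} (h : Homotopic G T p q) :
    Homotopic G' T' (p.map f) (q.map f) := by
  induction h with
  | refl p => exact .refl _
  | symm _ ih => exact ih.symm
  | trans _ _ ih₁ ih₂ => exact ih₁.trans ih₂
  | cons h _ ih => exact .cons _ ih
  | backtrack h p => exact .backtrack (f.map_adj h) (p.map f)
  | triangle hab hbc hac ht p =>
    refine .triangle (f.map_adj hab) (f.map_adj hbc) (f.map_adj hac) ?_ (p.map f)
    have := hT _ ht
    rwa [Set.image_insert_eq, Set.image_pair] at this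

/-- The elements of `loopSubgroup` are the given generators themselves. -/
theorem mem_loopSubgroup {W : Type*} {C : SimpleGraph W} (f : C →g G) {x : V} {i : W}
    {p : G.Walk x (f i)} {g : Pi1 G T x} :
    g ∈ loopSubgroup T f i p ↔
      ∃ γ : C.Walk i i, @Eq (Cls G T x x) g <| Cls.mk p ⬝ Cls.mk (γ.map f) ⬝ (Cls.mk p).inv := by
  constructor
  · intro h
    refine Subgroup.closure_induction (G := Pi1 G T x) (p := fun g _ => ∃ γ : C.Walk i i,
      @Eq (Cls G T x x) g <| Cls.mk p ⬝ Cls.mk (γ.map f) ⬝ (Cls.mk p).inv) ?_ ?_ ?_ ?_ h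
    · rintro _ ⟨γ, rfl⟩
      exact ⟨γ, rfl⟩
    · refine ⟨.nil, ?_⟩
      rw [SimpleGraph.Walk.map_nil, Cls.nil_comp, Cls.comp_inv]
      rfl
    · rintro a b _ _ ⟨γ, hγ⟩ ⟨δ, hδ⟩
      refine ⟨γ.append δ, ?_⟩
      change @Cls.comp _ _ _ x x x a b = _
      rw [hγ, hδ, SimpleGraph.Walk.map_append, Cls.mk_append]
      simp only [Cls.comp_assoc, Cls.inv_comp_assoc]
    · rintro a _ ⟨γ, hγ⟩
      refine ⟨γ.reverse, ?_⟩
      change @Cls.inv _ _ _ x x a = _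
      rw [hγ, ← SimpleGraph.Walk.reverse_map, Cls.mk_reverse]
      simp only [Cls.inv_comp_rev, Cls.inv_inv, Cls.comp_assoc]
  · rintro ⟨γ, rfl⟩
    exact Subgroup.subset_closure ⟨γ, rfl⟩

/-! ### Reduced walks -/

/-- A list of vertices without backtracking `a, b, a`. -/
def NoBacktrack : List V → Prop
  | a :: b :: c :: l => a ≠ c ∧ NoBacktrack (b :: c :: l)
  | _ => True

/-- A walk is reduced if it does not backtrack. -/
def IsReduced {a b : V} (p : G.Walk a b) : Prop := NoBacktrack p.support

section Reduced

variable {a b c d : V}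

theorem isReduced_cons_cons {h : G.Adj a b} {h' : G.Adj b c} {p : G.Walk c d} :
    IsReduced (.cons h (.cons h' p)) ↔ a ≠ c ∧ IsReduced (.cons h' p) := by
  cases p <;> exact Iff.rfl

theorem IsReduced.of_cons {h : G.Adj a b} {p : G.Walk b c} (hp : IsReduced (.cons h p)) :
    IsReduced p := by
  cases p with
  | nil => trivial
  | cons h' p => exact (isReduced_cons_cons.1 hp).2

theorem IsReduced.of_append {p : G.Walk a b} {q : G.Walk b c} (hp : IsReduced (p.append q)) :
    IsReduced q := by
  induction p with
  | nil => exact hp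
  | cons h p ih => exact ih hp.of_cons

/-- Every walk is homotopic to a reduced one. -/
theorem exists_isReduced (T : Set (Set V)) (p : G.Walk a b) :
    ∃ q : G.Walk a b, IsReduced q ∧ Homotopic G T p q := by
  induction p with
  | nil => exact ⟨.nil, trivial, .refl _⟩
  | @cons a b c h p ih =>
    obtain ⟨q, hq, hpq⟩ := ih
    cases q with
    | nil => exact ⟨.cons h .nil, trivial, .cons h hpq⟩
    | @cons _ d _ h' q =>
      by_cases hd : a = d
      · subst hd
        exact ⟨q, hq.of_cons, (Homotopic.cons h hpq).trans (.backtrack h q)⟩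
      · exact ⟨.cons h (.cons h' q), isReduced_cons_cons.2 ⟨hd, hq⟩, .cons h hpq⟩

open Classical in
/-- Prepend `a` to a list of vertices, cancelling a backtrack. -/
noncomputable def push (a : V) (l : List V) : List V :=
  if l.tail.head? = some a then l.tail else a :: l

theorem NoBacktrack.tail {a : V} {l : List V} (h : NoBacktrack (a :: l)) : NoBacktrack l := by
  match l, h with
  | [], _ => trivial
  | [_], _ => trivial
  | _ :: _ :: _, h => exact h.2

theorem NoBacktrack.push {a : V} {l : List V} (h : NoBacktrack l) : NoBacktrack (push a l) := by
  unfold EdgePath.push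
  match l, h with
  | [], _ => simp [NoBacktrack]
  | [_], _ => simp [NoBacktrack]
  | b :: c :: l, h =>
    split_ifs with hc
    · exact h.tail
    · refine ⟨?_, h⟩
      rintro rfl
      exact hc rfl

/-- The reduced form of a list of vertices. -/
noncomputable def reduceList (l : List V) : List V := l.foldr push []

theorem noBacktrack_reduceList (l : List V) : NoBacktrack (reduceList l) := by
  induction l with
  | nil => trivial
  | cons a l ih => exact ih.push

theorem reduceList_eq_self {l : List V} (h : NoBacktrack l) : reduceList l = l := by
  induction l with
  | nil => rfl
  | cons a l ih =>
    have : reduceList (a :: l) = push a (reduceList l) := rfl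
    rw [this, ih h.tail, push, if_neg]
    match l, h with
    | [], _ => simp
    | [_], _ => simp
    | b :: c :: l, h => simpa using Ne.symm h.1

theorem exists_reduceList_support (p : G.Walk a b) : ∃ m, reduceList p.support = a :: m := by
  induction p with
  | nil => exact ⟨[], rfl⟩
  | @cons a b c h p ih =>
    obtain ⟨m, hm⟩ := ih
    have : reduceList (SimpleGraph.Walk.cons h p).support = push a (reduceList p.support) := rfl
    rw [this, hm, push]
    split_ifs with ha
    · match m, ha with
      | d :: m, ha =>
        obtain rfl : d = a := by simpa using ha
        exact ⟨m, rfl⟩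
    · exact ⟨_, rfl⟩

theorem push_push {a b : V} {m : List V} (h : NoBacktrack (a :: m)) :
    push a (push b (a :: m)) = a :: m := by
  unfold push
  match m, h with
  | [], _ => simp
  | c :: m, h =>
    by_cases hc : c = b
    · subst hc
      match m, h with
      | [], _ => simp
      | d :: m, h => simp [Ne.symm h.1]
    · simp [hc]

/-- In a graph, the reduced form of a walk depends only on its homotopy class. -/
theorem Homotopic.reduceList_eq {p q : G.Walk a b} (h : Homotopic G ∅ p q) :
    reduceList p.support = reduceList q.support := by
  induction h with
  | refl => rfl
  | symm _ ih => exact ih.symm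
  | trans _ _ ih₁ ih₂ => exact ih₁.trans ih₂
  | @cons a b c h p q _ ih =>
    have key (r : G.Walk b c) :
      reduceList (SimpleGraph.Walk.cons h r).support = push a (reduceList r.support) := rfl
    rw [key, key, ih]
  | @backtrack a b c h p =>
    change push a (push b (reduceList p.support)) = _
    obtain ⟨m, hm⟩ := exists_reduceList_support p
    have := noBacktrack_reduceList p.support
    rw [hm] at this ⊢
    exact push_push this
  | triangle _ _ _ ht => exact ht.elim

/-- The length of the reduced walks in a homotopy class of a graph. -/
noncomputable def Cls.length (u : Cls G ∅ a b) : ℕ :=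
  Quotient.lift (fun p : G.Walk a b => (reduceList p.support).length - 1)
    (fun _ _ h => by simp only [Homotopic.reduceList_eq h]) u

theorem IsReduced.length_mk {p : G.Walk a b} (hp : IsReduced p) :
    (Cls.mk p : Cls G ∅ a b).length = p.length := by
  change (reduceList p.support).length - 1 = _
  rw [reduceList_eq_self hp]
  simp

/-- A reduced walk in the source of an immersion, followed by a walk that prolongs reducedly along
both directions of the source, has a reduced image. -/
theorem IsReduced.map_append {W : Type*} {C : SimpleGraph W} (f : C →g G)
    (hf : ∀ i j k, C.Adj i j → C.Adj i k → f j = f k → j = k) {m i : W} {ξ : C.Walk m i}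
    (hξ : IsReduced ξ) {v : V} {q : G.Walk (f i) v}
    (hq : ∀ j (h : C.Adj j i), IsReduced (.cons (f.map_adj h) q)) (hq' : IsReduced q) :
    IsReduced ((ξ.map f).append q) := by
  induction ξ with
  | nil => exact hq'
  | cons h ξ ih =>
    cases ξ with
    | nil => exact hq _ h
    | cons h' ξ =>
      obtain ⟨h1, h2⟩ := isReduced_cons_cons.1 hξ
      have h3 := ih h2 hq hq'
      refine isReduced_cons_cons.2 ⟨fun he => h1 ?_, h3⟩
      exact hf _ _ _ h.symm h' he

end Reduced

end EdgePath

/-! ### Immersed cycles and their passages through vertices and edges -/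

namespace ImmersedCycle

variable {W : Type w} {Γ : SimpleGraph W}

instance (C : ImmersedCycle Γ) : NeZero C.len := ⟨by have := C.three_le_len; omega⟩

theorem cycleGraph_adj_iff {n : ℕ} [NeZero n] (hn : 3 ≤ n) {i j : Fin n} :
    (SimpleGraph.cycleGraph n).Adj i j ↔ j = i + 1 ∨ i = j + 1 := by
  obtain ⟨m, rfl⟩ := Nat.exists_eq_add_of_le' (show 2 ≤ n by omega)
  rw [SimpleGraph.cycleGraph_adj, or_comm]
  exact or_congr sub_eq_iff_eq_add' sub_eq_iff_eq_add'

theorem fin_add_two_ne {n : ℕ} [NeZero n] (hn : 3 ≤ n) (i : Fin n) : i + 1 + 1 ≠ i := by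
  obtain ⟨m, rfl⟩ := Nat.exists_eq_add_of_le' hn
  intro h
  rw [add_assoc, add_eq_left] at h
  have := congrArg Fin.val h
  simp [Fin.val_add] at this
  rw [Nat.mod_eq_of_lt (by omega)] at this
  omega

variable (C : ImmersedCycle Γ)

theorem adj_iff {i j : Fin C.len} :
    (SimpleGraph.cycleGraph C.len).Adj i j ↔ j = i + 1 ∨ i = j + 1 :=
  cycleGraph_adj_iff C.three_le_len

theorem adj_succ (i : Fin C.len) : (SimpleGraph.cycleGraph C.len).Adj i (i + 1) :=
  C.adj_iff.2 (.inl rfl)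

theorem succ_succ_ne (i : Fin C.len) : i + 1 + 1 ≠ i := fin_add_two_ne C.three_le_len i

theorem sub_one_ne_succ (i : Fin C.len) : i - 1 ≠ i + 1 := by
  intro h
  have := C.succ_succ_ne (i - 1)
  rw [sub_add_cancel, ← h] at this
  exact this rfl

theorem adj_pred (i : Fin C.len) : (SimpleGraph.cycleGraph C.len).Adj i (i - 1) :=
  C.adj_iff.2 (.inr (sub_add_cancel i 1).symm)

theorem exists_adj_ne {m i : Fin C.len} :
    ∃ j, (SimpleGraph.cycleGraph C.len).Adj i j ∧ j ≠ m := by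
  by_cases h : i + 1 = m
  · exact ⟨i - 1, C.adj_pred i, fun h' => C.sub_one_ne_succ i (h'.trans h.symm)⟩
  · exact ⟨i + 1, C.adj_succ i, h⟩

theorem eq_or_eq_of_adj {i j k l : Fin C.len} (hij : (SimpleGraph.cycleGraph C.len).Adj i j)
    (hik : (SimpleGraph.cycleGraph C.len).Adj i k) (hjk : j ≠ k)
    (hil : (SimpleGraph.cycleGraph C.len).Adj i l) : l = j ∨ l = k := by
  have pred {x : Fin C.len} (h : i = x + 1) : x = i - 1 := (sub_eq_of_eq_add h).symm
  have h1 := (C.adj_iff.1 hij).imp_right pred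
  have h2 := (C.adj_iff.1 hik).imp_right pred
  have h3 := (C.adj_iff.1 hil).imp_right pred
  grind

/-- Unordered edges of the cycle are indexed by their first vertex. -/
theorem sym2_succ_injective {i j : Fin C.len} (h : s(i, i + 1) = s(j, j + 1)) : i = j := by
  rcases Sym2.eq_iff.1 h with h | ⟨h1, h2⟩
  · exact h.1
  · rw [h1] at h2
    exact (C.succ_succ_ne j h2).elim

theorem edge_eq_of_mem {a b i : Fin C.len} (h : (SimpleGraph.cycleGraph C.len).Adj a b)
    (hi : i ∈ s(a, b)) : s(a, b) = s(i, i + 1) ∨ s(a, b) = s(i - 1, i - 1 + 1) := by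
  rcases Sym2.mem_iff.1 hi with rfl | rfl <;> rcases C.adj_iff.1 h with rfl | rfl
  · exact .inl rfl
  · exact .inr (by rw [add_sub_cancel_right, Sym2.eq_swap])
  · exact .inr (by rw [add_sub_cancel_right])
  · exact .inl Sym2.eq_swap

/-- The ways in which the cycles of a family run through the oriented edge from `v` to `w`. -/
abbrev Passage {ι : Type*} (C : ι → ImmersedCycle Γ) (v w : W) : Type _ :=
  {p : Σ κ, Fin (C κ).len × Fin (C κ).len // (SimpleGraph.cycleGraph (C p.1).len).Adj p.2.1 p.2.2 ∧
    (C p.1).toHom p.2.1 = v ∧ (C p.1).toHom p.2.2 = w}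

instance {ι : Type*} [Finite ι] (C : ι → ImmersedCycle Γ) (v w : W) : Finite (Passage C v w) :=
  Subtype.finite

/-- The Whitehead graph of the family `C` at a vertex `v` has the neighbours of `v` as vertices and
the passages of the cycles through `v` as edges. The family is biconnected if every Whitehead graph is
nonempty and connected, has no cut vertex, and has no vertex of degree less than two. Connectedness
is expressed by saying that predicates that agree at the two ends of every edge are constant. -/
structure IsBiconnected {ι : Type*} (C : ι → ImmersedCycle Γ) : Prop where
  exists_adj : ∀ v, ∃ w, Γ.Adj v w
  connected : ∀ v (Q : W → Prop),
    (∀ κ i j k, (C κ).toHom i = v → (SimpleGraph.cycleGraph (C κ).len).Adj i j →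
      (SimpleGraph.cycleGraph (C κ).len).Adj i k → Q ((C κ).toHom j) → Q ((C κ).toHom k)) →
    ∀ w w', Γ.Adj v w → Γ.Adj v w' → Q w → Q w'
  no_cut_vertex : ∀ v u, Γ.Adj v u → ∀ (Q : W → Prop),
    (∀ κ i j k, (C κ).toHom i = v → (SimpleGraph.cycleGraph (C κ).len).Adj i j →
      (SimpleGraph.cycleGraph (C κ).len).Adj i k → (C κ).toHom j ≠ u → (C κ).toHom k ≠ u →
      Q ((C κ).toHom j) → Q ((C κ).toHom k)) →
    ∀ w w', Γ.Adj v w → Γ.Adj v w' → w ≠ u → w' ≠ u → Q w → Q w'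
  nontrivial_passage : ∀ v w, Γ.Adj v w → Nontrivial (Passage C v w)

end ImmersedCycle

namespace TubularGraphOfGraphs

open ImmersedCycle

section

variable {X : TubularGraphOfGraphs.{u, v, w}}

/-- A corner at the dart `d` of the vertex graph at `s` is a passage of an incident cycle. -/
theorem IsCorner.exists_incidence {s : X.V} {d : (X.graph s).Dart} {a : X.E} {b : Bool}
    {i : Fin (X.len a)} (h : X.IsCorner (.inl ⟨s, d⟩) (.inr ⟨a, b, i⟩)) :
    ∃ (κ : X.Incidence s) (i' j' : Fin (X.incidentCycle s κ).len), κ.1 = (a, b) ∧ i'.1 = i.1 ∧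
      (SimpleGraph.cycleGraph (X.incidentCycle s κ).len).Adj i' j' ∧
      (X.incidentCycle s κ).toHom i' = d.fst ∧ (X.incidentCycle s κ).toHom j' = d.snd := by
  obtain ⟨j, hij, h⟩ := h
  obtain rfl : X.endpt a b = s := congrArg Sigma.fst h
  obtain rfl := eq_of_heq (Sigma.mk.inj_iff.1 h).2
  exact ⟨⟨(a, b), rfl⟩, i, j, rfl, rfl, hij, rfl, rfl⟩

theorem links_adj {η ζ : X.HalfEdge} (h : X.links.Adj η ζ) :
    ∃ d h, X.IsCorner (.inl d) (.inr h) ∧ ((η = .inl d ∧ ζ = .inr h) ∨ (η = .inr h ∧ ζ = .inl d)) := by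
  obtain ⟨-, h | h⟩ := (SimpleGraph.fromRel_adj _ _ _).1 h
  · match η, ζ, h with
    | .inl d, .inr e, h => exact ⟨d, e, h, .inl ⟨rfl, rfl⟩⟩
  · match ζ, η, h with
    | .inl d, .inr e, h => exact ⟨d, e, h, .inr ⟨rfl, rfl⟩⟩

/-- The darts with which a half-edge bounds a corner; a dart is assigned to itself. -/
def tips : X.HalfEdge → Set (Σ s, (X.graph s).Dart)
  | .inl d => {d}
  | .inr h => {d | X.IsCorner (.inl d) (.inr h)}

/-- A predicate on the neighbours of `v` that is invariant under the passages avoiding the set `E` of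
neighbours is constant off `E`, if the link of `v` is connected after removal of the half-edges
towards `E`. -/
theorem invariant_of_linkMinus_connected {s : X.V} {v : X.Vert s} (E : Set (X.Vert s))
    (σ : Set X.HalfEdge)
    (hσ : ∀ d : (X.graph s).Dart, d.fst = v → ((.inl ⟨s, d⟩ : X.HalfEdge) ∈ σ ↔ d.snd ∈ E))
    (hconn : (X.linkMinus ⟨s, v⟩ σ).Connected) (Q : X.Vert s → Prop)
    (hQ : ∀ κ i j k, (X.incidentCycle s κ).toHom i = v →
      (SimpleGraph.cycleGraph (X.incidentCycle s κ).len).Adj i j →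
      (SimpleGraph.cycleGraph (X.incidentCycle s κ).len).Adj i k →
      (X.incidentCycle s κ).toHom j ∉ E → (X.incidentCycle s κ).toHom k ∉ E →
      Q ((X.incidentCycle s κ).toHom j) → Q ((X.incidentCycle s κ).toHom k))
    {w w' : X.Vert s} (hw : (X.graph s).Adj v w) (hw' : (X.graph s).Adj v w') (hwE : w ∉ E)
    (hwE' : w' ∉ E) (h : Q w) : Q w' := by
  let Q' : X.HalfEdge → Prop := fun η =>
    ∃ d : (X.graph s).Dart, ⟨s, d⟩ ∈ tips η ∧ d.fst = v ∧ d.snd ∉ E ∧ Q d.snd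
  have inl_iff (d : (X.graph s).Dart) (hd : d.fst = v) (hE : d.snd ∉ E) :
      Q' (.inl ⟨s, d⟩) ↔ Q d.snd := by
    constructor
    · rintro ⟨d', hd', -, -, hQ⟩
      obtain rfl := eq_of_heq (Sigma.mk.inj_iff.1 hd').2
      exact hQ
    · exact fun hQ => ⟨d, rfl, hd, hE, hQ⟩
  have corner (d : Σ s, (X.graph s).Dart) (e : Σ a, Bool × Fin (X.len a))
      (hb : X.base (.inl d) = ⟨s, v⟩) (hdσ : .inl d ∉ σ)
      (hc : X.IsCorner (.inl d) (.inr e)) : Q' (.inl d) ↔ Q' (.inr e) := by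
    obtain ⟨s', d⟩ := d
    obtain ⟨a, b, i⟩ := e
    obtain rfl : s' = s := congrArg Sigma.fst hb
    have hdv : d.fst = v := eq_of_heq (Sigma.mk.inj_iff.1 hb).2
    have hdE : d.snd ∉ E := fun h => hdσ ((hσ d hdv).2 h)
    rw [inl_iff d hdv hdE]
    constructor
    · exact fun h => ⟨d, hc, hdv, hdE, h⟩
    · rintro ⟨d', hd', hdv', hdE', h⟩
      obtain ⟨j, hij, hc⟩ := hc
      obtain ⟨j', hij', hc'⟩ := hd'
      obtain rfl : X.endpt a b = s' := congrArg Sigma.fst hc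
      obtain rfl := eq_of_heq (Sigma.mk.inj_iff.1 hc).2
      obtain rfl := eq_of_heq (Sigma.mk.inj_iff.1 hc').2
      exact hQ ⟨(a, b), rfl⟩ i j' j hdv hij' hij hdE' hdE h
  have step (η ζ : {η | X.base η = ⟨s, v⟩ ∧ η ∉ σ}) (hadj : (X.linkMinus ⟨s, v⟩ σ).Adj η ζ) :
      Q' η → Q' ζ := by
    obtain ⟨d, e, hc, ⟨h1, h2⟩ | ⟨h1, h2⟩⟩ := TubularGraphOfGraphs.links_adj hadj
    · change η.1 = _ at h1
      change ζ.1 = _ at h2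
      have := (corner d e (h1 ▸ η.2.1) (h1 ▸ η.2.2) hc).1
      rwa [← h1, ← h2] at this
    · change η.1 = _ at h1
      change ζ.1 = _ at h2
      have := (corner d e (h2 ▸ ζ.2.1) (h2 ▸ ζ.2.2) hc).2
      rwa [← h1, ← h2] at this
  have hd (w) (hw : (X.graph s).Adj v w) (hwE : w ∉ E) :
      X.base (.inl ⟨s, ⟨(v, w), hw⟩⟩) = ⟨s, v⟩ ∧ .inl ⟨s, ⟨(v, w), hw⟩⟩ ∉ σ :=
    ⟨rfl, fun h => hwE ((hσ ⟨(v, w), hw⟩ rfl).1 h)⟩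
  obtain ⟨p⟩ := hconn.preconnected ⟨_, hd w hw hwE⟩ ⟨_, hd w' hw' hwE'⟩
  have walk (η ζ : {η | X.base η = ⟨s, v⟩ ∧ η ∉ σ}) (p : (X.linkMinus ⟨s, v⟩ σ).Walk η ζ) :
      Q' η → Q' ζ := by
    induction p with
    | nil => exact id
    | cons hadj _ ih => exact ih ∘ step _ _ hadj
  exact (inl_iff ⟨(v, w'), hw'⟩ rfl hwE').1 (walk _ _ p ((inl_iff ⟨(v, w), hw⟩ rfl hwE).2 h))

theorem exists_corner_of_connected {s : X.V} {d : (X.graph s).Dart} {σ : Set X.HalfEdge}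
    (hconn : (X.linkMinus ⟨s, d.fst⟩ σ).Connected) (hd : .inl ⟨s, d⟩ ∉ σ) {η : X.HalfEdge}
    (hη : X.base η = ⟨s, d.fst⟩) (hησ : η ∉ σ) (hne : η ≠ .inl ⟨s, d⟩) :
    ∃ a b i, .inr ⟨a, b, i⟩ ∉ σ ∧ X.IsCorner (.inl ⟨s, d⟩) (.inr ⟨a, b, i⟩) := by
  obtain ⟨p⟩ := hconn.preconnected ⟨.inl ⟨s, d⟩, rfl, hd⟩ ⟨η, hη, hησ⟩
  cases p with
  | nil => exact (hne rfl).elim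
  | @cons _ ζ _ h p =>
    obtain ⟨d', ⟨a, b, i⟩, hc, ⟨h1, h2⟩ | ⟨h1, h2⟩⟩ := TubularGraphOfGraphs.links_adj h
    · obtain rfl := Sum.inl_injective h1
      exact ⟨a, b, i, h2 ▸ ζ.2.2, hc⟩
    · cases h1

/-- In a Brady–Meier tubular graph of graphs the incident cycles of every vertex graph are
biconnected. -/
theorem IsBradyMeier.isBiconnected (hBM : X.IsBradyMeier) (s : X.V) :
    IsBiconnected (X.incidentCycle s) where
  exists_adj v := by
    obtain ⟨η, hη, -⟩ := (hBM ⟨s, v⟩).1.nonempty.some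
    match η, hη with
    | .inl ⟨s', d⟩, hη =>
      obtain rfl : s' = s := congrArg Sigma.fst hη
      obtain rfl : d.fst = v := eq_of_heq (Sigma.mk.inj_iff.1 hη).2
      exact ⟨d.snd, d.adj⟩
    | .inr ⟨a, b, i⟩, hη =>
      obtain rfl : X.endpt a b = s := congrArg Sigma.fst hη
      obtain rfl : X.attach a b i = v := eq_of_heq (Sigma.mk.inj_iff.1 hη).2
      exact ⟨_, (X.attach a b).map_adj ((X.tubeCycle a b).adj_succ i)⟩
  connected v Q hQ w w' hw hw' :=
    invariant_of_linkMinus_connected ∅ ∅ (fun _ _ => Iff.rfl) (hBM ⟨s, v⟩).1 Q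
      (fun κ i j k hi hj hk _ _ => hQ κ i j k hi hj hk) hw hw' (Set.notMem_empty _)
      (Set.notMem_empty _)
  no_cut_vertex v u hu Q hQ w w' hw hw' hwu hwu' := by
    refine invariant_of_linkMinus_connected {u} {.inl ⟨s, ⟨(v, u), hu⟩⟩} ?_
      ((hBM ⟨s, v⟩).2.1 _ rfl) Q hQ hw hw' hwu hwu'
    rintro ⟨⟨a, b⟩, hab⟩ (rfl : a = v)
    constructor
    · intro h
      have := eq_of_heq (Sigma.mk.inj_iff.1 (Sum.inl_injective h)).2
      exact congrArg (fun d : (X.graph s).Dart => d.snd) this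
    · rintro (rfl : b = u)
      rfl
  nontrivial_passage v w hvw := by
    let d : (X.graph s).Dart := ⟨(v, w), hvw⟩
    obtain ⟨h0, h1, -⟩ := hBM ⟨s, v⟩
    obtain ⟨η, hη, hne⟩ := (h1 (.inl ⟨s, d⟩) rfl).nonempty.some
    obtain ⟨a, b, i, -, hc⟩ := exists_corner_of_connected (d := d) h0 (Set.notMem_empty _) hη
      (Set.notMem_empty _) hne
    obtain ⟨κ, i₁, j₁, hκ, hi, hadj, hi₁, hj₁⟩ := hc.exists_incidence
    have hbase : X.base (.inr ⟨a, b, i⟩) = ⟨s, v⟩ := by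
      obtain ⟨j, hij, hc⟩ := hc
      exact congrArg (fun d : Σ s, (X.graph s).Dart => (⟨d.1, d.2.fst⟩ : X.Vertex)) hc
    -- The horizontal half-edge `h` of this corner has a second neighbour, so that the link minus
    -- `h` has a further vertex to which `d` must be connected.
    obtain ⟨d', hd', hdd'⟩ : ∃ d' : Σ s, (X.graph s).Dart, X.base (.inl d') = ⟨s, v⟩ ∧
        d' ≠ ⟨s, d⟩ := by
      obtain ⟨j, hij, hc⟩ := hc
      obtain ⟨k, hik, hkj⟩ := (X.tubeCycle a b).exists_adj_ne (m := j) (i := i)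
      refine ⟨⟨X.endpt a b, (X.attach a b).mapDart ⟨(i, k), hik⟩⟩, hbase, ?_⟩
      rw [← hc]
      intro h
      have := congrArg (fun d : (X.graph (X.endpt a b)).Dart => d.snd)
        (eq_of_heq (Sigma.mk.inj_iff.1 h).2)
      exact hkj ((X.immersion a b i k j hik hij this))
    obtain ⟨a', b', i', hne', hc'⟩ := exists_corner_of_connected (d := d) (η := .inl d')
      (h1 (.inr ⟨a, b, i⟩) hbase) (fun h => Sum.inl_ne_inr h) hd' (fun h => Sum.inl_ne_inr h)
      (fun h => hdd' (Sum.inl_injective h))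
    obtain ⟨κ', i₂, j₂, hκ', hi', hadj', hi₂, hj₂⟩ := hc'.exists_incidence
    refine ⟨⟨⟨κ, i₁, j₁⟩, hadj, hi₁, hj₁⟩, ⟨⟨κ', i₂, j₂⟩, hadj', hi₂, hj₂⟩, fun he => hne' ?_⟩
    have he := congrArg Subtype.val he
    obtain rfl : κ = κ' := congrArg Sigma.fst he
    obtain ⟨rfl, rfl⟩ := Prod.mk.inj (eq_of_heq (Sigma.mk.inj_iff.1 he).2)
    obtain ⟨rfl, rfl⟩ := Prod.mk.inj (hκ.symm.trans hκ')
    obtain rfl : i = i' := Fin.ext (hi.symm.trans hi')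
    rfl

end

/-! ### Thickness of the edges of a double -/

section

variable {W : Type w} (hW : Finite W) (Γ : SimpleGraph W) (hΓ : Γ.Connected) {ι : Type v}
  (hι : Finite ι) (C : ι → ImmersedCycle Γ)

theorem double_thickness_inr (κ : ι) (i : Fin (C κ).len) :
    (double hW Γ hΓ hι C).thickness (.inr ⟨κ, i⟩) = 2 := by
  let q (j : Fin (C κ).len) : (double hW Γ hΓ hι C).Square :=
    ⟨κ, show Sym2 (Fin (C κ).len) from s(j, j + 1), (C κ).adj_succ j⟩
  have : {x | (double hW Γ hΓ hι C).Contains x (.inr ⟨κ, i⟩)} = {q i, q (i - 1)} := by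
    ext ⟨κ', e, he⟩
    obtain ⟨a, b, rfl⟩ : ∃ a b, s(a, b) = e := Sym2.ind (fun a b => ⟨a, b, rfl⟩) e
    constructor
    · rintro ⟨j, hj, h⟩
      obtain rfl : κ' = κ := congrArg Sigma.fst h
      obtain rfl : j = i := eq_of_heq (Sigma.mk.inj_iff.1 h).2
      exact ((C κ').edge_eq_of_mem he hj).imp
        (fun h => congrArg (Sigma.mk κ') (Subtype.ext h))
        (fun h => congrArg (Sigma.mk κ') (Subtype.ext h))
    · rintro (h | h)
      · rw [h]
        exact ⟨i, Sym2.mem_mk_left _ _, rfl⟩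
      · rw [h]
        have : i ∈ s(i - 1, i - 1 + 1) := by
          rw [sub_add_cancel]
          exact Sym2.mem_mk_right _ _
        exact ⟨i, this, rfl⟩
  change Set.ncard {x | (double hW Γ hΓ hι C).Contains x (.inr ⟨κ, i⟩)} = 2
  rw [this, Set.ncard_pair]
  intro h
  have h := congrArg Subtype.val (eq_of_heq (Sigma.mk.inj_iff.1 h).2)
  have := (C κ).adj_pred i
  rw [← (C κ).sym2_succ_injective h] at this
  exact this.ne rfl

theorem double_contains_inl (q : (double hW Γ hΓ hι C).Square) (b : Bool) (e : Γ.edgeSet) :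
    (double hW Γ hΓ hι C).Contains q (.inl ⟨b, e⟩) ↔ Sym2.map (C q.1).toHom q.2.1 = e.1 := by
  constructor
  · rintro ⟨b', h⟩
    obtain rfl : b' = b := congrArg Sigma.fst h
    exact congrArg Subtype.val (eq_of_heq (Sigma.mk.inj_iff.1 h).2)
  · intro h
    exact ⟨b, congrArg (Sigma.mk (β := fun _ => Γ.edgeSet) b) (Subtype.ext h)⟩

theorem double_thickness_inl (b : Bool) {v w : W} (hvw : Γ.Adj v w) :
    (double hW Γ hΓ hι C).thickness (.inl ⟨b, s(v, w), hvw⟩) = Nat.card (Passage C v w) := by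
  symm
  refine Nat.card_eq_of_bijective (fun p => ⟨⟨p.1.1, s(p.1.2.1, p.1.2.2), p.2.1⟩,
    (double_contains_inl hW Γ hΓ hι C ⟨p.1.1, s(p.1.2.1, p.1.2.2), p.2.1⟩ b ⟨s(v, w), hvw⟩).2
      (Sym2.eq_iff.2 (.inl p.2.2))⟩) ⟨?_, ?_⟩
  · rintro ⟨⟨κ, i, j⟩, hij, rfl, rfl⟩ ⟨⟨κ', i', j'⟩, hij', hi, hj⟩ h
    replace h := congrArg Subtype.val h
    obtain rfl : κ = κ' := congrArg Sigma.fst h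
    have h := congrArg Subtype.val (eq_of_heq (Sigma.mk.inj_iff.1 h).2)
    rcases Sym2.eq_iff.1 h with ⟨rfl, rfl⟩ | ⟨h1, h2⟩
    · rfl
    · dsimp only at h1 h2 hi
      rw [h2] at hvw
      exact (hvw.ne hi.symm).elim
  · rintro ⟨⟨κ, e, he⟩, h⟩
    replace h := (double_contains_inl hW Γ hΓ hι C ⟨κ, e, he⟩ b ⟨s(v, w), hvw⟩).1 h
    induction e using Sym2.ind with | _ i j =>
    rcases Sym2.eq_iff.1 (show s(_, _) = s(v, w) from h) with ⟨hi, hj⟩ | ⟨hi, hj⟩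
    · exact ⟨⟨⟨κ, i, j⟩, he, hi, hj⟩, rfl⟩
    · exact ⟨⟨⟨κ, j, i⟩, SimpleGraph.Adj.symm he, hj, hi⟩,
        Subtype.ext (congrArg (Sigma.mk κ) (Subtype.ext Sym2.eq_swap))⟩

theorem double_thickness_eq_two_iff : (∀ e, (double hW Γ hΓ hι C).thickness e = 2) ↔
    ∀ v w, Γ.Adj v w → Nat.card (Passage C v w) = 2 := by
  constructor
  · intro h v w hvw
    exact (double_thickness_inl hW Γ hΓ hι C true hvw).symm.trans (h _)
  · rintro h (⟨b, e, he⟩ | ⟨κ, i⟩)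
    · induction e using Sym2.ind with | _ v w =>
      exact (double_thickness_inl hW Γ hΓ hι C b he).trans (h v w he)
    · exact double_thickness_inr hW Γ hΓ hι C κ i

end

end TubularGraphOfGraphs

/-! ### The universal cover of a triangulated surface -/

namespace EdgePath

variable {V : Type*} {G : SimpleGraph V} {T : Set (Set V)} {y : V}

variable (G T) in
/-- The preimage in the universal cover with base point `y` of a subgraph `B` of the 1-skeleton `G`. -/
def liftGraph (y : V) (B : SimpleGraph V) : SimpleGraph (Σ a, Cls G T a y) where
  Adj u v := B.Adj u.1 v.1 ∧ ∃ h : G.Adj u.1 v.1, u.2 = Cls.mk h.toWalk ⬝ v.2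
  symm := ⟨by
    rintro ⟨a, x⟩ ⟨b, x'⟩ ⟨hB, h, hx⟩
    refine ⟨hB.symm, h.symm, ?_⟩
    dsimp only at hx ⊢
    rw [hx]
    exact (Cls.inv_comp_assoc (Cls.mk h.toWalk) x').symm⟩
  loopless := ⟨fun _ h => h.1.ne rfl⟩

theorem liftGraph_adj_mk {B : SimpleGraph V} {a b : V} (hB : B.Adj b a) (h : G.Adj b a)
    (x : Cls G T a y) : (liftGraph G T y B).Adj ⟨b, Cls.mk h.toWalk ⬝ x⟩ ⟨a, x⟩ :=
  ⟨hB, h, rfl⟩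

/-- The neighbours of a vertex of the universal cover are determined by their images. -/
theorem liftGraph_adj_unique {B B' : SimpleGraph V} {u v w : Σ a, Cls G T a y}
    (hv : (liftGraph G T y B).Adj v u) (hw : (liftGraph G T y B').Adj w u) (h : v.1 = w.1) :
    v = w := by
  obtain ⟨a, v⟩ := v
  obtain ⟨b, w⟩ := w
  obtain rfl : a = b := h
  obtain ⟨-, _, hv⟩ := hv
  obtain ⟨-, _, hw⟩ := hw
  dsimp only at hv hw
  rw [hv, hw]

theorem liftGraph_reachable {B : SimpleGraph V} (hB : B ≤ G) {u v : Σ a, Cls G T a y} :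
    (liftGraph G T y B).Reachable u v ↔
      ∃ ζ : B.Walk u.1 v.1, u.2 = Cls.mk (ζ.map (.ofLE hB)) ⬝ v.2 := by
  constructor
  · rintro ⟨p⟩
    induction p with
    | nil => exact ⟨.nil, (Cls.nil_comp _).symm⟩
    | cons h p ih =>
      obtain ⟨ζ, hζ⟩ := ih
      obtain ⟨hB', h', h''⟩ := h
      refine ⟨.cons hB' ζ, ?_⟩
      rw [h'', hζ, ← Cls.comp_assoc]
      rfl
  · obtain ⟨a, x⟩ := u
    obtain ⟨b, x'⟩ := v
    rintro ⟨ζ, hζ⟩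
    dsimp only at ζ hζ
    subst hζ
    induction ζ with
    | nil =>
      rw [SimpleGraph.Walk.map_nil, Cls.nil_comp]
    | cons h ζ ih =>
      refine SimpleGraph.Reachable.trans (SimpleGraph.Adj.reachable ?_) (ih x')
      have := liftGraph_adj_mk (y := y) h (hB h) (Cls.mk (ζ.map (.ofLE hB)) ⬝ x' : Cls G T _ y)
      rwa [← Cls.comp_assoc] at this

/-- Three vertices of the universal cover span a lift of a triangle. -/
def IsTriangle (u v w : Σ a, Cls G T a y) : Prop :=
  {u.1, v.1, w.1} ∈ T ∧ (liftGraph G T y G).Adj u v ∧ (liftGraph G T y G).Adj u w ∧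
    (liftGraph G T y G).Adj v w

namespace IsTriangle

variable {u v w : Σ a, Cls G T a y}

theorem swap_left (h : IsTriangle u v w) : IsTriangle v u w :=
  ⟨by rw [Set.insert_comm]; exact h.1, h.2.1.symm, h.2.2.2, h.2.2.1⟩

theorem swap_right (h : IsTriangle u v w) : IsTriangle u w v :=
  ⟨by rw [Set.pair_comm]; exact h.1, h.2.2.1, h.2.1, h.2.2.2.symm⟩

/-- The indicator of an edge `p q` has on the boundary of a triangle the sum one or zero, according as
the triangle contains this edge or not. -/
theorem sum_indicator [DecidableEq (Σ a, Cls G T a y)] (h : IsTriangle u v w)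
    {p q : Σ a, Cls G T a y} (hpq : p ≠ q) [Decidable (p ∈ ({u, v, w} : Set _) ∧
      q ∈ ({u, v, w} : Set _))] :
    (if s(u, v) = s(p, q) then 1 else 0) + (if s(v, w) = s(p, q) then 1 else 0) +
      (if s(u, w) = s(p, q) then 1 else 0) =
      (if p ∈ ({u, v, w} : Set _) ∧ q ∈ ({u, v, w} : Set _) then 1 else 0 : ZMod 2) := by
  have h1 := h.2.1.ne
  have h2 := h.2.2.1.ne
  have h3 := h.2.2.2.ne
  simp only [Sym2.eq_iff, Set.mem_insert_iff, Set.mem_singleton_iff]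
  by_cases a1 : u = p <;> by_cases a2 : u = q <;> by_cases a3 : v = p <;> by_cases a4 : v = q <;>
    by_cases a5 : w = p <;> by_cases a6 : w = q <;> simp_all [eq_comm]

/-- A triangle that contains the edge `p q` is spanned by this edge and a third vertex. -/
theorem exists_third (h : IsTriangle u v w) {p q : Σ a, Cls G T a y} (hpq : p ≠ q)
    (hp : p ∈ ({u, v, w} : Set _)) (hq : q ∈ ({u, v, w} : Set _)) :
    ∃ r, IsTriangle p q r ∧ ({u, v, w} : Set _) = {p, q, r} := by
  rcases hp with rfl | rfl | rfl <;> rcases hq with rfl | rfl | rfl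
  · exact (hpq rfl).elim
  · exact ⟨w, h, rfl⟩
  · exact ⟨v, h.swap_right, by rw [Set.pair_comm]⟩
  · exact ⟨w, h.swap_left, by rw [Set.insert_comm]⟩
  · exact (hpq rfl).elim
  · exact ⟨u, h.swap_left.swap_right, by rw [Set.insert_comm, Set.pair_comm]⟩
  · exact ⟨v, h.swap_right.swap_left, by rw [Set.pair_comm, Set.insert_comm]⟩
  · exact ⟨u, h.swap_left.swap_right.swap_left, by
      rw [Set.insert_comm, Set.pair_comm, Set.insert_comm]⟩
  · exact (hpq rfl).elim

end IsTriangle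

/-- A cocycle modulo two on the universal cover. -/
def IsCocycle (c : Sym2 (Σ a, Cls G T a y) → ZMod 2) : Prop :=
  ∀ u v w, IsTriangle u v w → c s(u, v) + c s(v, w) + c s(u, w) = 0

/-- The sum of a 1-cochain along the lift of a path that ends at the base point. -/
def integral (c : Sym2 (Σ a, Cls G T a y) → ZMod 2) : ∀ {a : V}, G.Walk a y → ZMod 2
  | _, .nil => 0
  | _, .cons h p => c s(⟨_, Cls.mk (.cons h p)⟩, ⟨_, Cls.mk p⟩) + integral c p

theorem integral_eq_of_homotopic {a : V} {p q : G.Walk a y} (h : Homotopic G T p q)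
    {c : Sym2 (Σ a, Cls G T a y) → ZMod 2} (hc : IsCocycle c) : integral c p = integral c q := by
  induction h with
  | refl => rfl
  | symm _ ih => exact (ih hc).symm
  | trans _ _ ih₁ ih₂ => exact (ih₁ hc).trans (ih₂ hc)
  | cons h hpq ih =>
    simp only [integral, ih hc, Cls.mk_eq_mk.2 hpq, Cls.mk_eq_mk.2 (Homotopic.cons h hpq)]
  | backtrack h p =>
    simp only [integral, Cls.mk_eq_mk.2 (Homotopic.backtrack h p)]
    rw [Sym2.eq_swap, ← add_assoc, CharTwo.add_self_eq_zero, zero_add]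
  | triangle hab hbc hac ht p =>
    have := hc ⟨_, Cls.mk (.cons hac p)⟩ ⟨_, Cls.mk (.cons hbc p)⟩ ⟨_, Cls.mk p⟩
      ⟨ht, ⟨hab, hab, (Cls.mk_eq_mk.2 (Homotopic.triangle hab hbc hac ht p)).symm⟩,
        ⟨hac, hac, rfl⟩, ⟨hbc, hbc, rfl⟩⟩
    simp only [integral, Cls.mk_eq_mk.2 (Homotopic.triangle hab hbc hac ht p)]
    rw [← add_assoc, CharTwo.add_eq_zero.1 this]

/-- The universal cover is simply connected: a cocycle is a coboundary. -/
theorem IsCocycle.exists_potential {c : Sym2 (Σ a, Cls G T a y) → ZMod 2} (hc : IsCocycle c) :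
    ∃ F : (Σ a, Cls G T a y) → ZMod 2, ∀ u v, (liftGraph G T y G).Adj u v →
      F u = c s(u, v) + F v := by
  refine ⟨fun u => Quotient.lift (fun p => integral c p)
    (fun _ _ h => integral_eq_of_homotopic h hc) u.2, ?_⟩
  rintro ⟨a, u⟩ ⟨b, v⟩ ⟨-, h, he⟩
  dsimp only at he h
  subst he
  induction v using Cls.ind with | h p =>
  rfl

end EdgePath

/-! ### Triangles and boundary lines of the universal cover -/

namespace TriangulatedSurface

open EdgePath

variable {S : TriangulatedSurface}

theorem skeleton_adj {a b : S.V} : S.skeleton.Adj a b ↔ a ≠ b ∧ ∃ t ∈ S.triangles, a ∈ t ∧ b ∈ t := by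
  rw [skeleton, SimpleGraph.fromRel_adj]
  refine and_congr_right fun _ => or_iff_left_of_imp ?_
  rintro ⟨t, ht, hb, ha⟩
  exact ⟨t, ht, ha, hb⟩

theorem boundary_adj {a b : S.V} :
    S.boundary.Adj a b ↔ a ≠ b ∧ {t ∈ S.triangles | a ∈ t ∧ b ∈ t}.ncard = 1 := by
  rw [boundary, SimpleGraph.fromRel_adj]
  refine and_congr_right fun _ => or_iff_left_of_imp fun h => ?_
  simpa only [and_comm] using h

theorem triangle_ne {a b c : S.V} (h : {a, b, c} ∈ S.triangles) : a ≠ b ∧ a ≠ c ∧ b ≠ c := by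
  have := S.card_triangle _ h
  have pair (a b : S.V) : ({a, b} : Set S.V).ncard ≤ 2 :=
    (Set.ncard_insert_le _ _).trans (by rw [Set.ncard_singleton])
  refine ⟨?_, ?_, ?_⟩ <;> rintro rfl
  · have h2 := pair a c
    rw [Set.insert_eq_of_mem (Set.mem_insert _ _)] at this
    omega
  · have h2 := pair b a
    rw [Set.insert_eq_of_mem (by simp)] at this
    omega
  · have h2 := pair a b
    rw [Set.pair_eq_singleton] at this
    omega

theorem exists_eq_triple {t : Set S.V} (ht : t ∈ S.triangles) {a b : S.V} (ha : a ∈ t) (hb : b ∈ t)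
    (hab : a ≠ b) : ∃ c, t = {a, b, c} := by
  have : Finite S.V := S.finite
  have h2 : (t \ {a, b}).ncard = 1 := by
    rw [Set.ncard_sdiff (by rintro x (rfl | rfl) <;> assumption), S.card_triangle t ht,
      Set.ncard_pair hab]
  obtain ⟨c, hc⟩ := Set.ncard_eq_one.1 h2
  refine ⟨c, ?_⟩
  have : t = (t \ {a, b}) ∪ {a, b} :=
    (Set.sdiff_union_of_subset (by rintro x (rfl | rfl) <;> assumption)).symm
  rw [this, hc]
  ext x
  simp only [Set.mem_union, Set.mem_singleton_iff, Set.mem_insert_iff]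
  tauto

theorem skeleton_adj_of_mem {t : Set S.V} (ht : t ∈ S.triangles) {a b : S.V} (ha : a ∈ t)
    (hb : b ∈ t) (hab : a ≠ b) : S.skeleton.Adj a b := skeleton_adj.2 ⟨hab, t, ht, ha, hb⟩

theorem triple_injective {a b c c' : S.V} (h : {a, b, c} ∈ S.triangles)
    (he : ({a, b, c} : Set S.V) = {a, b, c'}) : c = c' := by
  obtain ⟨-, h1, h2⟩ := triangle_ne h
  have : c ∈ ({a, b, c'} : Set S.V) := he ▸ by simp
  rcases this with rfl | rfl | rfl
  · exact (h1 rfl).elim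
  · exact (h2 rfl).elim
  · rfl

/-- The third vertices of the triangles over an edge correspond to these triangles. -/
theorem ncard_third (a b : S.V) (hab : a ≠ b) : {c | {a, b, c} ∈ S.triangles}.ncard =
    {t ∈ S.triangles | a ∈ t ∧ b ∈ t}.ncard := by
  refine Set.ncard_congr (fun c _ => {a, b, c}) (fun c hc => ⟨hc, by simp, by simp⟩)
    (fun c c' hc _ he => triple_injective hc he) ?_
  rintro t ⟨ht, ha, hb⟩
  obtain ⟨c, rfl⟩ := exists_eq_triple ht ha hb hab
  exact ⟨c, ht, rfl⟩

/-- The boundary edges at a vertex correspond to the vertices of odd degree in its link. -/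
theorem even_boundary_neighborSet (a : S.V) : Even (S.boundary.neighborSet a).ncard := by
  classical
  have : Finite S.V := S.finite
  have := Fintype.ofFinite S.V
  let N := {b : S.V // b ≠ a ∧ ∃ t ∈ S.triangles, a ∈ t ∧ b ∈ t}
  let L : SimpleGraph N := SimpleGraph.fromRel fun b c : N => ({a, b.1, c.1} : Set S.V) ∈ S.triangles
  have adj (b c : N) : L.Adj b c ↔ ({a, b.1, c.1} : Set S.V) ∈ S.triangles := by
    rw [SimpleGraph.fromRel_adj]
    constructor
    · rintro ⟨-, h | h⟩
      · exact h
      · rwa [Set.pair_comm]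
    · exact fun h => ⟨fun he => (triangle_ne h).2.2 (congrArg Subtype.val he), .inl h⟩
  have hdeg (b : N) : L.degree b = {t ∈ S.triangles | a ∈ t ∧ b.1 ∈ t}.ncard := by
    rw [← ncard_third a b.1 b.2.1.symm, ← SimpleGraph.card_neighborSet_eq_degree,
      ← Nat.card_eq_fintype_card]
    change (L.neighborSet b).ncard = _
    refine Set.ncard_congr (fun c _ => c.1) (fun c hc => (adj _ _).1 hc)
      (fun c c' _ _ h => Subtype.ext h) fun c hc => ?_
    exact ⟨⟨c, (triangle_ne hc).2.1.symm, _, hc, by simp, by simp⟩, (adj _ _).2 hc, rfl⟩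
  have key := L.even_card_odd_degree_vertices
  convert key using 1
  rw [← Set.ncard_coe_finset]
  symm
  refine Set.ncard_congr (fun c _ => c.1) ?_ (fun c c' _ _ h => Subtype.ext h) ?_
  · intro b hb
    simp only [Finset.coe_filter, Finset.mem_univ, true_and, Set.mem_ofPred_eq, hdeg] at hb
    have := S.edge_le_two a b.1 b.2.1.symm
    refine boundary_adj.2 ⟨b.2.1.symm, ?_⟩
    obtain ⟨k, hk⟩ := hb
    omega
  · intro b hb
    obtain ⟨hne, h1⟩ := boundary_adj.1 hb
    have hadj := skeleton_adj.1 (S.boundary_le hb)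
    refine ⟨⟨b, hne.symm, hadj.2⟩, ?_, rfl⟩
    simp only [Finset.coe_filter, Finset.mem_univ, true_and, Set.mem_ofPred_eq, hdeg]
    rw [h1]
    exact odd_one

variable {y : S.V}

/-- The vertices of the universal cover of `S`. -/
abbrev Cover (S : TriangulatedSurface) (y : S.V) : Type :=
  Σ a, Cls S.skeleton S.triangles a y

/-- The 1-skeleton of the universal cover. -/
abbrev coverSkeleton (S : TriangulatedSurface) (y : S.V) : SimpleGraph (S.Cover y) :=
  liftGraph S.skeleton S.triangles y S.skeleton

/-- The boundary of the universal cover. -/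
abbrev coverBoundary (S : TriangulatedSurface) (y : S.V) : SimpleGraph (S.Cover y) :=
  liftGraph S.skeleton S.triangles y S.boundary

theorem coverBoundary_le : S.coverBoundary y ≤ S.coverSkeleton y :=
  fun _ _ h => ⟨S.boundary_le h.1, h.2⟩

/-- Over an edge of the universal cover, triangles lift uniquely. -/
theorem exists_isTriangle {u v : S.Cover y} (h : (S.coverSkeleton y).Adj u v) {c : S.V}
    (hc : {u.1, v.1, c} ∈ S.triangles) : ∃ w : S.Cover y, w.1 = c ∧ IsTriangle u v w := by
  obtain ⟨a, x⟩ := u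
  obtain ⟨b, x'⟩ := v
  obtain ⟨h1, h2, h3⟩ := triangle_ne hc
  have hac := (skeleton_adj_of_mem hc (by simp) (by simp) h2).symm
  have hcb := (skeleton_adj_of_mem hc (by simp) (by simp) h3).symm
  have hca := liftGraph_adj_mk (T := S.triangles) (y := y) hac hac x
  have key : (S.coverSkeleton y).Adj ⟨c, Cls.mk hac.toWalk ⬝ x⟩ ⟨b, x'⟩ := by
    obtain ⟨-, hab, hx⟩ := h
    dsimp only at hab hx
    refine ⟨hcb, hcb, ?_⟩
    dsimp only
    rw [hx, ← Cls.comp_assoc]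
    congr 1
    refine Cls.mk_eq_mk.2 (.triangle hac hab hcb ?_ .nil)
    have : ({c, a, b} : Set S.V) = {a, b, c} := by
      rw [Set.insert_comm, Set.pair_comm]
    rwa [this]
  exact ⟨⟨c, Cls.mk hac.toWalk ⬝ x⟩, rfl, hc, h, hca.symm, key.symm⟩

theorem isTriangle_unique {u v w w' : S.Cover y} (h : IsTriangle u v w) (h' : IsTriangle u v w')
    (he : w.1 = w'.1) : w = w' :=
  liftGraph_adj_unique h.2.2.1.symm h'.2.2.1.symm he

theorem exists_isTriangle_of_adj {u v : S.Cover y} (h : (S.coverSkeleton y).Adj u v) :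
    ∃ w, IsTriangle u v w := by
  obtain ⟨hne, t, ht, ha, hb⟩ := skeleton_adj.1 h.1
  obtain ⟨c, rfl⟩ := exists_eq_triple ht ha hb hne
  obtain ⟨w, -, hw⟩ := exists_isTriangle h ht
  exact ⟨w, hw⟩

/-- Boundary edges lie in only one triangle. -/
theorem isTriangle_unique_of_boundary {u v w w' : S.Cover y} (hb : S.boundary.Adj u.1 v.1)
    (h : IsTriangle u v w) (h' : IsTriangle u v w') : w = w' := by
  refine isTriangle_unique h h' ?_
  obtain ⟨hne, hcard⟩ := boundary_adj.1 hb
  rw [← ncard_third _ _ hne] at hcard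
  obtain ⟨x, hx⟩ := Set.ncard_eq_one.1 hcard
  have h1 : w.1 ∈ ({x} : Set S.V) := hx ▸ h.1
  have h2 : w'.1 ∈ ({x} : Set S.V) := hx ▸ h'.1
  rw [h1, h2]

open Classical in
/-- The sets of vertices `t` and `t'` of triangles of the universal cover are cohomologous: the sum of
their indicators is the coboundary of a finite cochain that vanishes on the boundary. -/
def Cohomologous (t t' : Set (S.Cover y)) : Prop :=
  ∃ c : Sym2 (S.Cover y) → ZMod 2, c.support.Finite ∧
    (∀ u v, (S.coverBoundary y).Adj u v → c s(u, v) = 0) ∧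
    ∀ u v w, IsTriangle u v w → c s(u, v) + c s(v, w) + c s(u, w) =
      (if {u, v, w} = t then 1 else 0) + (if {u, v, w} = t' then 1 else 0)

theorem Cohomologous.refl (t : Set (S.Cover y)) : Cohomologous t t := by
  refine ⟨0, by simp, fun _ _ _ => rfl, fun u v w _ => ?_⟩
  rw [CharTwo.add_self_eq_zero]
  simp

theorem Cohomologous.trans {t t' t'' : Set (S.Cover y)} (h : Cohomologous t t')
    (h' : Cohomologous t' t'') : Cohomologous t t'' := by
  obtain ⟨c, h1, h2, h3⟩ := h
  obtain ⟨c', h1', h2', h3'⟩ := h'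
  refine ⟨c + c', (h1.union h1').subset (Function.support_add _ _), fun u v h => ?_,
    fun u v w h => ?_⟩
  · rw [Pi.add_apply, h2 u v h, h2' u v h, add_zero]
  · have := congrArg₂ (· + ·) (h3 u v w h) (h3' u v w h)
    simp only [Pi.add_apply] at this ⊢
    linear_combination this + CharTwo.add_self_eq_zero
      (if {u, v, w} = t' then 1 else 0 : ZMod 2)

/-- Triangles that are adjacent along an edge are cohomologous, by the indicator of this edge. -/
theorem cohomologous_of_adj {p q r r' : S.Cover y} (h : IsTriangle p q r) (h' : IsTriangle p q r') :
    Cohomologous {p, q, r} {p, q, r'} := by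
  classical
  by_cases hr : r = r'
  · subst hr
    exact .refl _
  have hpq := h.2.1.ne
  have hr1 : r.1 ≠ r'.1 := fun he => hr (isTriangle_unique h h' he)
  have hlt : 1 < {c | {p.1, q.1, c} ∈ S.triangles}.ncard := by
    have := S.finite
    exact (Set.one_lt_ncard).2 ⟨r.1, h.1, r'.1, h'.1, hr1⟩
  have hthird (w : S.Cover y) (hw : IsTriangle p q w) : w = r ∨ w = r' := by
    have hle := S.edge_le_two p.1 q.1 (triangle_ne h.1).1
    rw [← ncard_third _ _ (triangle_ne h.1).1] at hle
    have hS := S.finite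
    by_contra! hne
    have h3 : 2 < {c | {p.1, q.1, c} ∈ S.triangles}.ncard :=
      (Set.two_lt_ncard).2 ⟨r.1, h.1, r'.1, h'.1, w.1, hw.1, hr1,
        fun he => hne.1 (isTriangle_unique hw h he.symm),
        fun he => hne.2 (isTriangle_unique hw h' he.symm)⟩
    omega
  refine ⟨fun e => if e = s(p, q) then 1 else 0, ?_, fun u v huv => ?_, fun u v w huvw => ?_⟩
  · refine (Set.finite_singleton s(p, q)).subset fun e he => ?_
    by_contra hne
    exact he (if_neg hne)
  · refine if_neg fun he => ?_
    have hb : S.boundary.Adj p.1 q.1 := by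
      rcases Sym2.eq_iff.1 he with ⟨rfl, rfl⟩ | ⟨rfl, rfl⟩
      · exact huv.1
      · exact huv.1.symm
    obtain ⟨hne, hcard⟩ := boundary_adj.1 hb
    rw [← ncard_third _ _ hne] at hcard
    omega
  · refine (huvw.sum_indicator hpq).trans ?_
    have hset : ({p, q, r} : Set (S.Cover y)) ≠ {p, q, r'} := by
      intro he
      have : r ∈ ({p, q, r'} : Set (S.Cover y)) := he ▸ by simp
      rcases this with he | he | he
      · exact h.2.2.1.ne he.symm
      · exact h.2.2.2.ne he.symm
      · exact hr he
    split_ifs with h1 h2 h3 h3 h2 h3 h3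
    · exact (hset (h2.symm.trans h3)).elim
    · simp
    · simp
    · obtain ⟨w', hw', he⟩ := huvw.exists_third hpq h1.1 h1.2
      rcases hthird w' hw' with rfl | rfl
      · exact (h2 he).elim
      · exact (h3 he).elim
    · exact (h1 ⟨h2 ▸ by simp, h2 ▸ by simp⟩).elim
    · exact (h1 ⟨h2 ▸ by simp, h2 ▸ by simp⟩).elim
    · exact (h1 ⟨h3 ▸ by simp, h3 ▸ by simp⟩).elim
    · simp

/-- The triangles at a vertex are cohomologous, because the link is connected. -/
theorem cohomologous_of_common_vertex {u v w v' w' : S.Cover y} (h : IsTriangle u v w)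
    (h' : IsTriangle u v' w') : Cohomologous {u, v, w} {u, v', w'} := by
  have mem {v w : S.Cover y} (h : IsTriangle u v w) :
      v.1 ≠ u.1 ∧ ∃ t ∈ S.triangles, u.1 ∈ t ∧ v.1 ∈ t :=
    ⟨(triangle_ne h.1).1.symm, _, h.1, by simp, by simp⟩
  obtain ⟨p⟩ := (S.link_connected u.1).preconnected ⟨v.1, mem h⟩ ⟨v'.1, mem h'⟩
  generalize hb : (⟨v.1, mem h⟩ : {b // b ≠ u.1 ∧ ∃ t ∈ S.triangles, u.1 ∈ t ∧ b ∈ t}) = b at p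
  generalize hb' : (⟨v'.1, mem h'⟩ : {b // b ≠ u.1 ∧ ∃ t ∈ S.triangles, u.1 ∈ t ∧ b ∈ t}) = b' at p
  replace hb := congrArg Subtype.val hb
  dsimp only at hb
  induction p generalizing v w with
  | nil =>
    obtain rfl : v = v' :=
      liftGraph_adj_unique h.2.1.symm h'.2.1.symm (hb.trans (congrArg Subtype.val hb').symm)
    exact cohomologous_of_adj h h'
  | @cons b c _ hbc p ih =>
    have ht : ({u.1, v.1, c.1} : Set S.V) ∈ S.triangles := by
      rw [hb]
      obtain ⟨-, h | h⟩ := (SimpleGraph.fromRel_adj _ _ _).1 hbc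
      · exact h
      · rwa [Set.pair_comm]
    obtain ⟨x, hx, hux⟩ := exists_isTriangle h.2.1 ht
    refine (cohomologous_of_adj h hux).trans ?_
    rw [Set.pair_comm]
    exact ih hux.swap_right hb' hx

theorem coverSkeleton_reachable_base (u : S.Cover y) :
    (S.coverSkeleton y).Reachable u ⟨y, Cls.mk .nil⟩ := by
  obtain ⟨a, x⟩ := u
  induction x using Cls.ind with | h p =>
  refine (liftGraph_reachable le_rfl).2 ⟨p, ?_⟩
  rw [Cls.comp_nil]
  exact congrArg Cls.mk (SimpleGraph.Walk.map_id p).symm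

/-- All triangles of the universal cover are cohomologous. -/
theorem cohomologous_of_isTriangle {u v w u' v' w' : S.Cover y} (h : IsTriangle u v w)
    (h' : IsTriangle u' v' w') : Cohomologous {u, v, w} {u', v', w'} := by
  obtain ⟨p⟩ := (coverSkeleton_reachable_base u).trans (coverSkeleton_reachable_base u').symm
  induction p generalizing v w with
  | nil => exact cohomologous_of_common_vertex h h'
  | cons hadj p ih =>
    obtain ⟨x, hx⟩ := exists_isTriangle_of_adj hadj
    refine (cohomologous_of_common_vertex h hx).trans ?_
    rw [Set.insert_comm]
    exact ih hx.swap_left h'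

open Classical in
/-- For any two boundary edges of the universal cover there is a finite cocycle that meets the boundary
only in these two edges. It is dual to an arc joining the two edges. -/
theorem exists_cocycle {u v u' v' : S.Cover y} (h : (S.coverBoundary y).Adj u v)
    (h' : (S.coverBoundary y).Adj u' v') :
    ∃ c : Sym2 (S.Cover y) → ZMod 2, c.support.Finite ∧ IsCocycle c ∧
      ∀ p q, (S.coverBoundary y).Adj p q →
        c s(p, q) = (if s(p, q) = s(u, v) then 1 else 0) + (if s(p, q) = s(u', v') then 1 else 0) := by
  obtain ⟨w, hw⟩ := exists_isTriangle_of_adj (coverBoundary_le h)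
  obtain ⟨w', hw'⟩ := exists_isTriangle_of_adj (coverBoundary_le h')
  obtain ⟨c, h1, h2, h3⟩ := cohomologous_of_isTriangle hw hw'
  -- The indicator of a boundary edge has as coboundary the indicator of its only triangle.
  have edge {u v w : S.Cover y} (h : (S.coverBoundary y).Adj u v) (hw : IsTriangle u v w)
      {p q r : S.Cover y} (hp : IsTriangle p q r) :
      (if s(p, q) = s(u, v) then 1 else 0) + (if s(q, r) = s(u, v) then 1 else 0) +
        (if s(p, r) = s(u, v) then 1 else 0) =
          (if {p, q, r} = ({u, v, w} : Set _) then 1 else 0 : ZMod 2) := by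
    rw [hp.sum_indicator h.ne]
    refine if_congr ⟨fun hmem => ?_, fun he => ?_⟩ rfl rfl
    · obtain ⟨x, hx, he⟩ := hp.exists_third h.ne hmem.1 hmem.2
      rw [he, isTriangle_unique_of_boundary h.1 hx hw]
    · rw [he]
      simp
  refine ⟨fun e => c e + ((if e = s(u, v) then 1 else 0) + (if e = s(u', v') then 1 else 0)),
    ?_, fun p q r hp => ?_, fun p q hpq => ?_⟩
  · refine (h1.union (Set.toFinite {s(u, v), s(u', v')})).subset fun e he => ?_
    by_contra hne
    simp only [Set.mem_union, Set.mem_insert_iff, Set.mem_singleton_iff, not_or,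
      Function.mem_support, not_not] at hne
    exact he (by simp [hne])
  · have e1 := edge h hw hp
    have e2 := edge h' hw' hp
    have e3 := h3 p q r hp
    have e4 := CharTwo.add_self_eq_zero (if {p, q, r} = ({u, v, w} : Set _) then 1 else 0 : ZMod 2)
    have e5 := CharTwo.add_self_eq_zero
      (if {p, q, r} = ({u', v', w'} : Set _) then 1 else 0 : ZMod 2)
    linear_combination e1 + e2 + e3 + e4 + e5
  · beta_reduce
    rw [h2 p q hpq, zero_add]

theorem even_coverBoundary_neighborSet (u : S.Cover y) :
    Even ((S.coverBoundary y).neighborSet u).ncard := by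
  convert even_boundary_neighborSet u.1 using 1
  refine Set.ncard_congr (fun v _ => v.1) (fun v h => h.1)
    (fun v v' h h' he => liftGraph_adj_unique (SimpleGraph.Adj.symm h) (SimpleGraph.Adj.symm h') he) ?_
  intro b hb
  refine ⟨⟨b, Cls.mk (S.boundary_le hb.symm).toWalk ⬝ u.2⟩, ?_, rfl⟩
  exact (liftGraph_adj_mk hb.symm (S.boundary_le hb.symm) u.2).symm

theorem finite_coverBoundary_neighborSet (u : S.Cover y) :
    ((S.coverBoundary y).neighborSet u).Finite := by
  have := S.finite
  refine Set.Finite.of_finite_image (f := Sigma.fst) (Set.toFinite _) ?_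
  exact fun v h v' h' he => liftGraph_adj_unique (SimpleGraph.Adj.symm h) (SimpleGraph.Adj.symm h') he

/-- The coboundary of a function that is constant off a finite set cannot meet a component of the
boundary of the universal cover in a single edge, since all boundary vertices have even degree. -/
theorem not_finite_of_single_edge {F : S.Cover y → ZMod 2} {z : ZMod 2} (hF : {u | F u ≠ z}.Finite)
    {u v : S.Cover y} (huv : (S.coverBoundary y).Adj u v)
    (h : ∀ p q, (S.coverBoundary y).Adj p q → (S.coverBoundary y).Reachable p u →
      (F p ≠ F q ↔ s(p, q) = s(u, v))) : False := by
  classical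
  have hne : F u ≠ F v := (h u v huv .rfl).2 rfl
  wlog hu : F u ≠ z generalizing u v
  · refine this huv.symm (fun p q hpq hpv => ?_) hne.symm fun he => hne ((not_not.1 hu).trans he.symm)
    rw [h p q hpq (hpv.trans huv.symm.reachable), Sym2.eq_swap (a := v)]
  have hv : F v = z := by
    have key : ∀ a b z : ZMod 2, a ≠ b → a ≠ z → b = z := by decide
    exact key _ _ _ hne hu
  let A : Set (S.Cover y) := {p | (S.coverBoundary y).Reachable p u ∧ F p ≠ z}
  have hA : A.Finite := hF.subset fun p hp => hp.2
  have := hA.fintype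
  let H := (S.coverBoundary y).induce A
  have hdeg (p : A) : H.degree p = ((S.coverBoundary y).neighborSet p.1 ∩ A).ncard := by
    rw [← SimpleGraph.card_neighborSet_eq_degree, ← Nat.card_eq_fintype_card]
    change (H.neighborSet p).ncard = _
    exact Set.ncard_congr (fun q _ => q.1) (fun q hq => ⟨hq, q.2⟩)
      (fun _ _ _ _ he => Subtype.ext he) fun q hq => ⟨⟨q, hq.2⟩, hq.1, rfl⟩
  have hodd : (Finset.univ.filter fun p : A => Odd (H.degree p)) = {⟨u, .rfl, hu⟩} := by
    ext ⟨p, hp, hpz⟩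
    rw [Finset.mem_filter, Finset.mem_singleton, hdeg]
    have hsub (q) (hq : (S.coverBoundary y).Adj p q) (hqv : ¬ s(p, q) = s(u, v)) : q ∈ A :=
      ⟨hq.symm.reachable.trans hp, fun he => hqv ((h p q hq hp).1 fun he' => hpz (he'.trans he))⟩
    have heven := even_coverBoundary_neighborSet p
    constructor
    · rintro ⟨-, hodd⟩
      by_contra hpu
      replace hpu : p ≠ u := fun he => hpu (Subtype.ext he)
      rw [Set.inter_eq_left.2, ← Nat.not_even_iff_odd] at hodd
      · exact hodd heven
      · intro q hq
        refine hsub q hq fun he => ?_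
        rcases Sym2.eq_iff.1 he with ⟨he, -⟩ | ⟨he, -⟩
        · exact hpu he
        · exact hpz (he ▸ hv)
    · intro he
      obtain rfl : p = u := congrArg Subtype.val he
      refine ⟨Finset.mem_univ _, ?_⟩
      have : (S.coverBoundary y).neighborSet p ∩ A = (S.coverBoundary y).neighborSet p \ {v} := by
        ext q
        refine and_congr_right fun hq => ⟨fun hqA he => hqA.2 (he ▸ hv), fun hqv => hsub q hq ?_⟩
        intro he
        rcases Sym2.eq_iff.1 he with ⟨-, he⟩ | ⟨he, -⟩
        · exact hqv he
        · exact huv.ne he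
      rw [this]
      have hcard := Set.ncard_sdiff_singleton_add_one (show v ∈ (S.coverBoundary y).neighborSet p from huv)
        (finite_coverBoundary_neighborSet p)
      rw [← hcard] at heven
      rw [← Nat.not_even_iff_odd]
      intro h'
      exact (Nat.even_add_one.1 heven) h'
  have key := H.even_card_odd_degree_vertices
  rw [hodd, Finset.card_singleton] at key
  exact absurd key (by decide)

end TriangulatedSurface

/-! ### Functions on the universal cover of a graph that do not separate the ends of lines -/

namespace EdgePath

open ImmersedCycle

variable {W : Type*} {Γ : SimpleGraph W} {α : Type*}

/-- The function `g` on walks ending at `v` takes the value `z` on all sufficiently long reduced walks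
whose last part is `h` followed by `q`. -/
def EventuallyEq {v : W} (g : ∀ a, Γ.Walk a v → α) {a b : W} (h : Γ.Adj b a) (q : Γ.Walk a v)
    (z : α) : Prop :=
  ∃ M, ∀ m (r : Γ.Walk m b), M ≤ r.length → IsReduced (r.append (.cons h q)) →
    g m (r.append (.cons h q)) = z

/-- An immersed cycle is followed for `n` steps from a vertex `j` of the cycle, in the direction away
from the neighbour `i` of `j`. -/
theorem exists_ray (C : ImmersedCycle Γ) {v : W} {i j : Fin C.len}
    (h : (SimpleGraph.cycleGraph C.len).Adj j i) (q : Γ.Walk (C.toHom i) v)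
    (hq : IsReduced (.cons (C.toHom.map_adj h) q)) (n : ℕ) :
    ∃ (m : Fin C.len) (ξ : (SimpleGraph.cycleGraph C.len).Walk m j), ξ.length = n ∧
      IsReduced ((ξ.map C.toHom).append (.cons (C.toHom.map_adj h) q)) := by
  suffices ∃ (m m' : Fin C.len) (ξ : (SimpleGraph.cycleGraph C.len).Walk m j)
      (ξ' : Γ.Walk (C.toHom m') v) (hm : (SimpleGraph.cycleGraph C.len).Adj m m'), ξ.length = n ∧
      (ξ.map C.toHom).append (.cons (C.toHom.map_adj h) q) = .cons (C.toHom.map_adj hm) ξ' ∧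
      IsReduced (.cons (C.toHom.map_adj hm) ξ') by
    obtain ⟨m, m', ξ, ξ', hm, hn, he, hr⟩ := this
    exact ⟨m, ξ, hn, he ▸ hr⟩
  induction n with
  | zero => exact ⟨j, i, .nil, q, h, rfl, rfl, hq⟩
  | succ n ih =>
    obtain ⟨m, m', ξ, ξ', hm, hn, he, hr⟩ := ih
    obtain ⟨l, hl, hne⟩ := C.exists_adj_ne (m := m') (i := m)
    refine ⟨l, m, .cons hl.symm ξ, .cons (C.toHom.map_adj hm) ξ', hl.symm, by simp [hn], ?_, ?_⟩
    · rw [SimpleGraph.Walk.map_cons, SimpleGraph.Walk.cons_append, he]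
    · exact isReduced_cons_cons.2 ⟨fun he => hne (C.immersion m l m' hl hm he), hr⟩

theorem EventuallyEq.eq_of_line {v : W} {g : ∀ a, Γ.Walk a v → α} (C : ImmersedCycle Γ)
    {i j : Fin C.len} (h : (SimpleGraph.cycleGraph C.len).Adj j i) {q : Γ.Walk (C.toHom i) v}
    (hq : IsReduced (.cons (C.toHom.map_adj h) q)) {z z' : α}
    (hz : EventuallyEq g (C.toHom.map_adj h) q z)
    (hz' : ∃ M, ∀ m (ξ : (SimpleGraph.cycleGraph C.len).Walk m i), M ≤ ξ.length →
      IsReduced ((ξ.map C.toHom).append q) → g _ ((ξ.map C.toHom).append q) = z') : z = z' := by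
  obtain ⟨M, hM⟩ := hz
  obtain ⟨M', hM'⟩ := hz'
  obtain ⟨m, ξ, hξ, hr⟩ := exists_ray C h q hq (max M M')
  have he : ((ξ.append (.cons h .nil)).map C.toHom).append q =
      (ξ.map C.toHom).append (.cons (C.toHom.map_adj h) q) := by
    rw [SimpleGraph.Walk.map_append, ← SimpleGraph.Walk.append_assoc]
    rfl
  rw [← hM _ (ξ.map C.toHom) (by rw [SimpleGraph.Walk.length_map, hξ]; exact le_max_left _ _) hr,
    ← he]
  refine hM' _ _ ?_ (he ▸ hr)
  rw [SimpleGraph.Walk.length_append, hξ]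
  exact (le_max_right _ _).trans (Nat.le_add_right _ _)

/-- If all branches at the end of `q` have the same eventual value, so has `q`. -/
theorem exists_bound_of_forall_eventuallyEq [Finite W] {v : W} {g : ∀ a, Γ.Walk a v → α} {a : W}
    {q : Γ.Walk a v} {z : α}
    (H : ∀ b (h : Γ.Adj b a), IsReduced (.cons h q) → EventuallyEq g h q z) :
    ∃ M, ∀ m (r : Γ.Walk m a), M ≤ r.length → IsReduced (r.append q) → g m (r.append q) = z := by
  have (b : W) : ∃ M, ∀ (h : Γ.Adj b a), IsReduced (.cons h q) →
      ∀ m (r : Γ.Walk m b), M ≤ r.length → IsReduced (r.append (.cons h q)) →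
        g m (r.append (.cons h q)) = z := by
    by_cases hb : ∃ h : Γ.Adj b a, IsReduced (.cons h q)
    · obtain ⟨h, hr⟩ := hb
      obtain ⟨M, hM⟩ := H b h hr
      exact ⟨M, fun _ _ => hM⟩
    · exact ⟨0, fun h hr => (hb ⟨h, hr⟩).elim⟩
  choose M hM using this
  obtain ⟨B, hB⟩ := (Set.finite_range M).bddAbove
  refine ⟨B + 1, fun m r hr hred => ?_⟩
  obtain ⟨b, r', h, rfl⟩ : ∃ b, ∃ (r' : Γ.Walk m b) (h : Γ.Adj b a), r = r'.concat h := by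
    cases r with
    | nil => simp at hr
    | cons h p =>
      obtain ⟨x, r', h', he⟩ := SimpleGraph.Walk.exists_cons_eq_concat h p
      exact ⟨x, r', h', he⟩
  rw [SimpleGraph.Walk.concat_append] at hred ⊢
  refine hM b h hred.of_append m r' ?_ hred
  rw [SimpleGraph.Walk.length_concat] at hr
  have := hB ⟨b, rfl⟩
  omega

/-- Let `g` be a function on the reduced walks ending at `v`, that is, on the vertices of the universal
cover of a graph, which is locally constant off a finite set (`hg`). If `g` takes the same value at both
ends of every lift of the cycles of a biconnected family, with the exception of some lifts through the
edge `v w` (`hline`), and if one lift through that edge is not exceptional, then `g` is constant off a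
finite set. Indeed, by induction on the distance to `v` every branch of the cover away from `v` has a
single eventual value: the Whitehead graph at the root of the branch has no cut vertex, so its
subbranches are connected through lifts of cycles inside the branch. -/
theorem exists_eventually_const [Finite W] {ι : Type*} {C : ι → ImmersedCycle Γ}
    (hC : IsBiconnected C) {v w : W} (hvw : Γ.Adj v w) (g : ∀ a, Γ.Walk a v → α) (N : ℕ)
    (hg : ∀ a b (h : Γ.Adj b a) (q : Γ.Walk a v), IsReduced (.cons h q) → N ≤ q.length →
      g b (.cons h q) = g a q)
    (E : ∀ κ, Fin (C κ).len → Prop)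
    (hE : ∀ κ i, E κ i → ∃ j, (SimpleGraph.cycleGraph (C κ).len).Adj i j ∧ (C κ).toHom j = w)
    (hline : ∀ κ i (q : Γ.Walk ((C κ).toHom i) v), IsReduced q →
      (∀ j (h : (SimpleGraph.cycleGraph (C κ).len).Adj j i),
        IsReduced (.cons ((C κ).toHom.map_adj h) q)) → (q.length = 0 → ¬ E κ i) →
      ∃ z M, ∀ m (ξ : (SimpleGraph.cycleGraph (C κ).len).Walk m i), M ≤ ξ.length →
        IsReduced ((ξ.map (C κ).toHom).append q) → g _ ((ξ.map (C κ).toHom).append q) = z)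
    (p : Passage C v w) (hp : ¬ E p.1.1 p.1.2.1) :
    ∃ z M, ∀ a (q : Γ.Walk a v), M ≤ q.length → IsReduced q → g a q = z := by
  -- Two branches at `q` connected by a line have the same eventual value.
  have transfer (κ) (i j k) (hij : (SimpleGraph.cycleGraph (C κ).len).Adj i j)
      (hik : (SimpleGraph.cycleGraph (C κ).len).Adj i k) (q : Γ.Walk ((C κ).toHom i) v)
      (hq : IsReduced q) (hj : IsReduced (.cons ((C κ).toHom.map_adj hij.symm) q))
      (hk : IsReduced (.cons ((C κ).toHom.map_adj hik.symm) q)) (hjk : j ≠ k)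
      (hexc : q.length = 0 → ¬ E κ i)
      (z z' : α) (hz : EventuallyEq g ((C κ).toHom.map_adj hij.symm) q z)
      (hz' : EventuallyEq g ((C κ).toHom.map_adj hik.symm) q z') : z = z' := by
    obtain ⟨z₀, M, h⟩ := hline κ i q hq (fun l hl => by
      rcases (C κ).eq_or_eq_of_adj hij hik hjk hl.symm with rfl | rfl
      · exact hj
      · exact hk) hexc
    exact (hz.eq_of_line _ hij.symm hj ⟨M, h⟩).trans (hz'.eq_of_line _ hik.symm hk ⟨M, h⟩).symm
  have branch (n : ℕ) : ∀ a b (h : Γ.Adj b a) (q : Γ.Walk a v), IsReduced (.cons h q) →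
      N ≤ q.length + n → ∃ z, EventuallyEq g h q z := by
    induction n with
    | zero =>
      refine fun a b h q _ hN => ⟨g a q, 0, fun m r _ => ?_⟩
      induction r with
      | nil => exact fun hr => hg a _ h q hr hN
      | cons h' r ih =>
        intro hr
        rw [← ih h ‹_› (Nat.zero_le _) hr.of_cons]
        refine hg _ _ _ _ hr ?_
        simp only [SimpleGraph.Walk.length_append, SimpleGraph.Walk.length_cons]
        omega
    | succ n ih =>
      intro a b h q hr hN
      have ih' (c) (h' : Γ.Adj c b) (hred : IsReduced (.cons h' (.cons h q))) :=
        ih b c h' (.cons h q) hred (by simp only [SimpleGraph.Walk.length_cons]; omega)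
      by_cases hex : ∃ c, ∃ h' : Γ.Adj c b, IsReduced (.cons h' (.cons h q))
      · obtain ⟨c, h', hred⟩ := hex
        obtain ⟨z, hz⟩ := ih' c h' hred
        refine ⟨z, exists_bound_of_forall_eventuallyEq fun c' h'' hred' => ?_⟩
        have := hC.no_cut_vertex b a h (fun x => ∃ hx : Γ.Adj x b, EventuallyEq g hx (.cons h q) z)
          ?_ c c' h'.symm h''.symm (isReduced_cons_cons.1 hred).1 (isReduced_cons_cons.1 hred').1
          ⟨h', hz⟩
        · exact this.2
        · rintro κ i j k rfl hij hik hj hk ⟨_, hzj⟩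
          refine ⟨(C κ).toHom.map_adj hik.symm, ?_⟩
          have hredj : IsReduced (.cons ((C κ).toHom.map_adj hij.symm) (.cons h q)) :=
            isReduced_cons_cons.2 ⟨hj, hr⟩
          have hredk : IsReduced (.cons ((C κ).toHom.map_adj hik.symm) (.cons h q)) :=
            isReduced_cons_cons.2 ⟨hk, hr⟩
          by_cases hjk : j = k
          · subst hjk
            exact hzj
          obtain ⟨z', hz'⟩ := ih' _ ((C κ).toHom.map_adj hik.symm) hredk
          rwa [transfer κ i j k hij hik _ hr hredj hredk hjk (fun h => by simp at h) _ _ hzj hz']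
      · refine ⟨g a q, 1, fun m r hlen hred => ?_⟩
        cases r with
        | nil => simp at hlen
        | cons h₁ r =>
          obtain ⟨x, r', h', he⟩ := SimpleGraph.Walk.exists_cons_eq_concat h₁ r
          rw [he, SimpleGraph.Walk.concat_append] at hred
          exact (hex ⟨x, h', hred.of_append⟩).elim
  have root (b) (h : Γ.Adj b v) : ∃ z, EventuallyEq g h .nil z :=
    branch N v b h .nil trivial (by simp)
  have root_transfer (κ) (i j k) (hi : (C κ).toHom i = v)
      (hij : (SimpleGraph.cycleGraph (C κ).len).Adj i j)
      (hik : (SimpleGraph.cycleGraph (C κ).len).Adj i k) (hjk : j ≠ k) (hexc : ¬ E κ i) (z : α)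
      (hj : ∃ h : Γ.Adj ((C κ).toHom j) v, EventuallyEq g h .nil z) :
      ∃ h : Γ.Adj ((C κ).toHom k) v, EventuallyEq g h .nil z := by
    subst hi
    refine ⟨(C κ).toHom.map_adj hik.symm, ?_⟩
    obtain ⟨z', hz'⟩ := root _ ((C κ).toHom.map_adj hik.symm)
    rwa [transfer κ i j k hij hik .nil trivial trivial trivial hjk (fun _ => hexc) z z' hj.2 hz']
  obtain ⟨⟨κ, i, j⟩, hij, hi, hj⟩ := p
  dsimp only at hij hi hj hp
  obtain ⟨k, hik, hkj⟩ := (C κ).exists_adj_ne (m := j) (i := i)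
  have hvk : Γ.Adj v ((C κ).toHom k) := hi ▸ (C κ).toHom.map_adj hik
  obtain ⟨z, hz⟩ := root _ hvk.symm
  suffices H : ∀ b (h : Γ.Adj b _), EventuallyEq g h .nil z by
    obtain ⟨M, hM⟩ := exists_bound_of_forall_eventuallyEq (q := .nil) fun b h _ => H b h
    exact ⟨z, M, fun a q hq hred => by simpa using hM a q hq (by simpa using hred)⟩
  intro b h
  by_cases hb : b = w
  · subst hb hj
    exact (root_transfer κ i k j hi hik hij hkj hp z ⟨_, hz⟩).2
  · have hk : (C κ).toHom k ≠ w :=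
      fun he => hkj ((C κ).immersion i k j hik hij (he.trans hj.symm))
    refine (hC.no_cut_vertex _ _ hvw (fun x => ∃ hx : Γ.Adj x _, EventuallyEq g hx .nil z)
      ?_ _ _ hvk h.symm hk hb ⟨_, hz⟩).2
    intro κ' i' j' k' hi' hij' hik' hj' hk' hz
    by_cases hjk : j' = k'
    · subst hjk
      exact hz
    refine root_transfer κ' i' j' k' hi' hij' hik' hjk (fun he => ?_) z hz
    obtain ⟨l, hl, hlw⟩ := hE _ _ he
    rcases (C κ').eq_or_eq_of_adj hij' hik' hjk hl with rfl | rfl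
    · exact hj' hlw
    · exact hk' hlw

end EdgePath

/-! ### Passages in a surface graph -/

namespace EdgePath

open ImmersedCycle TriangulatedSurface

theorem exists_bound_of_finite {ι : Type*} [Finite ι] {p : ι → ℕ → Prop}
    (h : ∀ i, ∃ N, ∀ n, N ≤ n → p i n) : ∃ N, ∀ i n, N ≤ n → p i n := by
  choose N hN using h
  obtain ⟨B, hB⟩ := (Set.finite_range N).bddAbove
  exact ⟨B, fun i n hn => hN i n ((hB ⟨i, rfl⟩).trans hn)⟩

theorem exists_length_bound {W : Type*} {Γ : SimpleGraph W} {a b : W} {s : Set (Cls Γ ∅ a b)}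
    (hs : s.Finite) : ∃ N, ∀ n, N ≤ n → ∀ u : Cls Γ ∅ a b, u.length = n → u ∉ s := by
  obtain ⟨B, hB⟩ := (hs.image Cls.length).bddAbove
  refine ⟨B + 1, fun n hn u hu hmem => ?_⟩
  have := hB ⟨u, hmem, rfl⟩
  omega

/-- A function on the universal cover whose coboundary is finite changes only finitely often under
prolongation by a fixed path. -/
theorem finite_ne_of_potential {V : Type*} {G : SimpleGraph V} {T : Set (Set V)} {y : V}
    {c : Sym2 (Σ a, Cls G T a y) → ZMod 2} (hc : c.support.Finite)
    {F : (Σ a, Cls G T a y) → ZMod 2}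
    (hF : ∀ u v, (liftGraph G T y G).Adj u v → F u = c s(u, v) + F v) {a b : V} (Z : Cls G T b a) :
    {u : Cls G T a y | F ⟨b, Z ⬝ u⟩ ≠ F ⟨a, u⟩}.Finite := by
  induction Z using Cls.ind with | h p =>
  induction p with
  | nil => simp [Cls.nil_comp]
  | @cons b b' a h p ih =>
    have h1 : {u : Cls G T a y |
        c s(⟨b, Cls.mk h.toWalk ⬝ (Cls.mk p ⬝ u)⟩, ⟨b', Cls.mk p ⬝ u⟩) ≠ 0}.Finite := by
      refine hc.preimage (f := fun u : Cls G T a y =>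
        s((⟨b, Cls.mk h.toWalk ⬝ (Cls.mk p ⬝ u)⟩ : Σ a, Cls G T a y), ⟨b', Cls.mk p ⬝ u⟩)) ?_
      intro u _ u' _ he
      rcases Sym2.eq_iff.1 he with ⟨-, h2⟩ | ⟨h2, -⟩
      · exact Cls.comp_left_cancel _ (eq_of_heq (Sigma.mk.inj_iff.1 h2).2)
      · exact (h.ne (congrArg Sigma.fst h2)).elim
    refine (h1.union ih).subset fun u hu => ?_
    by_contra hne
    simp only [Set.mem_union, Set.mem_ofPred_eq, not_or, not_not] at hne
    refine hu ?_
    rw [Cls.mk_cons, Cls.comp_assoc, hF _ _ (liftGraph_adj_mk h h _), hne.1, hne.2, zero_add]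

/-- An isomorphism of the fundamental group of a graph `Γ` with that of a surface which matches the
cycles `C` with the boundary circles, together with a choice of paths: `τ a` joins the base point of
`Γ` to `a`, `σ κ i` joins `0` to `i` in the cycle `κ`, and `P κ` joins the base point of the surface to
a vertex of the boundary circle `β κ`, such that the subgroup carried by the cycle along `τ`
corresponds to the one carried by the boundary circle along `P`. -/
structure SurfaceMarking {W : Type w} (Γ : SimpleGraph W) {ι : Type v} (C : ι → ImmersedCycle Γ) where
  /-- The surface. -/
  S : TriangulatedSurface
  /-- The base point of the graph. -/
  x : W
  /-- The base point of the surface. -/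
  y : S.V
  /-- The isomorphism of fundamental groups. -/
  φ : Γ.Pi1 x ≃* S.Pi1 y
  /-- The boundary circle of a cycle. -/
  β : ι ≃ S.BoundaryComponent
  /-- The paths in the graph. -/
  τ : ∀ a, Γ.Walk x a
  /-- The paths in the cycles. -/
  σ : ∀ κ i, (SimpleGraph.cycleGraph (C κ).len).Walk 0 i
  /-- A vertex on a boundary circle. -/
  b : ι → S.V
  mk_b : ∀ κ, S.boundary.connectedComponentMk (b κ) = (β κ).1
  /-- A path from the base point to that vertex. -/
  P : ∀ κ, S.skeleton.Walk y (b κ)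
  map_loopSubgroup : ∀ κ, Subgroup.map φ.toMonoidHom (loopSubgroup ∅ (C κ).toHom 0 (τ _)) =
    loopSubgroup S.triangles (SimpleGraph.Hom.ofLE S.boundary_le) (b κ) (P κ)

variable {W : Type w} {Γ : SimpleGraph W} {ι : Type v} {C : ι → ImmersedCycle Γ}

theorem exists_surfaceMarking (hΓ : Γ.Connected) (h : Γ.IsSurfaceWithPeripheral C) :
    Nonempty (SurfaceMarking Γ C) := by
  obtain ⟨S, x, y, φ, β, h⟩ := h
  have τ (a : W) : Γ.Walk x a := (hΓ.preconnected x a).some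
  have σ (κ : ι) (i : Fin (C κ).len) : (SimpleGraph.cycleGraph (C κ).len).Walk 0 i :=
    (SimpleGraph.cycleGraph_preconnected 0 i).some
  have key (κ : ι) : Subgroup.map φ.toMonoidHom (loopSubgroup ∅ (C κ).toHom 0 (τ _)) ∈
      S.peripheralSubgroups (β κ) y := by
    rw [← h κ]
    exact ⟨_, ⟨0, τ _, rfl⟩, rfl⟩
  choose b hb P hP using key
  exact ⟨⟨S, x, y, φ, β, τ, σ, b, hb, P, hP⟩⟩

namespace SurfaceMarking

variable (D : SurfaceMarking Γ C)

/-- The isomorphism of fundamental groups, on classes of paths. -/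
def iso (g : Cls Γ ∅ D.x D.x) : Cls D.S.skeleton D.S.triangles D.y D.y := D.φ g

theorem iso_comp (g g' : Cls Γ ∅ D.x D.x) : D.iso (g ⬝ g') = D.iso g ⬝ D.iso g' :=
  D.φ.map_mul' g g'

theorem iso_inv (g : Cls Γ ∅ D.x D.x) : D.iso g.inv = (D.iso g).inv :=
  map_inv D.φ (show Γ.Pi1 D.x from g)

theorem iso_injective : Function.Injective D.iso := D.φ.injective

theorem iso_surjective : Function.Surjective D.iso := D.φ.surjective

/-- The class of `τ a`. -/
def t (a : W) : Cls Γ ∅ D.x a := Cls.mk (D.τ a)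

/-- The image of a path in a cycle. -/
def arc {κ : ι} {i j : Fin (C κ).len} (ξ : (SimpleGraph.cycleGraph (C κ).len).Walk i j) :
    Cls Γ ∅ ((C κ).toHom i) ((C κ).toHom j) := Cls.mk (ξ.map (C κ).toHom)

theorem arc_append {κ : ι} {i j k : Fin (C κ).len}
    (ξ : (SimpleGraph.cycleGraph (C κ).len).Walk i j)
    (ξ' : (SimpleGraph.cycleGraph (C κ).len).Walk j k) : arc (ξ.append ξ') = arc ξ ⬝ arc ξ' := by
  rw [arc, SimpleGraph.Walk.map_append]
  rfl

theorem arc_reverse {κ : ι} {i j : Fin (C κ).len}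
    (ξ : (SimpleGraph.cycleGraph (C κ).len).Walk i j) : arc ξ.reverse = (arc ξ).inv := by
  rw [arc, ← SimpleGraph.Walk.reverse_map]
  rfl

theorem mem_loopSubgroup_iff (κ : ι) (g : Cls Γ ∅ D.x D.x) :
    (∃ η : (SimpleGraph.cycleGraph (C κ).len).Walk 0 0, g = D.t _ ⬝ arc η ⬝ (D.t _).inv) ↔
    ∃ ζ : D.S.boundary.Walk (D.b κ) (D.b κ), D.iso g =
      Cls.mk (D.P κ) ⬝ Cls.mk (ζ.map (.ofLE D.S.boundary_le)) ⬝ (Cls.mk (D.P κ)).inv := by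
  rw [← mem_loopSubgroup (T := D.S.triangles) (.ofLE D.S.boundary_le) (p := D.P κ) (g := D.iso g),
    ← D.map_loopSubgroup κ]
  refine (mem_loopSubgroup (T := ∅) (C κ).toHom (p := D.τ _) (g := g)).symm.trans ?_
  exact (Subgroup.mem_map_iff_mem D.φ.injective).symm

variable {v : W} (p₀ : Γ.Walk v D.x)

/-- The vertex on the boundary of the universal cover of the surface that corresponds to the vertex
`i` of the lift of the cycle `κ` through the vertex `u` of the universal cover of `Γ`. Lifts of cycles
correspond in this way to boundary lines. -/
def boundaryPoint (κ : ι) (i : Fin (C κ).len) (u : Cls Γ ∅ ((C κ).toHom i) v) : D.S.Cover D.y :=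
  ⟨D.b κ, (Cls.mk (D.P κ)).inv ⬝ D.iso (D.t _ ⬝ arc (D.σ κ i) ⬝ u ⬝ Cls.mk p₀)⟩

theorem eq_of_reachable {κ κ' : ι} {i : Fin (C κ).len} {i' : Fin (C κ').len}
    {u : Cls Γ ∅ ((C κ).toHom i) v} {u' : Cls Γ ∅ ((C κ').toHom i') v}
    (h : (D.S.coverBoundary D.y).Reachable (D.boundaryPoint p₀ κ i u) (D.boundaryPoint p₀ κ' i' u')) :
    κ = κ' := by
  obtain ⟨ζ, -⟩ := (liftGraph_reachable D.S.boundary_le).1 h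
  refine D.β.injective (Subtype.ext ?_)
  rw [← D.mk_b, ← D.mk_b]
  exact SimpleGraph.ConnectedComponent.sound ⟨ζ⟩

/-- Two points lie on the same boundary line if and only if they come from the same lift of a cycle. -/
theorem reachable_iff {κ : ι} {i i' : Fin (C κ).len}
    {u : Cls Γ ∅ ((C κ).toHom i) v} {u' : Cls Γ ∅ ((C κ).toHom i') v} :
    (D.S.coverBoundary D.y).Reachable (D.boundaryPoint p₀ κ i u) (D.boundaryPoint p₀ κ i' u') ↔
      ∃ ξ : (SimpleGraph.cycleGraph (C κ).len).Walk i i', u = arc ξ ⬝ u' := by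
  have h1 := D.mem_loopSubgroup_iff κ ((D.t _ ⬝ arc (D.σ κ i) ⬝ u ⬝ Cls.mk p₀) ⬝
    (D.t _ ⬝ arc (D.σ κ i') ⬝ u' ⬝ Cls.mk p₀).inv)
  rw [liftGraph_reachable D.S.boundary_le]
  constructor
  · rintro ⟨ζ, hζ⟩
    obtain ⟨η, hη⟩ := h1.2 ⟨ζ, by
      dsimp only [boundaryPoint] at hζ
      rw [D.iso_comp, D.iso_inv, ← Cls.comp_inv_assoc (Cls.mk (D.P κ))
        (D.iso (D.t _ ⬝ arc (D.σ κ i) ⬝ u ⬝ Cls.mk p₀)), hζ]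
      simp only [Cls.comp_assoc, Cls.comp_inv, Cls.comp_nil]⟩
    refine ⟨(D.σ κ i).reverse.append (η.append (D.σ κ i')), ?_⟩
    rw [arc_append, arc_append, arc_reverse]
    have h2 := congrArg (fun z => (arc (D.σ κ i)).inv ⬝ (D.t _).inv ⬝ z ⬝ D.t _ ⬝
      arc (D.σ κ i') ⬝ u') hη
    simpa only [Cls.inv_comp_rev, Cls.comp_assoc, Cls.inv_comp_assoc, Cls.comp_inv_assoc,
      Cls.inv_comp, Cls.comp_nil] using h2
  · rintro ⟨ξ, rfl⟩
    obtain ⟨ζ, hζ⟩ := h1.1 ⟨(D.σ κ i).append (ξ.append (D.σ κ i').reverse), by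
      rw [arc_append, arc_append, arc_reverse]
      simp only [Cls.inv_comp_rev, Cls.comp_assoc, Cls.comp_inv_assoc]⟩
    refine ⟨ζ, ?_⟩
    dsimp only [boundaryPoint]
    rw [D.iso_comp, D.iso_inv] at hζ
    have h2 := congrArg (fun z => (Cls.mk (D.P κ)).inv ⬝ z ⬝
      D.iso (D.t _ ⬝ arc (D.σ κ i') ⬝ u' ⬝ Cls.mk p₀)) hζ
    simpa only [Cls.comp_assoc, Cls.inv_comp_assoc, Cls.inv_comp, Cls.comp_nil] using h2

end SurfaceMarking

theorem passage_eq {v w : W} {p p' : Passage C v w}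
    (h : (⟨p.1.1, p.1.2.1⟩ : Σ κ, Fin (C κ).len) = ⟨p'.1.1, p'.1.2.1⟩) : p = p' := by
  obtain ⟨⟨κ, i, j⟩, hij, hi, hj⟩ := p
  obtain ⟨⟨κ', i', j'⟩, hij', hi', hj'⟩ := p'
  obtain rfl : κ = κ' := congrArg Sigma.fst h
  obtain rfl : i = i' := eq_of_heq (Sigma.mk.inj_iff.1 h).2
  obtain rfl : j = j' := (C κ).immersion i j j' hij hij' (hj.trans hj'.symm)
  rfl

namespace SurfaceMarking

variable (D : SurfaceMarking Γ C) {v : W} (p₀ : Γ.Walk v D.x)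

/-- A lift of a cycle through the end of a reduced walk `q` that does not run along the last edge of
`q` meets the root `v` of the universal cover only if `q` is trivial, and then it determines the cycle and
the vertex of the cycle that lies at `v`. -/
theorem eq_of_reachable_root {κ κ' : ι} {i : Fin (C κ).len} {i' : Fin (C κ').len}
    {q : Γ.Walk ((C κ).toHom i) v} (hq : IsReduced q)
    (hjoin : ∀ j (h : (SimpleGraph.cycleGraph (C κ).len).Adj j i),
      IsReduced (.cons ((C κ).toHom.map_adj h) q))
    {q' : Γ.Walk ((C κ').toHom i') v} (hq' : q'.length = 0)
    (h : (D.S.coverBoundary D.y).Reachable (D.boundaryPoint p₀ κ i (Cls.mk q))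
      (D.boundaryPoint p₀ κ' i' (Cls.mk q'))) :
    q.length = 0 ∧ (⟨κ, i⟩ : Σ κ, Fin (C κ).len) = ⟨κ', i'⟩ := by
  obtain rfl := D.eq_of_reachable p₀ h
  obtain ⟨ξ, hξ⟩ := (D.reachable_iff p₀).1 h.symm
  obtain ⟨ξ', hr, hh⟩ := exists_isReduced ∅ ξ
  have he : Cls.mk q' = (Cls.mk ((ξ'.map (C κ).toHom).append q) : Cls Γ ∅ _ _) := by
    rw [hξ, Cls.mk_append]
    congr 1
    exact Cls.mk_eq_mk.2 (hh.map _ fun _ h => h.elim)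
  have hred := hr.map_append (C κ).toHom (C κ).immersion hjoin hq
  have hlen := congrArg Cls.length he
  have hq'' : IsReduced q' := by
    cases q' with
    | nil => trivial
    | cons => simp at hq'
  rw [hq''.length_mk, hred.length_mk, hq', SimpleGraph.Walk.length_append,
    SimpleGraph.Walk.length_map] at hlen
  refine ⟨by omega, ?_⟩
  obtain rfl := SimpleGraph.Walk.eq_of_length_eq_zero (show ξ'.length = 0 by omega)
  rfl

theorem exists_boundary_adj (κ : ι) (u : D.S.Cover D.y) (hu : u.1 = D.b κ) :
    ∃ u', (D.S.coverBoundary D.y).Adj u u' := by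
  obtain ⟨a, x⟩ := u
  dsimp only at hu
  subst hu
  have : ∃ c, D.S.boundary.Adj (D.b κ) c := by
    obtain ⟨i, ⟨c, hc⟩, hi⟩ := (D.β κ).2
    rw [← D.mk_b] at hi
    obtain ⟨p⟩ := SimpleGraph.ConnectedComponent.exact hi.symm
    cases p with
    | nil => exact ⟨c, hc⟩
    | cons h _ => exact ⟨_, h⟩
  obtain ⟨c, hc⟩ := this
  exact ⟨_, (liftGraph_adj_mk hc.symm (D.S.boundary_le hc.symm) x).symm⟩

/-- A function `F` on the universal cover of the surface is transported to a function on the universal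
cover of the graph with base point `v`. -/
def transport (F : D.S.Cover D.y → ZMod 2) (a : W) (u : Cls Γ ∅ a v) : ZMod 2 :=
  F ⟨D.y, D.iso (D.t a ⬝ u ⬝ Cls.mk p₀)⟩

variable {c : Sym2 (D.S.Cover D.y) → ZMod 2} {F : D.S.Cover D.y → ZMod 2}

theorem finite_transport_ne (hc : c.support.Finite)
    (hF : ∀ u v, (D.S.coverSkeleton D.y).Adj u v → F u = c s(u, v) + F v) (a : W) {b : D.S.V}
    (Z : Cls D.S.skeleton D.S.triangles b D.y) :
    {u : Cls Γ ∅ a v | F ⟨b, Z ⬝ D.iso (D.t a ⬝ u ⬝ Cls.mk p₀)⟩ ≠ D.transport p₀ F a u}.Finite :=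
  (finite_ne_of_potential hc hF Z).preimage fun _ _ _ _ h =>
    Cls.comp_right_cancel _ (Cls.comp_left_cancel _ (D.iso_injective h))

theorem finite_transport_cons_ne (hc : c.support.Finite)
    (hF : ∀ u v, (D.S.coverSkeleton D.y).Adj u v → F u = c s(u, v) + F v) {a b : W}
    (h : Γ.Adj b a) :
    {u : Cls Γ ∅ a v | D.transport p₀ F b (Cls.mk h.toWalk ⬝ u) ≠ D.transport p₀ F a u}.Finite := by
  convert D.finite_transport_ne p₀ hc hF a (D.iso (D.t b ⬝ Cls.mk h.toWalk ⬝ (D.t a).inv)) using 5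
  · rw [transport, ← D.iso_comp]
    simp only [Cls.comp_assoc, Cls.inv_comp_assoc]

theorem finite_transport_boundaryPoint_ne (hc : c.support.Finite)
    (hF : ∀ u v, (D.S.coverSkeleton D.y).Adj u v → F u = c s(u, v) + F v) (κ : ι)
    (i : Fin (C κ).len) :
    {u | F (D.boundaryPoint p₀ κ i u) ≠ D.transport p₀ F _ u}.Finite := by
  convert D.finite_transport_ne p₀ hc hF ((C κ).toHom i) ((Cls.mk (D.P κ)).inv ⬝
    D.iso (D.t _ ⬝ arc (D.σ κ i) ⬝ (D.t _).inv)) using 5 with u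
  · rw [boundaryPoint, Cls.comp_assoc, ← D.iso_comp]
    simp only [Cls.comp_assoc, Cls.inv_comp_assoc]

/-- If the transported function is constant on long reduced walks, then the function on the universal
cover of the surface is constant off a finite set. -/
theorem finite_ne_of_transport [Finite W] (hc : c.support.Finite)
    (hF : ∀ u v, (D.S.coverSkeleton D.y).Adj u v → F u = c s(u, v) + F v) {z : ZMod 2} {M : ℕ}
    (hz : ∀ a (q : Γ.Walk a v), M ≤ q.length → IsReduced q →
      D.transport p₀ F a (Cls.mk q) = z) : {u | F u ≠ z}.Finite := by
  classical
  have := Fintype.ofFinite W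
  have := D.S.finite
  have h0 : {X : Cls D.S.skeleton D.S.triangles D.y D.y | F ⟨D.y, X⟩ ≠ z}.Finite := by
    have hfin : {q : Γ.Walk v v | q.length < M}.Finite := Set.toFinite _
    refine (hfin.image fun q => D.iso (D.t v ⬝ Cls.mk q ⬝ Cls.mk p₀)).subset fun X hX => ?_
    obtain ⟨g, rfl⟩ := D.iso_surjective X
    obtain ⟨q, hq⟩ := Cls.exists_rep ((D.t v).inv ⬝ g ⬝ (Cls.mk p₀).inv)
    obtain ⟨q', hr, hh⟩ := exists_isReduced ∅ q
    rw [Cls.mk_eq_mk.2 hh] at hq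
    have hg : D.t v ⬝ Cls.mk q' ⬝ Cls.mk p₀ = g := by
      rw [hq]
      simp only [Cls.comp_assoc, Cls.comp_inv_assoc, Cls.inv_comp, Cls.comp_nil]
    refine ⟨q', ?_, congrArg D.iso hg⟩
    by_contra hlt
    refine hX ?_
    rw [← hz v q' (not_lt.1 hlt) hr, transport, hg]
  have h1 (a : D.S.V) : {X : Cls D.S.skeleton D.S.triangles a D.y | F ⟨a, X⟩ ≠ z}.Finite := by
    by_cases hne : Nonempty (Cls D.S.skeleton D.S.triangles a D.y)
    · obtain ⟨Z⟩ := hne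
      refine (h0.union (finite_ne_of_potential hc hF Z)).image (fun X => Z ⬝ X) |>.subset
        fun X hX => ?_
      refine ⟨Z.inv ⬝ X, ?_, Cls.comp_inv_assoc Z X⟩
      by_contra hmem
      simp only [Set.mem_union, Set.mem_ofPred_eq, not_or, not_not, Cls.comp_inv_assoc] at hmem
      exact hX (hmem.2.trans hmem.1)
    · exact Set.Finite.subset Set.finite_empty fun X _ => hne ⟨X⟩
  refine (Set.finite_iUnion fun a => (h1 a).image (Sigma.mk a)).subset ?_
  rintro ⟨a, X⟩ hX
  exact Set.mem_iUnion.2 ⟨a, X, hX, rfl⟩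

end SurfaceMarking

open Classical in
/-- If the fundamental group of a graph with a biconnected family of cycles is that of a surface with
the cycles as boundary, then no three passages of cycles run through the same edge. The cocycle dual to
an arc between the boundary lines of two of the passages separates the ends of these two lines only. In
the universal cover of the graph this forces its potential to be constant at infinity, which contradicts
that the arc meets the first boundary line once. -/
theorem SurfaceMarking.not_three_passages [Finite W] [Finite ι] (hΓ : Γ.Connected)
    (hC : IsBiconnected C) (D : SurfaceMarking Γ C) {v w : W} (hvw : Γ.Adj v w)
    {p₁ p₂ p₃ : Passage C v w} (h12 : p₁ ≠ p₂) (h13 : p₁ ≠ p₃) (h23 : p₂ ≠ p₃) : False := by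
  obtain ⟨p₀⟩ := hΓ.preconnected v D.x
  have root (p : Passage C v w) : ∃ q : Γ.Walk ((C p.1.1).toHom p.1.2.1) v, q.length = 0 := by
    rw [p.2.2.1]
    exact ⟨.nil, rfl⟩
  obtain ⟨q₁, hq₁⟩ := root p₁
  obtain ⟨q₂, hq₂⟩ := root p₂
  obtain ⟨e₁, he₁⟩ := D.exists_boundary_adj p₁.1.1
    (D.boundaryPoint p₀ p₁.1.1 p₁.1.2.1 (Cls.mk q₁)) rfl
  obtain ⟨e₂, he₂⟩ := D.exists_boundary_adj p₂.1.1
    (D.boundaryPoint p₀ p₂.1.1 p₂.1.2.1 (Cls.mk q₂)) rfl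
  have nil_of_length {a : W} {q : Γ.Walk a v} (h : q.length = 0) : IsReduced q ∧
      ∀ b (h : Γ.Adj b a), IsReduced (.cons h q) := by
    cases q with
    | nil => exact ⟨trivial, fun _ _ => trivial⟩
    | cons => simp at h
  have hne12 : ¬ (D.S.coverBoundary D.y).Reachable
      (D.boundaryPoint p₀ p₁.1.1 p₁.1.2.1 (Cls.mk q₁))
      (D.boundaryPoint p₀ p₂.1.1 p₂.1.2.1 (Cls.mk q₂)) := fun h =>
    h12 (passage_eq (D.eq_of_reachable_root p₀ (nil_of_length hq₁).1
      (fun j hj => (nil_of_length hq₁).2 _ _) hq₂ h).2)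
  generalize hu₁ : D.boundaryPoint p₀ p₁.1.1 p₁.1.2.1 (Cls.mk q₁) = u₁ at *
  generalize hu₂ : D.boundaryPoint p₀ p₂.1.1 p₂.1.2.1 (Cls.mk q₂) = u₂ at *
  obtain ⟨c, hfin, hcoc, hbd⟩ := exists_cocycle he₁ he₂
  obtain ⟨F, hF⟩ := hcoc.exists_potential
  -- On the other boundary lines the potential is constant.
  have hconst {a b : D.S.Cover D.y} (hab : (D.S.coverBoundary D.y).Reachable a b)
      (h1 : ¬ (D.S.coverBoundary D.y).Reachable a u₁)
      (h2 : ¬ (D.S.coverBoundary D.y).Reachable a u₂) : F a = F b := by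
    obtain ⟨p⟩ := hab
    induction p with
    | nil => rfl
    | @cons a b _ h p ih =>
      rw [← ih (fun h' => h1 (h.reachable.trans h')) (fun h' => h2 (h.reachable.trans h')),
        hF _ _ (coverBoundary_le h), hbd _ _ h, if_neg, if_neg]
      · simp
      · intro he
        rcases Sym2.eq_iff.1 he with ⟨he, -⟩ | ⟨-, he⟩
        · exact h2 (he ▸ .rfl)
        · exact h2 (he ▸ h.reachable)
      · intro he
        rcases Sym2.eq_iff.1 he with ⟨he, -⟩ | ⟨-, he⟩
        · exact h1 (he ▸ .rfl)
        · exact h1 (he ▸ h.reachable)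
  -- Beyond `N` the transported potential is locally constant in the tree. Beyond `N'` it agrees with
  -- the potential on the boundary lines.
  obtain ⟨N, hN⟩ := exists_bound_of_finite (ι := {e : W × W // Γ.Adj e.2 e.1}) fun e =>
    exists_length_bound (D.finite_transport_cons_ne p₀ hfin hF e.2)
  obtain ⟨N', hN'⟩ := exists_bound_of_finite (ι := Σ κ, Fin (C κ).len) fun e =>
    exists_length_bound (D.finite_transport_boundaryPoint_ne p₀ hfin hF e.1 e.2)
  obtain ⟨z, M, hz⟩ : ∃ z M, ∀ a (q : Γ.Walk a v), M ≤ q.length → IsReduced q →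
      D.transport p₀ F a (Cls.mk q) = z := by
    refine exists_eventually_const hC hvw (fun a q => D.transport p₀ F a (Cls.mk q)) N ?_
      (fun κ i => (⟨κ, i⟩ : Σ κ, Fin (C κ).len) = ⟨p₁.1.1, p₁.1.2.1⟩ ∨
        (⟨κ, i⟩ : Σ κ, Fin (C κ).len) = ⟨p₂.1.1, p₂.1.2.1⟩) ?_ ?_ p₃ ?_
    · intro a b h q hq hlen
      have := hN ⟨(a, b), h⟩ _ hlen (Cls.mk q) hq.of_cons.length_mk
      exact not_not.1 this
    · rintro κ i (h | h)
      · obtain rfl : κ = p₁.1.1 := congrArg Sigma.fst h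
        obtain rfl := eq_of_heq (Sigma.mk.inj_iff.1 h).2
        exact ⟨p₁.1.2.2, p₁.2.1, p₁.2.2.2⟩
      · obtain rfl : κ = p₂.1.1 := congrArg Sigma.fst h
        obtain rfl := eq_of_heq (Sigma.mk.inj_iff.1 h).2
        exact ⟨p₂.1.2.2, p₂.2.1, p₂.2.2.2⟩
    · intro κ i q hq hjoin hexc
      refine ⟨F (D.boundaryPoint p₀ κ i (Cls.mk q)), N', fun m ξ hlen hred => ?_⟩
      have h1 := hN' ⟨κ, m⟩ _ (by
        rw [SimpleGraph.Walk.length_append, SimpleGraph.Walk.length_map]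
        exact hlen.trans (Nat.le_add_right _ _)) _ hred.length_mk
      refine (not_not.1 h1).symm.trans (hconst ((D.reachable_iff p₀).2 ⟨ξ.reverse, ?_⟩) ?_ ?_).symm
      · rw [arc_reverse, Cls.mk_append]
        exact (Cls.inv_comp_assoc _ _).symm
      · intro h
        rw [← hu₁] at h
        obtain ⟨h0, h⟩ := D.eq_of_reachable_root p₀ hq hjoin hq₁ h
        exact hexc h0 (.inl h)
      · intro h
        rw [← hu₂] at h
        obtain ⟨h0, h⟩ := D.eq_of_reachable_root p₀ hq hjoin hq₂ h
        exact hexc h0 (.inr h)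
    · rintro (h | h)
      · exact h13 (passage_eq h).symm
      · exact h23 (passage_eq h).symm
  refine not_finite_of_single_edge (D.finite_ne_of_transport p₀ hfin hF hz) he₁ ?_
  intro p q hpq hp
  rw [hF _ _ (coverBoundary_le hpq), hbd _ _ hpq, if_neg (c := s(p, q) = s(u₂, e₂))]
  · split_ifs with h <;> simp [h]
  · intro he
    refine hne12 (hp.symm.trans ?_)
    rcases Sym2.eq_iff.1 he with ⟨he, -⟩ | ⟨-, he⟩
    · exact he ▸ .rfl
    · exact he ▸ hpq.reachable

theorem card_passage_eq_two [Finite W] [Finite ι] (hΓ : Γ.Connected) (hC : IsBiconnected C)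
    (h : Γ.IsSurfaceWithPeripheral C) {v w : W} (hvw : Γ.Adj v w) :
    Nat.card (Passage C v w) = 2 := by
  obtain ⟨D⟩ := exists_surfaceMarking hΓ h
  have := hC.nontrivial_passage v w hvw
  have h2 : 1 < Nat.card (Passage C v w) := Finite.one_lt_card
  by_contra hne
  have := Fintype.ofFinite (Passage C v w)
  have h3 : 2 < Fintype.card (Passage C v w) := by
    rw [← Nat.card_eq_fintype_card]
    omega
  obtain ⟨p₁, p₂, p₃, h12, h13, h23⟩ := Fintype.two_lt_card_iff.1 h3
  exact D.not_three_passages hΓ hC hvw h12 h13 h23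

end EdgePath

/-! ### The mapping cylinder of the cycles -/

namespace MappingCylinder

open EdgePath ImmersedCycle

variable {W : Type w} {Γ : SimpleGraph W} {U K : Type} (e : W ≃ U) (C : K → ImmersedCycle Γ)

/-- The vertices of the mapping cylinder of a family of cycles in a graph: those of the graph (indexed
by `U` through the bijection `e`, to place them in the lowest universe), and those of the cycles. -/
abbrev Vertex (_ : W ≃ U) (C : K → ImmersedCycle Γ) : Type := U ⊕ Σ k, Fin (C k).len

/-- A vertex of the graph as a vertex of the mapping cylinder. -/
def inGraph (a : W) : Vertex e C := .inl (e a)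

/-- A vertex of a cycle as a vertex of the mapping cylinder. -/
def inCycle (k : K) (i : Fin (C k).len) : Vertex e C := .inr ⟨k, i⟩

variable {e C}

theorem inGraph_inj {a b : W} : inGraph e C a = inGraph e C b ↔ a = b :=
  Sum.inl_injective.eq_iff.trans e.injective.eq_iff

theorem inCycle_inj {k k' : K} {i : Fin (C k).len} {i' : Fin (C k').len} :
    inCycle e C k i = inCycle e C k' i' ↔ (⟨k, i⟩ : Σ k, Fin (C k).len) = ⟨k', i'⟩ :=
  Sum.inr_injective.eq_iff

theorem inCycle_inj_same {k : K} {i i' : Fin (C k).len} :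
    inCycle e C k i = inCycle e C k i' ↔ i = i' := by
  rw [inCycle_inj]
  exact sigma_mk_injective.eq_iff

theorem inGraph_ne_inCycle {a : W} {k : K} {i : Fin (C k).len} :
    inGraph e C a ≠ inCycle e C k i := Sum.inl_ne_inr

theorem vertex_cases (y : Vertex e C) : (∃ a, inGraph e C a = y) ∨ ∃ k i, inCycle e C k i = y := by
  match y with
  | .inl u => exact .inl ⟨e.symm u, congrArg Sum.inl (e.apply_symm_apply u)⟩
  | .inr ⟨k, i⟩ => exact .inr ⟨k, i, rfl⟩

variable (e C) in
/-- The square over the edge from `i` to `i + 1` of a cycle is divided into two triangles: the first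
one contains this edge, the second one its image in the graph. -/
def tri : (Σ k, Fin (C k).len) × Bool → Set (Vertex e C)
  | (⟨k, i⟩, false) => {inCycle e C k i, inCycle e C k (i + 1), inGraph e C ((C k).toHom i)}
  | (⟨k, i⟩, true) => {inCycle e C k (i + 1), inGraph e C ((C k).toHom i),
      inGraph e C ((C k).toHom (i + 1))}

theorem inGraph_mem_tri_false {a : W} {k : K} {i : Fin (C k).len} :
    inGraph e C a ∈ tri e C (⟨k, i⟩, false) ↔ a = (C k).toHom i := by
  simp [tri, inGraph_inj, inGraph_ne_inCycle]

theorem inGraph_mem_tri_true {a : W} {k : K} {i : Fin (C k).len} :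
    inGraph e C a ∈ tri e C (⟨k, i⟩, true) ↔ a = (C k).toHom i ∨ a = (C k).toHom (i + 1) := by
  simp [tri, inGraph_inj, inGraph_ne_inCycle]

theorem inCycle_mem_tri_false {k k' : K} {i : Fin (C k).len} {i' : Fin (C k').len} :
    inCycle e C k' i' ∈ tri e C (⟨k, i⟩, false) ↔
      (⟨k', i'⟩ : Σ k, Fin (C k).len) = ⟨k, i⟩ ∨ (⟨k', i'⟩ : Σ k, Fin (C k).len) = ⟨k, i + 1⟩ := by
  simp only [tri, Set.mem_insert_iff, Set.mem_singleton_iff, inCycle_inj,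
    inGraph_ne_inCycle.symm, or_false]

theorem inCycle_mem_tri_true {k k' : K} {i : Fin (C k).len} {i' : Fin (C k').len} :
    inCycle e C k' i' ∈ tri e C (⟨k, i⟩, true) ↔ (⟨k', i'⟩ : Σ k, Fin (C k).len) = ⟨k, i + 1⟩ := by
  simp only [tri, Set.mem_insert_iff, Set.mem_singleton_iff, inCycle_inj,
    inGraph_ne_inCycle.symm, or_false]

theorem toHom_succ_ne (k : K) (i : Fin (C k).len) : (C k).toHom i ≠ (C k).toHom (i + 1) :=
  ((C k).toHom.map_adj ((C k).adj_succ i)).ne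

theorem tri_injective : Function.Injective (tri e C) := by
  rintro ⟨⟨k, i⟩, b⟩ ⟨⟨k', i'⟩, b'⟩ h
  have mixed {k k' : K} {i : Fin (C k).len} {i' : Fin (C k').len}
      (h : tri e C (⟨k, i⟩, false) = tri e C (⟨k', i'⟩, true)) : False := by
    have h1 := inCycle_mem_tri_true.1 (h ▸ inCycle_mem_tri_false.2 (.inl rfl))
    have h2 := inCycle_mem_tri_true.1 (h ▸ inCycle_mem_tri_false.2 (.inr rfl))
    exact ((C k).adj_succ i).ne (eq_of_heq (Sigma.mk.inj_iff.1 (h1.trans h2.symm)).2)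
  cases b <;> cases b'
  · have h1 := inCycle_mem_tri_false.1 (h ▸ inCycle_mem_tri_false.2 (.inl rfl))
    have h2 := inCycle_mem_tri_false.1 (h ▸ inCycle_mem_tri_false.2 (.inr rfl))
    obtain rfl : k = k' := h1.elim (congrArg Sigma.fst) (congrArg Sigma.fst)
    simp only [sigma_mk_injective.eq_iff] at h1 h2
    have hne := ((C k).adj_succ i).ne
    have : i = i' := by
      refine (C k).sym2_succ_injective (Sym2.eq_iff.2 ?_)
      rcases h1 with h1 | h1 <;> rcases h2 with h2 | h2
      · exact (hne (h1.trans h2.symm)).elim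
      · exact .inl ⟨h1, h2⟩
      · exact .inr ⟨h1, h2⟩
      · exact (hne (h1.trans h2.symm)).elim
    rw [this]
  · exact (mixed h).elim
  · exact (mixed h.symm).elim
  · have h1 := inCycle_mem_tri_true.1 (h ▸ inCycle_mem_tri_true.2 rfl)
    obtain rfl : k = k' := congrArg Sigma.fst h1
    rw [add_right_cancel (sigma_mk_injective h1)]

theorem ncard_tri (p : (Σ k, Fin (C k).len) × Bool) : (tri e C p).ncard = 3 := by
  rw [Set.ncard_eq_three]
  obtain ⟨⟨k, i⟩, _ | _⟩ := p
  · refine ⟨_, _, _, ?_, ?_, ?_, rfl⟩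
    · exact fun h => ((C k).adj_succ i).ne (inCycle_inj_same.1 h)
    · exact inGraph_ne_inCycle.symm
    · exact inGraph_ne_inCycle.symm
  · refine ⟨_, _, _, ?_, ?_, ?_, rfl⟩
    · exact inGraph_ne_inCycle.symm
    · exact inGraph_ne_inCycle.symm
    · exact fun h => toHom_succ_ne k i (inGraph_inj.1 h)

/-- The triangles over an edge. -/
def star (a b : Vertex e C) : Set ((Σ k, Fin (C k).len) × Bool) := {p | a ∈ tri e C p ∧ b ∈ tri e C p}

theorem ncard_triangles (a b : Vertex e C) :
    {t ∈ Set.range (tri e C) | a ∈ t ∧ b ∈ t}.ncard = (star a b).ncard := by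
  rw [← Set.ncard_image_of_injective _ tri_injective]
  congr 1
  ext t
  constructor
  · rintro ⟨⟨p, rfl⟩, h⟩
    exact ⟨p, h, rfl⟩
  · rintro ⟨p, h, rfl⟩
    exact ⟨⟨p, rfl⟩, h⟩

theorem star_comm (a b : Vertex e C) : star a b = star b a := Set.ext fun _ => and_comm

theorem star_inGraph_inCycle (a : W) (k : K) (i : Fin (C k).len) :
    star (inGraph e C a) (inCycle e C k i) = ∅ ∨
      (a = (C k).toHom i ∧ star (inGraph e C a) (inCycle e C k i) =
        {(⟨k, i⟩, false), (⟨k, i - 1⟩, true)}) ∨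
      (a = (C k).toHom (i - 1) ∧ star (inGraph e C a) (inCycle e C k i) =
        {(⟨k, i - 1⟩, false), (⟨k, i - 1⟩, true)}) := by
  have hne : (C k).toHom (i - 1) ≠ (C k).toHom i := by
    have := toHom_succ_ne k (i - 1)
    rwa [sub_add_cancel] at this
  have mem (p) : p ∈ star (inGraph e C a) (inCycle e C k i) ↔
      (p = (⟨k, i⟩, false) ∧ a = (C k).toHom i) ∨
      (p = (⟨k, i - 1⟩, false) ∧ a = (C k).toHom (i - 1)) ∨
      (p = (⟨k, i - 1⟩, true) ∧ (a = (C k).toHom i ∨ a = (C k).toHom (i - 1))) := by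
    obtain ⟨⟨k', i'⟩, _ | _⟩ := p
    · change inGraph e C a ∈ tri e C _ ∧ inCycle e C k i ∈ tri e C _ ↔ _
      rw [inGraph_mem_tri_false, inCycle_mem_tri_false]
      constructor
      · rintro ⟨rfl, h | h⟩
        · obtain rfl : k = k' := congrArg Sigma.fst h
          obtain rfl := sigma_mk_injective h
          exact .inl ⟨rfl, rfl⟩
        · obtain rfl : k = k' := congrArg Sigma.fst h
          obtain rfl := sigma_mk_injective h
          rw [add_sub_cancel_right]
          exact .inr (.inl ⟨rfl, rfl⟩)
      · rintro (⟨h, rfl⟩ | ⟨h, rfl⟩ | ⟨h, -⟩)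
        · replace h := congrArg Prod.fst h
          obtain rfl : k' = k := congrArg Sigma.fst h
          obtain rfl := sigma_mk_injective h
          exact ⟨rfl, .inl rfl⟩
        · replace h := congrArg Prod.fst h
          obtain rfl : k' = k := congrArg Sigma.fst h
          obtain rfl := sigma_mk_injective h
          rw [sub_add_cancel]
          exact ⟨rfl, .inr rfl⟩
        · exact absurd (congrArg Prod.snd h) (by simp)
    · change inGraph e C a ∈ tri e C _ ∧ inCycle e C k i ∈ tri e C _ ↔ _
      rw [inGraph_mem_tri_true, inCycle_mem_tri_true]
      constructor
      · rintro ⟨h', h⟩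
        obtain rfl : k = k' := congrArg Sigma.fst h
        obtain rfl := sigma_mk_injective h
        rw [add_sub_cancel_right]
        exact .inr (.inr ⟨rfl, h'.symm⟩)
      · rintro (⟨h, -⟩ | ⟨h, -⟩ | ⟨h, h'⟩)
        · exact absurd (congrArg Prod.snd h) (by simp)
        · exact absurd (congrArg Prod.snd h) (by simp)
        · replace h := congrArg Prod.fst h
          obtain rfl : k' = k := congrArg Sigma.fst h
          obtain rfl := sigma_mk_injective h
          rw [sub_add_cancel]
          exact ⟨h'.symm, rfl⟩
  by_cases h1 : a = (C k).toHom i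
  · refine .inr (.inl ⟨h1, Set.ext fun p => (mem p).trans ?_⟩)
    have h2 : a ≠ (C k).toHom (i - 1) := fun h => hne (h.symm.trans h1)
    simp [h1, hne.symm]
  · by_cases h2 : a = (C k).toHom (i - 1)
    · refine .inr (.inr ⟨h2, Set.ext fun p => (mem p).trans ?_⟩)
      simp [h2, hne]
    · refine .inl (Set.eq_empty_of_forall_notMem fun p hp => ?_)
      simpa [h1, h2] using (mem p).1 hp

theorem star_inCycle_inCycle_of_adj {k : K} {i j : Fin (C k).len}
    (h : (SimpleGraph.cycleGraph (C k).len).Adj i j) :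
    (star (inCycle e C k i) (inCycle e C k j)).ncard = 1 := by
  wlog hij : j = i + 1 generalizing i j
  · rw [star_comm]
    exact this h.symm (((C k).adj_iff.1 h).resolve_left hij)
  subst hij
  refine Set.ncard_eq_one.2 ⟨(⟨k, i⟩, false), Set.ext fun p => ?_⟩
  constructor
  · obtain ⟨⟨k', i'⟩, _ | _⟩ := p
    · rintro ⟨h1, h2⟩
      rw [inCycle_mem_tri_false] at h1 h2
      obtain rfl : k = k' := h1.elim (congrArg Sigma.fst) (congrArg Sigma.fst)
      simp only [sigma_mk_injective.eq_iff] at h1 h2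
      have : i = i' := by
        refine (C k).sym2_succ_injective (Sym2.eq_iff.2 ?_)
        rcases h1 with h1 | h1 <;> rcases h2 with h2 | h2
        · exact (h.ne (h1.trans h2.symm)).elim
        · exact .inl ⟨h1, h2⟩
        · exact .inr ⟨h1, h2⟩
        · exact (h.ne (h1.trans h2.symm)).elim
      rw [this]
      rfl
    · rintro ⟨h1, h2⟩
      rw [inCycle_mem_tri_true] at h1 h2
      exact (h.ne (eq_of_heq (Sigma.mk.inj_iff.1 (h1.trans h2.symm)).2)).elim
  · rintro rfl
    exact ⟨inCycle_mem_tri_false.2 (.inl rfl), inCycle_mem_tri_false.2 (.inr rfl)⟩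

theorem adj_of_mem_star_inCycle {k k' : K} {i : Fin (C k).len} {i' : Fin (C k').len}
    (hne : inCycle e C k i ≠ inCycle e C k' i') {p}
    (hp : p ∈ star (inCycle e C k i) (inCycle e C k' i')) :
    ∃ j, (⟨k', i'⟩ : Σ k, Fin (C k).len) = ⟨k, j⟩ ∧ (SimpleGraph.cycleGraph (C k).len).Adj i j := by
  rw [Ne, inCycle_inj] at hne
  obtain ⟨⟨l, m⟩, _ | _⟩ := p
  · obtain ⟨h1, h2⟩ := hp
    rw [inCycle_mem_tri_false] at h1 h2
    rcases h1 with h1 | h1 <;> rcases h2 with h2 | h2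
    · exact (hne (h1.trans h2.symm)).elim
    · obtain rfl : k = l := congrArg Sigma.fst h1
      obtain rfl := sigma_mk_injective h1
      exact ⟨_, h2, (C k).adj_succ i⟩
    · obtain rfl : k = l := congrArg Sigma.fst h1
      obtain rfl := sigma_mk_injective h1
      exact ⟨_, h2, ((C k).adj_succ m).symm⟩
    · exact (hne (h1.trans h2.symm)).elim
  · obtain ⟨h1, h2⟩ := hp
    rw [inCycle_mem_tri_true] at h1 h2
    exact (hne (h1.trans h2.symm)).elim

theorem mem_star_inGraph_inGraph {a b : W} (hab : a ≠ b) {p} :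
    p ∈ star (inGraph e C a) (inGraph e C b) ↔
      p.2 = true ∧ s((C p.1.1).toHom p.1.2, (C p.1.1).toHom (p.1.2 + 1)) = s(a, b) := by
  obtain ⟨⟨k, i⟩, _ | _⟩ := p
  · change inGraph e C a ∈ tri e C _ ∧ inGraph e C b ∈ tri e C _ ↔ _
    rw [inGraph_mem_tri_false, inGraph_mem_tri_false]
    constructor
    · rintro ⟨rfl, rfl⟩
      exact (hab rfl).elim
    · simp
  · change inGraph e C a ∈ tri e C _ ∧ inGraph e C b ∈ tri e C _ ↔ _
    rw [inGraph_mem_tri_true, inGraph_mem_tri_true, Sym2.eq_iff]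
    constructor
    · rintro ⟨rfl | rfl, rfl | rfl⟩ <;> simp at hab ⊢
    · rintro ⟨-, ⟨rfl, rfl⟩ | ⟨rfl, rfl⟩⟩ <;> simp

theorem ncard_star_inGraph_inGraph {a b : W} (hab : a ≠ b) :
    (star (inGraph e C a) (inGraph e C b)).ncard = Nat.card (Passage C a b) := by
  classical
  have key {k : K} {i j : Fin (C k).len} (h : (SimpleGraph.cycleGraph (C k).len).Adj i j) :
      s(i, j) = s(if j = i + 1 then i else j, (if j = i + 1 then i else j) + 1) := by
    split_ifs with hj
    · rw [hj]
    · rw [← ((C k).adj_iff.1 h).resolve_left hj, Sym2.eq_swap]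
  symm
  refine Nat.card_eq_of_bijective (fun p : Passage C a b => (⟨(⟨p.1.1,
    if p.1.2.2 = p.1.2.1 + 1 then p.1.2.1 else p.1.2.2⟩, true), ?_⟩ :
      star (inGraph e C a) (inGraph e C b))) ⟨?_, ?_⟩
  · obtain ⟨⟨k, i, j⟩, hij, hi, hj⟩ := p
    refine (mem_star_inGraph_inGraph hab).2 ⟨rfl, ?_⟩
    have := congrArg (Sym2.map (C k).toHom) (key hij)
    refine this.symm.trans ?_
    change s(_, _) = _
    rw [hi, hj]
  · rintro ⟨⟨k, i, j⟩, hij, hi, hj⟩ ⟨⟨k', i', j'⟩, hij', hi', hj'⟩ h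
    replace h := congrArg Prod.fst (congrArg Subtype.val h)
    obtain rfl : k = k' := congrArg Sigma.fst h
    replace h := sigma_mk_injective h
    dsimp only at h hi hi' hj hj'
    have h2 := (key hij).trans ((congrArg (fun m => s(m, m + 1)) h).trans (key hij').symm)
    rcases Sym2.eq_iff.1 h2 with ⟨rfl, rfl⟩ | ⟨rfl, rfl⟩
    · rfl
    · exact (hab (hi.symm.trans hj')).elim
  · rintro ⟨⟨⟨k, i⟩, b'⟩, hp⟩
    obtain ⟨rfl, h⟩ := (mem_star_inGraph_inGraph hab).1 hp
    rcases Sym2.eq_iff.1 h with ⟨h1, h2⟩ | ⟨h1, h2⟩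
    · exact ⟨⟨⟨k, i, i + 1⟩, (C k).adj_succ i, h1, h2⟩, by simp⟩
    · refine ⟨⟨⟨k, i + 1, i⟩, ((C k).adj_succ i).symm, h2, h1⟩, ?_⟩
      have : i ≠ i + 1 + 1 := ((C k).succ_succ_ne i).symm
      simp [this]

end MappingCylinder

/-! ### The surface triangulated by the mapping cylinder -/

namespace MappingCylinder

open EdgePath ImmersedCycle

variable {W : Type w} {Γ : SimpleGraph W} {U K : Type} {e : W ≃ U} {C : K → ImmersedCycle Γ}

theorem ncard_star_inGraph_inGraph_eq (hcard : ∀ a b, Γ.Adj a b → Nat.card (Passage C a b) = 2)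
    {a b : W} (hab : a ≠ b) : (Γ.Adj a b ∧ (star (inGraph e C a) (inGraph e C b)).ncard = 2) ∨
      (star (inGraph e C a) (inGraph e C b)).ncard = 0 := by
  rw [ncard_star_inGraph_inGraph hab]
  by_cases h : Γ.Adj a b
  · exact .inl ⟨h, hcard a b h⟩
  · refine .inr (Nat.card_eq_zero.2 (.inl ⟨?_⟩))
    rintro ⟨⟨k, i, j⟩, hij, rfl, rfl⟩
    exact h ((C k).toHom.map_adj hij)

theorem ncard_star_inGraph_inCycle (a : W) (k : K) (i : Fin (C k).len) :
    (star (inGraph e C a) (inCycle e C k i)).ncard = 0 ∨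
      (star (inGraph e C a) (inCycle e C k i)).ncard = 2 := by
  rcases star_inGraph_inCycle a k i with h | ⟨-, h⟩ | ⟨-, h⟩ <;> rw [h]
  · exact .inl (Set.ncard_empty _)
  · exact .inr (Set.ncard_pair (by simp))
  · exact .inr (Set.ncard_pair (by simp))

/-- An edge of the mapping cylinder lies in exactly one triangle if it is an edge of a cycle; otherwise
the number of triangles is two or zero. -/
theorem ncard_star_cases (hcard : ∀ a b, Γ.Adj a b → Nat.card (Passage C a b) = 2)
    {x y : Vertex e C} (hxy : x ≠ y) :
    ((star x y).ncard = 1 ∧ ∃ k i j, (SimpleGraph.cycleGraph (C k).len).Adj i j ∧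
      x = inCycle e C k i ∧ y = inCycle e C k j) ∨ (star x y).ncard = 2 ∨ (star x y).ncard = 0 := by
  obtain ⟨a, rfl⟩ | ⟨k, i, rfl⟩ := vertex_cases x <;>
    obtain ⟨b, rfl⟩ | ⟨k', i', rfl⟩ := vertex_cases y
  · exact .inr ((ncard_star_inGraph_inGraph_eq hcard (fun h => hxy (congrArg _ h))).imp_left And.right)
  · exact .inr (ncard_star_inGraph_inCycle a k' i').symm
  · rw [star_comm]
    exact .inr (ncard_star_inGraph_inCycle b k i).symm
  · rcases (star (inCycle e C k i) (inCycle e C k' i')).eq_empty_or_nonempty with h | ⟨p, hp⟩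
    · rw [h, Set.ncard_empty]
      exact .inr (.inr rfl)
    · obtain ⟨j, hj, hij⟩ := adj_of_mem_star_inCycle hxy hp
      rw [inCycle_inj.2 hj]
      exact .inl ⟨star_inCycle_inCycle_of_adj hij, k, i, j, hij, rfl, rfl⟩

theorem ncard_star_le_two (hcard : ∀ a b, Γ.Adj a b → Nat.card (Passage C a b) = 2)
    {x y : Vertex e C} (hxy : x ≠ y) : (star x y).ncard ≤ 2 := by
  rcases ncard_star_cases hcard hxy with ⟨h, -⟩ | h | h <;> omega

variable (e C) in
/-- The 1-skeleton of the mapping cylinder. -/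
def skeleton : SimpleGraph (Vertex e C) :=
  SimpleGraph.fromRel fun x y => ∃ t ∈ Set.range (tri e C), x ∈ t ∧ y ∈ t

theorem skeleton_adj_of_mem {x y : Vertex e C} (hxy : x ≠ y) (p) (hx : x ∈ tri e C p)
    (hy : y ∈ tri e C p) : (skeleton e C).Adj x y :=
  (SimpleGraph.fromRel_adj _ _ _).2 ⟨hxy, .inl ⟨_, ⟨p, rfl⟩, hx, hy⟩⟩

theorem exists_mem_star_of_adj {x y : Vertex e C} (h : (skeleton e C).Adj x y) :
    x ≠ y ∧ (star x y).Nonempty := by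
  obtain ⟨hne, ⟨_, ⟨p, rfl⟩, h1, h2⟩ | ⟨_, ⟨p, rfl⟩, h1, h2⟩⟩ := (SimpleGraph.fromRel_adj _ _ _).1 h
  · exact ⟨hne, p, h1, h2⟩
  · exact ⟨hne, p, h2, h1⟩

theorem adj_inCycle_inGraph (k : K) (i : Fin (C k).len) :
    (skeleton e C).Adj (inCycle e C k i) (inGraph e C ((C k).toHom i)) :=
  skeleton_adj_of_mem inGraph_ne_inCycle.symm (⟨k, i⟩, false) (inCycle_mem_tri_false.2 (.inl rfl))
    (inGraph_mem_tri_false.2 rfl)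

theorem adj_inCycle_succ_inGraph (k : K) (i : Fin (C k).len) :
    (skeleton e C).Adj (inCycle e C k (i + 1)) (inGraph e C ((C k).toHom i)) :=
  skeleton_adj_of_mem inGraph_ne_inCycle.symm (⟨k, i⟩, false) (inCycle_mem_tri_false.2 (.inr rfl))
    (inGraph_mem_tri_false.2 rfl)

theorem adj_inCycle_inCycle {k : K} {i j : Fin (C k).len}
    (h : (SimpleGraph.cycleGraph (C k).len).Adj i j) :
    (skeleton e C).Adj (inCycle e C k i) (inCycle e C k j) := by
  wlog hij : j = i + 1 generalizing i j
  · exact (this h.symm (((C k).adj_iff.1 h).resolve_left hij)).symm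
  subst hij
  exact skeleton_adj_of_mem (fun he => h.ne (inCycle_inj_same.1 he)) (⟨k, i⟩, false)
    (inCycle_mem_tri_false.2 (.inl rfl)) (inCycle_mem_tri_false.2 (.inr rfl))

theorem adj_inGraph_inGraph (hC : IsBiconnected C) {a b : W} (h : Γ.Adj a b) :
    (skeleton e C).Adj (inGraph e C a) (inGraph e C b) := by
  obtain ⟨⟨⟨k, i, j⟩, hij, hi, hj⟩, -⟩ := (hC.nontrivial_passage a b h).exists_pair_ne
  dsimp only at hij hi hj
  wlog hs : j = i + 1 generalizing i j a b
  · exact (this h.symm j i hij.symm hj hi (((C k).adj_iff.1 hij).resolve_left hs)).symm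
  subst hi hj hs
  exact skeleton_adj_of_mem (fun he => h.ne (inGraph_inj.1 he)) (⟨k, i⟩, true)
    (inGraph_mem_tri_true.2 (.inl rfl)) (inGraph_mem_tri_true.2 (.inr rfl))

theorem adj_of_skeleton_adj_inGraph {a b : W}
    (h : (skeleton e C).Adj (inGraph e C a) (inGraph e C b)) : Γ.Adj a b := by
  obtain ⟨hne, p, hp⟩ := exists_mem_star_of_adj h
  obtain ⟨-, h⟩ := (mem_star_inGraph_inGraph fun h => hne (congrArg _ h)).1 hp
  have hadj := (C p.1.1).toHom.map_adj ((C p.1.1).adj_succ p.1.2)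
  rcases Sym2.eq_iff.1 h with ⟨h1, h2⟩ | ⟨h1, h2⟩
  · rwa [h1, h2] at hadj
  · rw [h1, h2] at hadj
    exact hadj.symm

/-- The inclusion of the graph. -/
def inclusion (hC : IsBiconnected C) (e : W ≃ U) : Γ →g skeleton e C where
  toFun := inGraph e C
  map_rel' := adj_inGraph_inGraph hC

theorem skeleton_connected (hΓ : Γ.Connected) (hC : IsBiconnected C) :
    (skeleton e C).Connected := by
  obtain ⟨a₀⟩ := hΓ.nonempty
  have hg (a : W) : (skeleton e C).Reachable (inGraph e C a) (inGraph e C a₀) :=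
    (hΓ.preconnected a a₀).map (inclusion hC e)
  have hall (x : Vertex e C) : (skeleton e C).Reachable x (inGraph e C a₀) := by
    obtain ⟨a, rfl⟩ | ⟨k, i, rfl⟩ := vertex_cases x
    · exact hg a
    · exact (adj_inCycle_inGraph k i).reachable.trans (hg _)
  exact (SimpleGraph.connected_iff _).2 ⟨fun x y => (hall x).trans (hall y).symm, ⟨inGraph e C a₀⟩⟩

/-- The vertices of the link of `x`. -/
abbrev LinkVertex (x : Vertex e C) : Type :=
  {y // y ≠ x ∧ ∃ t ∈ Set.range (tri e C), x ∈ t ∧ y ∈ t}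

/-- The link of `x`. -/
abbrev link (x : Vertex e C) : SimpleGraph (LinkVertex x) :=
  SimpleGraph.fromRel fun y z => ({x, y.1, z.1} : Set (Vertex e C)) ∈ Set.range (tri e C)

/-- The vertices `y` and `z` lie in the link of `x` and are connected there. -/
def LinkReachable (x y z : Vertex e C) : Prop := ∃ hy hz, (link x).Reachable ⟨y, hy⟩ ⟨z, hz⟩

theorem LinkReachable.symm {x y z : Vertex e C} (h : LinkReachable x y z) : LinkReachable x z y :=
  let ⟨hy, hz, h⟩ := h
  ⟨hz, hy, h.symm⟩

theorem LinkReachable.trans {x y z z' : Vertex e C} (h : LinkReachable x y z)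
    (h' : LinkReachable x z z') : LinkReachable x y z' :=
  let ⟨hy, _, h⟩ := h
  let ⟨_, hz, h'⟩ := h'
  ⟨hy, hz, h.trans h'⟩

theorem linkReachable_of_triangle {x y z : Vertex e C} (p) (h : tri e C p = {x, y, z}) :
    LinkReachable x y z := by
  have hcard := ncard_tri (e := e) p
  have pair (a b : Vertex e C) : ({a, b} : Set (Vertex e C)).ncard ≤ 2 :=
    (Set.ncard_insert_le _ _).trans (by rw [Set.ncard_singleton])
  have h1 : y ≠ x := by
    rintro rfl
    rw [h, Set.insert_eq_of_mem (Set.mem_insert _ _)] at hcard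
    have := pair y z
    omega
  have h2 : z ≠ x := by
    rintro rfl
    rw [h, Set.insert_eq_of_mem (by simp)] at hcard
    have := pair y z
    omega
  have h3 : y ≠ z := by
    rintro rfl
    rw [h, Set.pair_eq_singleton] at hcard
    have := pair x y
    omega
  refine ⟨⟨h1, _, ⟨p, rfl⟩, ?_, ?_⟩, ⟨h2, _, ⟨p, rfl⟩, ?_, ?_⟩, SimpleGraph.Adj.reachable ?_⟩
  · simp [h]
  · simp [h]
  · simp [h]
  · simp [h]
  · exact (SimpleGraph.fromRel_adj _ _ _).2 ⟨fun he => h3 (congrArg Subtype.val he), .inl ⟨p, h⟩⟩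

/-- A cycle runs through the link of a vertex `f i` of the graph along
`f (i - 1)`, `i`, `i + 1`, `f (i + 1)`. -/
theorem linkReachable_inGraph (k : K) (i : Fin (C k).len) :
    LinkReachable (inGraph e C ((C k).toHom i)) (inGraph e C ((C k).toHom (i - 1)))
      (inCycle e C k i) ∧
    LinkReachable (inGraph e C ((C k).toHom i)) (inCycle e C k i) (inCycle e C k (i + 1)) ∧
    LinkReachable (inGraph e C ((C k).toHom i)) (inCycle e C k (i + 1))
      (inGraph e C ((C k).toHom (i + 1))) := by
  refine ⟨linkReachable_of_triangle (⟨k, i - 1⟩, true) ?_,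
    linkReachable_of_triangle (⟨k, i⟩, false) ?_, linkReachable_of_triangle (⟨k, i⟩, true) ?_⟩
  · rw [tri, sub_add_cancel, Set.insert_comm, Set.pair_comm, Set.insert_comm, Set.pair_comm]
  · rw [tri, Set.pair_comm, Set.insert_comm]
  · rw [tri, Set.insert_comm]

/-- The link of a vertex `i` of a cycle is the path `i - 1`, `f (i - 1)`, `f i`, `i + 1`. -/
theorem linkReachable_inCycle (k : K) (i : Fin (C k).len) :
    LinkReachable (inCycle e C k i) (inCycle e C k (i + 1)) (inGraph e C ((C k).toHom i)) ∧
    LinkReachable (inCycle e C k i) (inGraph e C ((C k).toHom (i - 1)))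
      (inGraph e C ((C k).toHom i)) ∧
    LinkReachable (inCycle e C k i) (inCycle e C k (i - 1))
      (inGraph e C ((C k).toHom (i - 1))) := by
  refine ⟨linkReachable_of_triangle (⟨k, i⟩, false) rfl,
    linkReachable_of_triangle (⟨k, i - 1⟩, true) ?_,
    linkReachable_of_triangle (⟨k, i - 1⟩, false) ?_⟩
  · rw [tri, sub_add_cancel]
  · rw [tri, sub_add_cancel, Set.insert_comm]

theorem connected_of_linkReachable {x z : Vertex e C}
    (hz : z ≠ x ∧ ∃ t ∈ Set.range (tri e C), x ∈ t ∧ z ∈ t)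
    (h : ∀ y, y ≠ x → ∀ p, x ∈ tri e C p → y ∈ tri e C p → LinkReachable x y z) :
    (link x).Connected := by
  have hall (y : LinkVertex x) : (link x).Reachable y ⟨z, hz⟩ := by
    obtain ⟨y, hy, _, ⟨p, rfl⟩, hx, hyp⟩ := y
    obtain ⟨_, _, h⟩ := h y hy p hx hyp
    exact h
  exact (SimpleGraph.connected_iff _).2 ⟨fun a b => (hall a).trans (hall b).symm, ⟨⟨z, hz⟩⟩⟩

theorem link_inCycle_connected (k : K) (i : Fin (C k).len) : (link (inCycle e C k i)).Connected := by
  obtain ⟨h1, h2, h3⟩ := linkReachable_inCycle (e := e) k i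
  refine connected_of_linkReachable (z := inGraph e C ((C k).toHom i)) (h1.2.1) fun y hy p hx hyp => ?_
  obtain ⟨⟨l, m⟩, _ | _⟩ := p
  · rcases inCycle_mem_tri_false.1 hx with h | h
    · obtain rfl : k = l := congrArg Sigma.fst h
      obtain rfl := sigma_mk_injective h
      rcases hyp with rfl | rfl | rfl
      · exact (hy rfl).elim
      · exact h1
      · exact ⟨h2.2.1, h2.2.1, .rfl⟩
    · obtain rfl : k = l := congrArg Sigma.fst h
      obtain rfl := sigma_mk_injective h
      rw [add_sub_cancel_right] at h2 h3
      rcases hyp with rfl | rfl | rfl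
      · exact h3.trans h2
      · exact (hy rfl).elim
      · exact h2
  · have h := inCycle_mem_tri_true.1 hx
    obtain rfl : k = l := congrArg Sigma.fst h
    obtain rfl := sigma_mk_injective h
    rw [add_sub_cancel_right] at h2 h3
    rcases hyp with rfl | rfl | rfl
    · exact (hy rfl).elim
    · exact h2
    · exact ⟨h2.2.1, h2.2.1, .rfl⟩

/-- The link of a vertex of the graph is a subdivision of its Whitehead graph. -/
theorem link_inGraph_connected (hC : IsBiconnected C) (a : W) :
    (link (inGraph e C a)).Connected := by
  have mem {b : W} (h : Γ.Adj a b) : inGraph e C b ≠ inGraph e C a ∧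
      ∃ t ∈ Set.range (tri e C), inGraph e C a ∈ t ∧ inGraph e C b ∈ t := by
    obtain ⟨hne, p, hp⟩ := exists_mem_star_of_adj (adj_inGraph_inGraph (e := e) hC h)
    exact ⟨hne.symm, _, ⟨p, rfl⟩, hp⟩
  have refl {b : W} (h : Γ.Adj a b) : LinkReachable (inGraph e C a) (inGraph e C b) (inGraph e C b) :=
    ⟨mem h, mem h, .rfl⟩
  -- All vertices of a cycle in the link of `a`, and all its neighbours there, are connected.
  have nbr (k : K) (i : Fin (C k).len) (hi : (C k).toHom i = a) (j : Fin (C k).len)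
      (hij : (SimpleGraph.cycleGraph (C k).len).Adj i j) :
      LinkReachable (inGraph e C a) (inGraph e C ((C k).toHom j)) (inCycle e C k i) := by
    subst hi
    obtain ⟨h1, h2, h3⟩ := linkReachable_inGraph (e := e) k i
    rcases (C k).adj_iff.1 hij with rfl | rfl
    · exact (h2.trans h3).symm
    · rwa [add_sub_cancel_right] at h1
  obtain ⟨b₀, hb₀⟩ := hC.exists_adj a
  have graph {b : W} (h : Γ.Adj a b) :
      LinkReachable (inGraph e C a) (inGraph e C b) (inGraph e C b₀) := by
    refine hC.connected a (fun b => LinkReachable (inGraph e C a) (inGraph e C b) (inGraph e C b₀))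
      ?_ b₀ b hb₀ h (refl hb₀)
    intro k i j j' hi hij hij' hj
    exact ((nbr k i hi j' hij').trans (nbr k i hi j hij).symm).trans hj
  have cyc (k : K) (i : Fin (C k).len) (hi : (C k).toHom i = a) :
      LinkReachable (inGraph e C a) (inCycle e C k i) (inGraph e C b₀) ∧
      LinkReachable (inGraph e C a) (inCycle e C k (i + 1)) (inGraph e C b₀) := by
    have h1 := (nbr k i hi _ ((C k).adj_succ i)).symm.trans
      (graph (hi ▸ (C k).toHom.map_adj ((C k).adj_succ i)))
    have h2 := (linkReachable_inGraph (e := e) k i).2.1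
    rw [hi] at h2
    exact ⟨h1, h2.symm.trans h1⟩
  refine connected_of_linkReachable (mem hb₀) fun y hy p hx hyp => ?_
  obtain ⟨⟨k, i⟩, _ | _⟩ := p
  · have hi := inGraph_mem_tri_false.1 hx
    rcases hyp with rfl | rfl | rfl
    · exact (cyc k i hi.symm).1
    · exact (cyc k i hi.symm).2
    · exact (hy (hi ▸ rfl)).elim
  · rcases inGraph_mem_tri_true.1 hx with hi | hi
    · rcases hyp with rfl | rfl | rfl
      · exact (cyc k i hi.symm).2
      · exact (hy (hi ▸ rfl)).elim
      · exact graph (hi ▸ (C k).toHom.map_adj ((C k).adj_succ i))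
    · rcases hyp with rfl | rfl | rfl
      · exact (cyc k (i + 1) hi.symm).1
      · exact graph (hi ▸ (C k).toHom.map_adj ((C k).adj_succ i).symm)
      · exact (hy (hi ▸ rfl)).elim

/-- The mapping cylinder of a biconnected family of cycles in which every edge is passed twice is a
surface. -/
def surface [Finite W] [Finite K] (e : W ≃ U) (hΓ : Γ.Connected) (hC : IsBiconnected C)
    (hcard : ∀ a b, Γ.Adj a b → Nat.card (Passage C a b) = 2) : TriangulatedSurface where
  V := Vertex e C
  finite :=
    have := Finite.of_equiv _ e
    inferInstance
  triangles := Set.range (tri e C)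
  card_triangle := by
    rintro _ ⟨p, rfl⟩
    exact ncard_tri p
  connected := skeleton_connected hΓ hC
  edge_le_two a b hab := (ncard_triangles a b).trans_le (ncard_star_le_two hcard hab)
  link_connected a := by
    obtain ⟨a, rfl⟩ | ⟨k, i, rfl⟩ := vertex_cases a
    · exact link_inGraph_connected hC a
    · exact link_inCycle_connected k i

end MappingCylinder

/-! ### Simplicial maps and homotopy -/

namespace EdgePath

variable {V : Type*} {G : SimpleGraph V} {T : Set (Set V)}

theorem walk_eq_of_length_le_one {a b : V} {p q : G.Walk a b} (hp : p.length ≤ 1) (hq : q.length ≤ 1) :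
    p = q := by
  refine SimpleGraph.Walk.ext_support ?_
  match p, q with
  | .nil, .nil => rfl
  | .nil, .cons h .nil => exact (h.ne rfl).elim
  | .cons h .nil, .nil => exact (h.ne rfl).elim
  | .cons _ .nil, .cons _ .nil => rfl
  | .cons _ (.cons _ _), _ => simp at hp
  | _, .cons _ (.cons _ _) => simp at hq

theorem homotopic_append_of_length_le_one {a b c : V} {p : G.Walk a b} {q : G.Walk b c}
    {r : G.Walk a c} (hp : p.length ≤ 1) (hq : q.length ≤ 1) (hr : r.length ≤ 1)
    (h : a = b ∨ b = c ∨ a = c) : Homotopic G T (p.append q) r := by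
  rcases h with rfl | rfl | rfl
  · obtain rfl := walk_eq_of_length_le_one hp (q := .nil) (by simp)
    obtain rfl := walk_eq_of_length_le_one hq hr
    exact .refl _
  · obtain rfl := walk_eq_of_length_le_one hq (q := .nil) (by simp)
    obtain rfl := walk_eq_of_length_le_one hp hr
    rw [SimpleGraph.Walk.append_nil]
    exact .refl _
  · obtain rfl := walk_eq_of_length_le_one hr (q := .nil) (by simp)
    obtain rfl := walk_eq_of_length_le_one hq (q := p.reverse) (by simpa using hp)
    exact .append_reverse_self p

section Collapse

variable {W : Type*} {Γ : SimpleGraph W} (r : V → W)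
  (hr : ∀ a b, G.Adj a b → r a = r b ∨ Γ.Adj (r a) (r b))

open Classical in
/-- The image of an edge under a simplicial map `r` that may collapse edges. -/
noncomputable def collapseEdge {a b : V} (h : G.Adj a b) : Γ.Walk (r a) (r b) :=
  if h' : Γ.Adj (r a) (r b) then h'.toWalk
  else SimpleGraph.Walk.nil.copy rfl ((hr a b h).resolve_right h')

theorem length_collapseEdge_le {a b : V} (h : G.Adj a b) : (collapseEdge r hr h).length ≤ 1 := by
  unfold collapseEdge
  split_ifs with h'
  · exact le_rfl
  · simp

/-- The image of a walk under a simplicial map that may collapse edges. -/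
noncomputable def collapse : ∀ {a b : V}, G.Walk a b → Γ.Walk (r a) (r b)
  | _, _, .nil => .nil
  | _, _, .cons h p => (collapseEdge r hr h).append (collapse p)

variable {r}

theorem collapse_homotopic
    (hT : ∀ a b c, {a, b, c} ∈ T → r a = r b ∨ r b = r c ∨ r a = r c) {a b : V} {p q : G.Walk a b}
    (h : Homotopic G T p q) : Homotopic Γ ∅ (collapse r hr p) (collapse r hr q) := by
  induction h with
  | refl => exact .refl _
  | symm _ ih => exact ih.symm
  | trans _ _ ih₁ ih₂ => exact ih₁.trans ih₂
  | cons h _ ih => exact .append_left _ ih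
  | backtrack h p =>
    rw [collapse, collapse, SimpleGraph.Walk.append_assoc]
    exact (homotopic_append_of_length_le_one (length_collapseEdge_le r hr _)
      (length_collapseEdge_le r hr _) (r := .nil) (by simp) (.inr (.inr rfl))).append_right _
  | triangle hab hbc hac ht p =>
    rw [collapse, collapse, collapse, SimpleGraph.Walk.append_assoc]
    exact (homotopic_append_of_length_le_one (length_collapseEdge_le r hr _)
      (length_collapseEdge_le r hr _) (length_collapseEdge_le r hr _) (hT _ _ _ ht)).append_right _

theorem support_collapse_map (j : Γ →g G) (hj : ∀ a, r (j a) = a) {a b : W} (p : Γ.Walk a b) :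
    (collapse r hr (p.map j)).support = p.support := by
  induction p with
  | nil => simp [collapse, hj]
  | @cons a b c h p ih =>
    have h' : Γ.Adj (r (j a)) (r (j b)) := by rwa [hj, hj]
    rw [SimpleGraph.Walk.map_cons, collapse, collapseEdge, dif_pos h', SimpleGraph.Walk.support_append,
      ih, SimpleGraph.Walk.support_cons]
    rw [← SimpleGraph.Walk.cons_tail_support p]
    simp [hj]

theorem homotopic_of_support_eq {a b a' b' : V} {p q : G.Walk a b} {p' q' : G.Walk a' b'}
    (ha : a' = a) (hb : b' = b) (hp : p'.support = p.support) (hq : q'.support = q.support)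
    (h : Homotopic G T p' q') : Homotopic G T p q := by
  subst ha hb
  rwa [SimpleGraph.Walk.ext_support hp, SimpleGraph.Walk.ext_support hq] at h

/-- The inclusion `j` of a graph that has a simplicial retraction `r` is injective on homotopy
classes. -/
theorem homotopic_of_map (hr : ∀ a b, G.Adj a b → r a = r b ∨ Γ.Adj (r a) (r b))
    (hT : ∀ a b c, {a, b, c} ∈ T → r a = r b ∨ r b = r c ∨ r a = r c) (j : Γ →g G)
    (hj : ∀ a, r (j a) = a) {a b : W} {p q : Γ.Walk a b} (h : Homotopic G T (p.map j) (q.map j)) :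
    Homotopic Γ ∅ p q :=
  homotopic_of_support_eq (hj a) (hj b) (support_collapse_map hr j hj p)
    (support_collapse_map hr j hj q) (collapse_homotopic hr hT h)

end Collapse

end EdgePath

/-! ### The fundamental group and the boundary of the mapping cylinder -/

namespace MappingCylinder

open EdgePath ImmersedCycle

variable {W : Type w} {Γ : SimpleGraph W} {U K : Type} {e : W ≃ U} {C : K → ImmersedCycle Γ}

variable (e C) in
/-- The retraction of the mapping cylinder onto the graph. -/
def retraction : Vertex e C → W
  | .inl u => e.symm u
  | .inr ⟨k, i⟩ => (C k).toHom i

theorem retraction_inGraph (a : W) : retraction e C (inGraph e C a) = a := e.symm_apply_apply a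

theorem retraction_inCycle (k : K) (i : Fin (C k).len) :
    retraction e C (inCycle e C k i) = (C k).toHom i := rfl

theorem retraction_mem_tri {x : Vertex e C} {k : K} {i : Fin (C k).len} {b : Bool}
    (hx : x ∈ tri e C (⟨k, i⟩, b)) :
    retraction e C x = (C k).toHom i ∨ retraction e C x = (C k).toHom (i + 1) := by
  cases b
  · rcases hx with rfl | rfl | rfl
    · exact .inl rfl
    · exact .inr rfl
    · exact .inl (retraction_inGraph _)
  · rcases hx with rfl | rfl | rfl
    · exact .inr rfl
    · exact .inl (retraction_inGraph _)
    · exact .inr (retraction_inGraph _)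

theorem retraction_adj {x y : Vertex e C} (h : (skeleton e C).Adj x y) :
    retraction e C x = retraction e C y ∨ Γ.Adj (retraction e C x) (retraction e C y) := by
  obtain ⟨-, ⟨⟨k, i⟩, b⟩, hx, hy⟩ := exists_mem_star_of_adj h
  have hadj := (C k).toHom.map_adj ((C k).adj_succ i)
  rcases retraction_mem_tri hx with h1 | h1 <;> rcases retraction_mem_tri hy with h2 | h2 <;>
    rw [h1, h2]
  · exact .inl rfl
  · exact .inr hadj
  · exact .inr hadj.symm
  · exact .inl rfl

theorem retraction_triangle (x y z : Vertex e C) (h : {x, y, z} ∈ Set.range (tri e C)) :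
    retraction e C x = retraction e C y ∨ retraction e C y = retraction e C z ∨
      retraction e C x = retraction e C z := by
  obtain ⟨⟨⟨k, i⟩, b⟩, h⟩ := h
  have hx := retraction_mem_tri (show x ∈ tri e C (⟨k, i⟩, b) by simp [h])
  have hy := retraction_mem_tri (show y ∈ tri e C (⟨k, i⟩, b) by simp [h])
  have hz := retraction_mem_tri (show z ∈ tri e C (⟨k, i⟩, b) by simp [h])
  grind

variable (e C) in
/-- Homotopy classes of paths in the mapping cylinder. -/
abbrev CylCls (x y : Vertex e C) : Type := Cls (skeleton e C) (Set.range (tri e C)) x y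

variable (e C) in
/-- The edge from a vertex of a cycle to its image in the graph. -/
def spoke (k : K) (i : Fin (C k).len) : CylCls e C (inCycle e C k i) (inGraph e C ((C k).toHom i)) :=
  Cls.mk (adj_inCycle_inGraph k i).toWalk

/-- The two triangles of a square make its two paths homotopic. -/
theorem spoke_comp (hC : IsBiconnected C) {k : K} {i j : Fin (C k).len}
    (h : (SimpleGraph.cycleGraph (C k).len).Adj i j) :
    spoke e C k i ⬝ Cls.mk (adj_inGraph_inGraph hC ((C k).toHom.map_adj h)).toWalk =
      Cls.mk (adj_inCycle_inCycle h).toWalk ⬝ spoke e C k j := by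
  wlog hij : j = i + 1 generalizing i j
  · have := this h.symm (((C k).adj_iff.1 h).resolve_left hij)
    have h1 : (Cls.mk (adj_inGraph_inGraph hC ((C k).toHom.map_adj h)).toWalk : CylCls e C _ _) =
      (Cls.mk (adj_inGraph_inGraph hC ((C k).toHom.map_adj h.symm)).toWalk).inv := rfl
    have h2 : (Cls.mk (adj_inCycle_inCycle h).toWalk : CylCls e C _ _) =
      (Cls.mk (adj_inCycle_inCycle h.symm).toWalk).inv := rfl
    rw [h1, h2]
    have h3 := congrArg (fun z => (Cls.mk (adj_inCycle_inCycle h.symm).toWalk).inv ⬝ z ⬝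
      (Cls.mk (adj_inGraph_inGraph hC ((C k).toHom.map_adj h.symm)).toWalk).inv) this.symm
    simpa only [Cls.comp_assoc, Cls.inv_comp_assoc, Cls.comp_inv, Cls.comp_nil] using h3
  subst hij
  have hd := adj_inCycle_succ_inGraph (e := e) k i
  have m1 : ({inCycle e C k i, inCycle e C k (i + 1), inGraph e C ((C k).toHom i)} :
      Set (Vertex e C)) ∈ Set.range (tri e C) := ⟨(⟨k, i⟩, false), rfl⟩
  have m2 : ({inCycle e C k (i + 1), inGraph e C ((C k).toHom i),
      inGraph e C ((C k).toHom (i + 1))} : Set (Vertex e C)) ∈ Set.range (tri e C) :=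
    ⟨(⟨k, i⟩, true), rfl⟩
  have t1 : (spoke e C k i : CylCls e C _ _) =
      Cls.mk (adj_inCycle_inCycle h).toWalk ⬝ Cls.mk hd.toWalk :=
    (Cls.mk_eq_mk.2 (.triangle (adj_inCycle_inCycle h) hd (adj_inCycle_inGraph k i)
      m1 .nil)).symm
  have t2 : Cls.mk hd.toWalk ⬝ Cls.mk (adj_inGraph_inGraph hC ((C k).toHom.map_adj h)).toWalk =
      spoke e C k (i + 1) :=
    Cls.mk_eq_mk.2 (.triangle hd (adj_inGraph_inGraph hC ((C k).toHom.map_adj h))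
      (adj_inCycle_inGraph k (i + 1)) m2 .nil)
  rw [t1, Cls.comp_assoc, t2]

/-- The class of a path in the graph. -/
def graphCls (hC : IsBiconnected C) (e : W ≃ U) {a b : W} (p : Γ.Walk a b) :
    CylCls e C (inGraph e C a) (inGraph e C b) :=
  Cls.mk (p.map (inclusion hC e))

theorem graphCls_append (hC : IsBiconnected C) {a b c : W} (p : Γ.Walk a b) (q : Γ.Walk b c) :
    graphCls hC e (p.append q) = graphCls hC e p ⬝ graphCls hC e q :=
  congrArg Cls.mk (SimpleGraph.Walk.map_append _ p q)

theorem graphCls_reverse (hC : IsBiconnected C) {a b : W} (p : Γ.Walk a b) :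
    graphCls hC e p.reverse = (graphCls hC e p).inv :=
  congrArg Cls.mk (SimpleGraph.Walk.reverse_map _ p).symm

/-- The embedding of a cycle in the mapping cylinder. -/
def cycleInclusion (e : W ≃ U) (C : K → ImmersedCycle Γ) (k : K) :
    SimpleGraph.cycleGraph (C k).len →g skeleton e C where
  toFun := inCycle e C k
  map_rel' := adj_inCycle_inCycle

/-- The class of a path in a cycle. -/
def cycleCls (e : W ≃ U) {k : K} {i j : Fin (C k).len}
    (ξ : (SimpleGraph.cycleGraph (C k).len).Walk i j) :
    CylCls e C (inCycle e C k i) (inCycle e C k j) :=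
  Cls.mk (ξ.map (cycleInclusion e C k))

/-- A path in a cycle is homotopic to its image in the graph, along the spokes. -/
theorem spoke_comp_map (hC : IsBiconnected C) {k : K} {i j : Fin (C k).len}
    (ξ : (SimpleGraph.cycleGraph (C k).len).Walk i j) :
    spoke e C k i ⬝ graphCls hC e (ξ.map (C k).toHom) = cycleCls e ξ ⬝ spoke e C k j := by
  induction ξ with
  | nil => exact (Cls.comp_nil _).trans (Cls.nil_comp _).symm
  | @cons i j l h ξ ih =>
    have h1 : graphCls hC e ((SimpleGraph.Walk.cons h ξ).map (C k).toHom) =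
      Cls.mk (adj_inGraph_inGraph hC ((C k).toHom.map_adj h)).toWalk ⬝
        graphCls hC e (ξ.map (C k).toHom) := rfl
    have h2 : cycleCls e (SimpleGraph.Walk.cons h ξ) =
      Cls.mk (adj_inCycle_inCycle h).toWalk ⬝ cycleCls e ξ := rfl
    rw [h1, h2, ← Cls.comp_assoc, spoke_comp hC h, Cls.comp_assoc, ih, Cls.comp_assoc]

/-- `δ` is the path along which the retraction moves the vertex `x` to the vertex `a` of the graph. -/
def IsRetractionPath (x : Vertex e C) (a : W) (δ : CylCls e C x (inGraph e C a)) : Prop :=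
  retraction e C x = a ∧ ∃ p, p.length ≤ 1 ∧ Cls.mk p = δ

theorem isRetractionPath_inGraph (a : W) :
    IsRetractionPath (e := e) (C := C) (inGraph e C a) a (Cls.mk .nil) :=
  ⟨retraction_inGraph a, .nil, by simp, rfl⟩

theorem isRetractionPath_spoke (k : K) (i : Fin (C k).len) :
    IsRetractionPath (inCycle e C k i) ((C k).toHom i) (spoke e C k i) :=
  ⟨rfl, _, le_rfl, rfl⟩

theorem IsRetractionPath.of_inGraph {a b : W} {δ : CylCls e C (inGraph e C a) (inGraph e C b)}
    (h : IsRetractionPath (inGraph e C a) b δ) : ∃ he : a = b, δ = he ▸ Cls.mk .nil := by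
  obtain ⟨h1, p, hp, rfl⟩ := h
  obtain rfl := (retraction_inGraph a).symm.trans h1
  exact ⟨rfl, congrArg Cls.mk (walk_eq_of_length_le_one hp (by simp))⟩

theorem IsRetractionPath.of_inCycle {k : K} {i : Fin (C k).len} {b : W}
    {δ : CylCls e C (inCycle e C k i) (inGraph e C b)}
    (h : IsRetractionPath (inCycle e C k i) b δ) : ∃ he : (C k).toHom i = b, δ = he ▸ spoke e C k i := by
  obtain ⟨h1, p, hp, rfl⟩ := h
  obtain rfl := (retraction_inCycle k i).symm.trans h1
  exact ⟨rfl, congrArg Cls.mk (walk_eq_of_length_le_one hp le_rfl)⟩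

theorem exists_isRetractionPath (x : Vertex e C) : ∃ a δ, IsRetractionPath x a δ := by
  obtain ⟨a, rfl⟩ | ⟨k, i, rfl⟩ := vertex_cases x
  · exact ⟨_, _, isRetractionPath_inGraph a⟩
  · exact ⟨_, _, isRetractionPath_spoke k i⟩

/-- Every edge of the mapping cylinder is homotopic to a path in the graph, along retraction paths. -/
theorem exists_comp_eq_of_adj (hC : IsBiconnected C) {x y : Vertex e C} (h : (skeleton e C).Adj x y)
    {a b : W} {δ : CylCls e C x (inGraph e C a)} {δ' : CylCls e C y (inGraph e C b)}
    (hδ : IsRetractionPath x a δ) (hδ' : IsRetractionPath y b δ') :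
    ∃ p : Γ.Walk a b, δ ⬝ graphCls hC e p = Cls.mk h.toWalk ⬝ δ' := by
  have mixed {c : W} {k : K} {i : Fin (C k).len}
      (h : (skeleton e C).Adj (inGraph e C c) (inCycle e C k i)) :
      ∃ p : Γ.Walk c ((C k).toHom i), graphCls hC e p =
        Cls.mk h.toWalk ⬝ spoke e C k i := by
    obtain ⟨-, q, hq⟩ := exists_mem_star_of_adj h
    rcases star_inGraph_inCycle (e := e) c k i with he | ⟨rfl, -⟩ | ⟨rfl, -⟩
    · rw [he] at hq
      exact hq.elim
    · exact ⟨.nil, (Cls.mk_eq_mk.2 (.backtrack h .nil)).symm⟩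
    · have hadj := ((C k).toHom.map_adj ((C k).adj_pred i)).symm
      have hm : ({inGraph e C ((C k).toHom (i - 1)), inCycle e C k i,
          inGraph e C ((C k).toHom i)} : Set (Vertex e C)) ∈ Set.range (tri e C) := by
        refine ⟨(⟨k, i - 1⟩, true), ?_⟩
        rw [tri, sub_add_cancel, Set.insert_comm]
      refine ⟨hadj.toWalk, (Cls.mk_eq_mk.2 (.triangle h (adj_inCycle_inGraph k i)
        (adj_inGraph_inGraph hC hadj) hm .nil)).symm⟩
  obtain ⟨c, rfl⟩ | ⟨k, i, rfl⟩ := vertex_cases x <;>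
    obtain ⟨d, rfl⟩ | ⟨k', j, rfl⟩ := vertex_cases y
  · obtain ⟨rfl, rfl⟩ := hδ.of_inGraph
    obtain ⟨rfl, rfl⟩ := hδ'.of_inGraph
    refine ⟨(adj_of_skeleton_adj_inGraph h).toWalk, ?_⟩
    exact (Cls.nil_comp _).trans (Cls.comp_nil _).symm
  · obtain ⟨rfl, rfl⟩ := hδ.of_inGraph
    obtain ⟨rfl, rfl⟩ := hδ'.of_inCycle
    obtain ⟨p, hp⟩ := mixed h
    exact ⟨p, (Cls.nil_comp _).trans hp⟩
  · obtain ⟨rfl, rfl⟩ := hδ.of_inCycle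
    obtain ⟨rfl, rfl⟩ := hδ'.of_inGraph
    obtain ⟨p, hp⟩ := mixed h.symm
    refine ⟨p.reverse, ?_⟩
    change spoke e C k i ⬝ _ = _ ⬝ Cls.mk .nil
    rw [graphCls_reverse, hp, Cls.inv_comp_rev, Cls.comp_inv_assoc]
    exact (Cls.comp_nil _).symm
  · obtain ⟨rfl, rfl⟩ := hδ.of_inCycle
    obtain ⟨rfl, rfl⟩ := hδ'.of_inCycle
    obtain ⟨hne, q, hq⟩ := exists_mem_star_of_adj h
    obtain ⟨j', hj, hij⟩ := adj_of_mem_star_inCycle hne hq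
    obtain rfl : k' = k := congrArg Sigma.fst hj
    obtain rfl := eq_of_heq (Sigma.mk.inj_iff.1 hj).2
    exact ⟨((C k').toHom.map_adj hij).toWalk, spoke_comp hC hij⟩

/-- Every path in the mapping cylinder is homotopic to a path in the graph, along retraction paths. -/
theorem exists_comp_eq (hC : IsBiconnected C) {x y : Vertex e C} (z : CylCls e C x y)
    {a b : W} {δ : CylCls e C x (inGraph e C a)} {δ' : CylCls e C y (inGraph e C b)}
    (hδ : IsRetractionPath x a δ) (hδ' : IsRetractionPath y b δ') :
    ∃ p : Γ.Walk a b, δ ⬝ graphCls hC e p = z ⬝ δ' := by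
  induction z using Cls.ind with | h q =>
  induction q generalizing a with
  | @nil x =>
    have : ∃ he : a = b, δ' = he ▸ δ := by
      obtain ⟨c, rfl⟩ | ⟨k, i, rfl⟩ := vertex_cases x
      · obtain ⟨rfl, rfl⟩ := hδ.of_inGraph
        obtain ⟨rfl, rfl⟩ := hδ'.of_inGraph
        exact ⟨rfl, rfl⟩
      · obtain ⟨rfl, rfl⟩ := hδ.of_inCycle
        obtain ⟨rfl, rfl⟩ := hδ'.of_inCycle
        exact ⟨rfl, rfl⟩
    obtain ⟨rfl, rfl⟩ := this
    exact ⟨.nil, (Cls.comp_nil _).trans (Cls.nil_comp _).symm⟩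
  | @cons x x' y h q ih =>
    obtain ⟨c, δ'', h''⟩ := exists_isRetractionPath x'
    obtain ⟨p, hp⟩ := ih h'' hδ'
    obtain ⟨p', hp'⟩ := exists_comp_eq_of_adj hC h hδ h''
    refine ⟨p'.append p, ?_⟩
    rw [graphCls_append, ← Cls.comp_assoc, hp', Cls.comp_assoc, hp, ← Cls.comp_assoc]
    rfl

section Surface

variable [Finite W] [Finite K] (hΓ : Γ.Connected) (hC : IsBiconnected C)
  (hcard : ∀ a b, Γ.Adj a b → Nat.card (Passage C a b) = 2)

theorem surface_boundary_adj {x y : Vertex e C} : (surface e hΓ hC hcard).boundary.Adj x y ↔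
    ∃ k i j, (SimpleGraph.cycleGraph (C k).len).Adj i j ∧ x = inCycle e C k i ∧
      y = inCycle e C k j := by
  have : x ≠ y ∧ {t ∈ Set.range (tri e C) | x ∈ t ∧ y ∈ t}.ncard = 1 ↔
      x ≠ y ∧ (star x y).ncard = 1 := by
    rw [ncard_triangles x y]
  refine ((TriangulatedSurface.boundary_adj (S := surface e hΓ hC hcard)).trans this).trans ?_
  constructor
  · rintro ⟨hne, h⟩
    rcases ncard_star_cases hcard hne with ⟨-, h'⟩ | h' | h'
    · exact h'
    · omega
    · omega
  · rintro ⟨k, i, j, hij, rfl, rfl⟩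
    exact ⟨fun he => hij.ne (inCycle_inj_same.1 he), star_inCycle_inCycle_of_adj hij⟩

/-- The cycles are the boundary circles of the mapping cylinder. -/
def cycleBoundary (k : K) : SimpleGraph.cycleGraph (C k).len →g (surface e hΓ hC hcard).boundary where
  toFun := inCycle e C k
  map_rel' h := (surface_boundary_adj hΓ hC hcard).2 ⟨k, _, _, h, rfl, rfl⟩

theorem exists_walk_of_boundary_walk {x y : Vertex e C}
    (ζ : (surface e hΓ hC hcard).boundary.Walk x y) {k : K} {i : Fin (C k).len}
    (hx : x = inCycle e C k i) : ∃ (j : Fin (C k).len) (_ : y = inCycle e C k j)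
      (ξ : (SimpleGraph.cycleGraph (C k).len).Walk i j),
        (ξ.map (cycleBoundary (e := e) hΓ hC hcard k)).support = ζ.support := by
  induction ζ generalizing i with
  | nil => exact ⟨i, hx, .nil, by rw [hx]; rfl⟩
  | cons h ζ ih =>
    obtain ⟨k', i', j', hij, h1, h2⟩ := (surface_boundary_adj hΓ hC hcard).1 h
    have h3 := inCycle_inj.1 (h1.symm.trans hx)
    obtain rfl : k' = k := congrArg Sigma.fst h3
    obtain rfl : i' = i := eq_of_heq (Sigma.mk.inj_iff.1 h3).2
    obtain ⟨j, hj, ξ, hξ⟩ := ih h2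
    refine ⟨j, hj, .cons hij ξ, ?_⟩
    exact congrArg₂ List.cons h1.symm hξ

/-- The closed boundary paths at a vertex of a cycle are those of the cycle. -/
theorem exists_map_eq_of_boundary_walk {k : K} {i : Fin (C k).len}
    (ζ : (surface e hΓ hC hcard).boundary.Walk (inCycle e C k i) (inCycle e C k i)) :
    ∃ ξ : (SimpleGraph.cycleGraph (C k).len).Walk i i,
      ζ = ξ.map (cycleBoundary (e := e) hΓ hC hcard k) := by
  obtain ⟨j, hj, ξ, hξ⟩ := exists_walk_of_boundary_walk hΓ hC hcard ζ rfl
  obtain rfl := inCycle_inj_same.1 hj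
  exact ⟨ξ, (SimpleGraph.Walk.ext_support hξ).symm⟩

/-- The boundary circle that is the cycle `k`. -/
def boundaryComponent (k : K) : (surface e hΓ hC hcard).BoundaryComponent :=
  ⟨(surface e hΓ hC hcard).boundary.connectedComponentMk (inCycle e C k 0), inCycle e C k 0,
    ⟨inCycle e C k 1, (surface_boundary_adj hΓ hC hcard).2
      ⟨k, 0, 1, by simpa using (C k).adj_succ 0, rfl, rfl⟩⟩, rfl⟩

theorem connectedComponentMk_inCycle (k : K) (i : Fin (C k).len) :
    (surface e hΓ hC hcard).boundary.connectedComponentMk (inCycle e C k i) =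
      (boundaryComponent (e := e) hΓ hC hcard k).1 :=
  SimpleGraph.ConnectedComponent.sound
    ((SimpleGraph.cycleGraph_preconnected i 0).map (cycleBoundary (e := e) hΓ hC hcard k))

theorem exists_eq_inCycle {k : K} {x : Vertex e C}
    (hx : (surface e hΓ hC hcard).boundary.connectedComponentMk x =
      (boundaryComponent (e := e) hΓ hC hcard k).1) : ∃ i, x = inCycle e C k i := by
  obtain ⟨ζ⟩ := SimpleGraph.ConnectedComponent.exact hx.symm
  obtain ⟨j, hj, -⟩ := exists_walk_of_boundary_walk hΓ hC hcard ζ rfl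
  exact ⟨j, hj⟩

theorem boundaryComponent_bijective :
    Function.Bijective (boundaryComponent (e := e) hΓ hC hcard) := by
  constructor
  · intro k k' h
    obtain ⟨i, hi⟩ := exists_eq_inCycle (e := e) hΓ hC hcard (k := k') (x := inCycle e C k 0)
      (congrArg Subtype.val h)
    exact congrArg Sigma.fst (inCycle_inj.1 hi)
  · rintro ⟨c, x, ⟨y, hxy⟩, rfl⟩
    obtain ⟨k, i, j, -, rfl, -⟩ := (surface_boundary_adj hΓ hC hcard).1 hxy
    exact ⟨k, Subtype.ext (connectedComponentMk_inCycle hΓ hC hcard k i).symm⟩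

end Surface

/-- The inclusion of the graph induces an isomorphism of fundamental groups. -/
theorem exists_mulEquiv (hC : IsBiconnected C) (e : W ≃ U) (x : W) :
    ∃ φ : Γ.Pi1 x ≃* EdgePath.Pi1 (skeleton e C) (Set.range (tri e C)) (inGraph e C x),
      ∀ p : Γ.Walk x x, φ (Pi1.mk p) = graphCls hC e p := by
  let f : Γ.Pi1 x →* EdgePath.Pi1 (skeleton e C) (Set.range (tri e C)) (inGraph e C x) :=
    { toFun := Quotient.map (fun p => p.map (inclusion hC e)) fun _ _ h => h.map _ fun _ h => h.elim
      map_one' := rfl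
      map_mul' := by
        rintro ⟨p⟩ ⟨q⟩
        exact graphCls_append hC p q }
  have hf : Function.Bijective f := by
    constructor
    · rintro ⟨p⟩ ⟨q⟩ h
      exact Quotient.sound (homotopic_of_map (fun _ _ => retraction_adj) retraction_triangle
        (inclusion hC e) retraction_inGraph (Quotient.exact h))
    · intro z
      obtain ⟨p, hp⟩ := exists_comp_eq hC (e := e) z (isRetractionPath_inGraph x)
        (isRetractionPath_inGraph x)
      exact ⟨Pi1.mk p, (Cls.nil_comp _).symm.trans (hp.trans (Cls.comp_nil _))⟩
  exact ⟨MulEquiv.ofBijective f hf, fun p => rfl⟩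

theorem isSurfaceWithPeripheral_of_bijection [Finite W] [Finite K] (hΓ : Γ.Connected)
    (hC : IsBiconnected C)
    (hcard : ∀ a b, Γ.Adj a b → Nat.card (Passage C a b) = 2) (e : W ≃ U) :
    Γ.IsSurfaceWithPeripheral C := by
  obtain ⟨x⟩ := hΓ.nonempty
  obtain ⟨φ, hφ⟩ := exists_mulEquiv hC e x
  refine ⟨surface e hΓ hC hcard, x, inGraph e C x, φ,
    .ofBijective _ (boundaryComponent_bijective hΓ hC hcard), fun k => ?_⟩
  -- The subgroup of the cycle along `p` goes to that of the boundary circle along any path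
  -- homotopic to `p` followed by a spoke.
  have key (i : Fin (C k).len) (p : Γ.Walk x ((C k).toHom i))
      (q : (surface e hΓ hC hcard).skeleton.Walk (inGraph e C x) (inCycle e C k i))
      (hq : graphCls hC e p = (Cls.mk q : CylCls e C _ _) ⬝ spoke e C k i) :
      Subgroup.map φ.toMonoidHom (loopSubgroup ∅ (C k).toHom i p) =
        loopSubgroup (surface e hΓ hC hcard).triangles
          (SimpleGraph.Hom.ofLE (surface e hΓ hC hcard).boundary_le) (inCycle e C k i) q := by
    have conj (γ : (SimpleGraph.cycleGraph (C k).len).Walk i i) :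
        graphCls hC e (p.append ((γ.map (C k).toHom).append p.reverse)) =
          (Cls.mk q : CylCls e C _ _) ⬝ cycleCls e γ ⬝ (Cls.mk q : CylCls e C _ _).inv := by
      rw [graphCls_append, graphCls_append, graphCls_reverse, hq, Cls.inv_comp_rev, Cls.comp_assoc,
        ← Cls.comp_assoc (spoke e C k i), spoke_comp_map, Cls.comp_assoc, Cls.comp_inv_assoc]
    have himage (γ : (SimpleGraph.cycleGraph (C k).len).Walk i i) :
        φ (Pi1.mk (p.append ((γ.map (C k).toHom).append p.reverse))) =
          (Cls.mk q : CylCls e C _ _) ⬝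
            Cls.mk ((γ.map (cycleBoundary hΓ hC hcard k)).map
              (SimpleGraph.Hom.ofLE (surface e hΓ hC hcard).boundary_le)) ⬝
            (Cls.mk q : CylCls e C _ _).inv := by
      refine (hφ _).trans ((conj γ).trans ?_)
      rw [SimpleGraph.Walk.map_map]
      rfl
    ext g
    refine Subgroup.mem_map.trans (Iff.trans ?_ (mem_loopSubgroup _).symm)
    constructor
    · rintro ⟨h, hh, rfl⟩
      obtain ⟨γ, rfl⟩ := (mem_loopSubgroup (C k).toHom).1 hh
      exact ⟨γ.map (cycleBoundary hΓ hC hcard k), himage γ⟩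
    · rintro ⟨ζ, rfl⟩
      obtain ⟨γ, rfl⟩ := exists_map_eq_of_boundary_walk hΓ hC hcard ζ
      exact ⟨Pi1.mk (p.append ((γ.map (C k).toHom).append p.reverse)),
        (mem_loopSubgroup (C k).toHom).2 ⟨γ, rfl⟩, himage γ⟩
  ext H
  constructor
  · rintro ⟨_, ⟨i, p, rfl⟩, rfl⟩
    obtain ⟨q, hq⟩ := Cls.exists_rep (graphCls hC e p ⬝ (spoke e C k i).inv)
    refine ⟨inCycle e C k i, connectedComponentMk_inCycle hΓ hC hcard k i, q, key i p q ?_⟩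
    rw [hq, Cls.comp_assoc, Cls.inv_comp, Cls.comp_nil]
  · rintro ⟨y, hy, q, rfl⟩
    obtain ⟨i, rfl⟩ := exists_eq_inCycle hΓ hC hcard hy
    obtain ⟨p, hp⟩ := exists_comp_eq hC (e := e) (Cls.mk q) (isRetractionPath_inGraph x)
      (isRetractionPath_spoke k i)
    rw [Cls.nil_comp] at hp
    exact ⟨_, ⟨i, p, rfl⟩, key i p q hp⟩

end MappingCylinder

namespace SimpleGraph

theorem IsSurfaceWithPeripheral.of_equiv {W : Type w} {Γ : SimpleGraph W} {ι ι' : Type*}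
    {C : ι → ImmersedCycle Γ} (f : ι' ≃ ι)
    (h : Γ.IsSurfaceWithPeripheral fun k => C (f k)) : Γ.IsSurfaceWithPeripheral C := by
  obtain ⟨S, x, y, φ, β, h⟩ := h
  refine ⟨S, x, y, φ, f.symm.trans β, fun i => ?_⟩
  have := h (f.symm i)
  dsimp only at this
  rwa [f.apply_symm_apply] at this

end SimpleGraph

/-- A biconnected family of cycles that passes every edge twice is the boundary of a surface. -/
theorem ImmersedCycle.IsBiconnected.isSurfaceWithPeripheral {W : Type w} [Finite W]
    {Γ : SimpleGraph W} {ι : Type v} [Finite ι] {C : ι → ImmersedCycle Γ} (hC : IsBiconnected C)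
    (hΓ : Γ.Connected) (hcard : ∀ a b, Γ.Adj a b → Nat.card (Passage C a b) = 2) :
    Γ.IsSurfaceWithPeripheral C := by
  obtain ⟨n, ⟨e⟩⟩ := Finite.exists_equiv_fin W
  obtain ⟨m, ⟨f⟩⟩ := Finite.exists_equiv_fin ι
  let C' : Fin m → ImmersedCycle Γ := fun k => C (f.symm k)
  have hpass (a b : W) : Passage C' a b ≃ Passage C a b :=
    (f.symm.sigmaCongrLeft (β := fun κ => Fin (C κ).len × Fin (C κ).len)).subtypeEquiv
      fun _ => Iff.rfl
  refine .of_equiv f.symm (MappingCylinder.isSurfaceWithPeripheral_of_bijection hΓ (C := C') ?_ ?_ e)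
  · refine ⟨hC.exists_adj, fun v Q hQ => hC.connected v Q ?_,
      fun v u hu Q hQ => hC.no_cut_vertex v u hu Q ?_, fun v w h => ?_⟩
    · intro κ
      obtain ⟨k, rfl⟩ := f.symm.surjective κ
      exact hQ k
    · intro κ
      obtain ⟨k, rfl⟩ := f.symm.surjective κ
      exact hQ k
    · have := hC.nontrivial_passage v w h
      exact (hpass v w).nontrivial
  · intro a b h
    rw [Nat.card_congr (hpass a b), hcard a b h]

/-! ### Surface graphs are those of thickness two -/

theorem mainTheorem10 (X : TubularGraphOfGraphs.{u, v, w}) (hconn : X.UnderlyingConnected)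
    (hBM : X.IsBradyMeier) (s : X.V) :
    X.IsSurfaceGraph s ↔ ∀ e : (X.vertexDouble s).Edge, (X.vertexDouble s).thickness e = 2 := by
  have := X.finite_Vert s
  have := X.finite_incidence s
  have hC := hBM.isBiconnected s
  refine Iff.trans ⟨fun h v w hvw => ?_, fun h => ?_⟩
    (TubularGraphOfGraphs.double_thickness_eq_two_iff ..).symm
  · exact EdgePath.card_passage_eq_two (X.graph_connected s) hC h hvw
  · exact hC.isSurfaceWithPeripheral (X.graph_connected s) h
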